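/- \textbf{Model.} A CoMP user is placed at the origin of $\mathbb R^2$. Base stations $x_1,x_2,\dots$, numbered by increasing distance from the origin, form a homogeneous Poisson point process of density $\lambda_c>0$. Each base station $x_i$ has $K\ge1$ users at positions $x_i+y_{i,k}$, with $y_{i,k}$ uniform in the disk of radius $\mathcal R_c>0$ centred at $0$. The coefficients $h_{i,(j,k)}$ (between base station $i$ and user $k$ of cluster $j$) and $h_{i,0}$ (between base station $i$ and the CoMP user) are Rayleigh fading coefficients with unit mean power. The base station process, all offsets and all fading coefficients are mutually independent. The path loss is $L(r)=r^\alpha$ with $\alpha=4$. In cluster $i$ the user $k_i^*$ maximizing $z_{i,k}=|h_{i,(i,k)}|^2/L(\|y_{i,k}\|)$ is selected as the NOMA user. For $\rho,\phi>0$ the SINR at the nearest base station $x_1$ is $$\mathrm{SINR}=\frac{z_{1,k_1^*}}{I_{\rm CoMP}+I_{\rm inter}+1/\rho},\qquad I_{\rm CoMP}=\frac{\phi|h_{1,0}|^2}{L(\|x_1\|)},\qquad I_{\rm inter}=\sum_{j\ne1}\frac{|h_{1,(j,k_j^*)}|^2}{L(\|y_{j,k_j^*}+x_j-x_1\|)},$$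 and for a target rate $\tilde R>0$ and $\epsilon_1=2^{\tilde R}-1$ the outage probability is $\mathrm P_1^{\rm nearest}=\mathrm P(\mathrm{SINR}<\epsilon_1)$. \textbf{Formula.} For $N\ge1$ and $1\le n\le N$ put $\theta_n=\cos\left(\frac{2n-1}{2N}\pi\right)$, $w_n=\frac{\pi}{2N}\sqrt{1-\theta_n^2}\,(\theta_n+1)$, $c_n=\left(\frac{\mathcal R_c}{2}\theta_n+\frac{\mathcal R_c}{2}\right)^4$, $\tilde w_n=-w_n$, $\tilde c_n=c_n$, and put $\tilde w_0=1$, $\tilde c_0=0$. For $k=(k_0,\dots,k_N)$ put $\mu=\sum_{n=0}^N k_n\tilde c_n$. With $B$ the beta function and $\alpha=4$, let $$Q_N=1+\sum_{\substack{k_0+\cdots+k_N=K\\k_0\ne K}}\binom{K}{k_0,\dots,k_N}\prod_{n=0}^N\tilde w_n^{k_n}e^{-k_n\tilde c_n\epsilon_1/\rho}\;\exp\left(-2\pi\lambda_c\frac{(\epsilon_1\mu)^{2/\alpha}}{\alpha}B\left(\tfrac2\alpha,\tfrac{\alpha-2}\alpha\right)\right)$$ $$\times\int_0^\infty\exp\left(\tfrac12\pi\lambda_c\sqrt{\epsilon_1\mu}\,\arctan\sqrt{-\tfrac12+\tfrac12\sqrt{1+\tfrac{16d^4}{\epsilon_1\mu}}}\right)\frac{1}{1+\phi\epsilon_1\mu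 d^{-4}}\,2\lambda_c\pi d\,e^{-\lambda_c\pi d^2}\,\mathrm dd .$$ \textbf{Proposition 1.} All the integrals in $Q_N$ converge, $I_{\rm inter}$ is almost surely finite, and $\mathrm P_1^{\rm nearest}\approx Q_N$ in the following sense. (1) $Q_N$ is exactly the average over all interference that results when the offsets of the interfering users are neglected and the distribution function of $z_{i,k}$ is replaced by its Gauss--Chebyshev approximation $F_N(z)=1-\sum_{n=1}^N w_ne^{-c_nz}$: for every $N\ge1$, the sum $I^0_{\rm inter}=\sum_{j\neq1}|h_{1,(j,k_j^*)}|^2/L(\|x_j-x_1\|)$ is almost surely finite, $F_N\left(\epsilon_1(I_{\rm CoMP}+I^0_{\rm inter}+1/\rho)\right)^K$ is integrable, and $$\mathbb E\left[F_N\left(\epsilon_1\left(I_{\rm CoMP}+I^0_{\rm inter}+\tfrac1\rho\right)\right)^K\right]=Q_N .$$ (2) The error is small as soon as $N$ is large and clusters are small compared with the distances between base stations, uniformly in all other parameters: for every $K\ge1$ and $\eta>0$ there are $\delta>0$ and $N_0$ such that, for all $\lambda_c,\mathcal R_c,\rho,\phi,\tilde R>0$ and all $N\ge N_0$ with $\mathcal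 R_c\sqrt{\lambda_c}<\delta$, $$\left|\mathrm P_1^{\rm nearest}-Q_N\right|<\eta .$$ -/

import Mathlib

open MeasureTheory ProbabilityTheory Set

noncomputable section

/-- The plane in which base stations and users are placed. -/
abbrev Plane : Type := EuclideanSpace ℝ (Fin 2)

/-- The law of `‖h‖` for a Rayleigh fading coefficient `h` with unit mean power:
density `2 r exp (-r ^ 2)` on `r ≥ 0`, so that `‖h‖ ^ 2` has density `exp (-x)` on `x ≥ 0`. -/
def rayleighLaw : Measure ℝ :=
  volume.withDensity
    (fun r : ℝ => ENNReal.ofReal (if 0 ≤ r then 2 * r * Real.exp (-r ^ 2) else 0))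

/-- The number of points of the random sequence `x` that lie in `B`, with multiplicity. -/
def pointCount {Ω : Type*} (x : ℕ → Ω → Plane) (B : Set Plane) (ω : Ω) : ℕ∞ :=
  {i : ℕ | x i ω ∈ B}.encard

/-- The points `x 0, x 1, …` form a homogeneous Poisson point process of density `lam`:
the number of points in a Borel set of finite area is Poisson with mean `lam` times the area,
and the numbers of points in pairwise disjoint such sets are independent. -/
structure IsHPPP {Ω : Type*} [MeasurableSpace Ω] (μ : Measure Ω) (lam : ℝ)
    (x : ℕ → Ω → Plane) : Prop where
  measurable_point : ∀ i, Measurable (x i)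
  count_law : ∀ B : Set Plane, MeasurableSet B → volume B < ⊤ →
    μ.map (pointCount x B) =
      (poissonMeasure (lam * volume.real B).toNNReal).map (fun n : ℕ => (n : ℕ∞))
  count_indep : ∀ (m : ℕ) (B : Fin m → Set Plane), (∀ a, MeasurableSet (B a)) →
    (∀ a, volume (B a) < ⊤) → Pairwise (fun a b => Disjoint (B a) (B b)) →
    iIndepFun (fun a => pointCount x (B a)) μ

/-- The random quantities of the uplink network. The CoMP user sits at the origin.
* `bs i` is the position of the `i`-th base station;
* `user i k` is the position of the `k`-th user of cluster `i` relative to `bs i`;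
* `chan i j k` is the fading coefficient between base station `i` and user `k` of cluster `j`;
* `chanCoMP i` is the fading coefficient between base station `i` and the CoMP user. -/
structure Network (Ω : Type*) (K : ℕ) where
  bs : ℕ → Ω → Plane
  user : ℕ → Fin K → Ω → Plane
  chan : ℕ → ℕ → Fin K → Ω → ℂ
  chanCoMP : ℕ → Ω → ℂ

namespace Network

variable {Ω : Type*} {K : ℕ}

/-- The probabilistic model: the base stations form a homogeneous Poisson point process of density
`lam` and are numbered by increasing distance from the CoMP user (so index `0` is the nearest
one); the users of a cluster are uniform in a disk of radius `Rc` around their base station;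
all fading coefficients are Rayleigh with unit mean power; and the base station process, all user
offsets and all fading coefficients are mutually independent. -/
structure IsModel [MeasurableSpace Ω] (S : Network Ω K) (μ : Measure Ω) (lam Rc : ℝ) :
    Prop where
  bs_poisson : IsHPPP μ lam S.bs
  bs_ordered : ∀ᵐ ω ∂μ, Monotone (fun i => ‖S.bs i ω‖)
  user_meas : ∀ i k, Measurable (S.user i k)
  user_law : ∀ i k, pdf.IsUniform (S.user i k) (Metric.closedBall (0 : Plane) Rc) μ volume
  user_indep : iIndepFun (fun p : ℕ × Fin K => S.user p.1 p.2) μ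
  chan_meas : ∀ i j k, Measurable (S.chan i j k)
  chan_law : ∀ i j k, μ.map (fun ω => ‖S.chan i j k ω‖) = rayleighLaw
  chan_indep : iIndepFun (fun p : ℕ × ℕ × Fin K => S.chan p.1 p.2.1 p.2.2) μ
  chanCoMP_meas : ∀ i, Measurable (S.chanCoMP i)
  chanCoMP_law : ∀ i, μ.map (fun ω => ‖S.chanCoMP i ω‖) = rayleighLaw
  chanCoMP_indep : iIndepFun S.chanCoMP μ
  bs_indep_rest : IndepFun (fun ω i => S.bs i ω)
    (fun ω => ((fun i k => S.user i k ω), (fun i j k => S.chan i j k ω),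
      (fun i => S.chanCoMP i ω))) μ
  user_indep_chan : IndepFun (fun ω i k => S.user i k ω)
    (fun ω => ((fun i j k => S.chan i j k ω), (fun i => S.chanCoMP i ω))) μ
  chan_indep_chanCoMP : IndepFun (fun ω i j k => S.chan i j k ω)
    (fun ω i => S.chanCoMP i ω) μ

/-- The path loss `L(r) = r ^ α`. -/
def pathLoss (α r : ℝ) : ℝ := r ^ α

/-- The composite channel gain between base station `i` and user `k` of its own cluster. -/
def gain (S : Network Ω K) (α : ℝ) (i : ℕ) (ω : Ω) (k : Fin K) : ℝ :=
  ‖S.chan i i k ω‖ ^ 2 / pathLoss α ‖S.user i k ω‖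

/-- The user of cluster `i` with the largest composite channel gain: the NOMA user. -/
def selected [NeZero K] (S : Network Ω K) (α : ℝ) (i : ℕ) (ω : Ω) : Fin K :=
  Classical.choose (Finite.exists_max (S.gain α i ω))

/-- Interference from the CoMP user at base station `i`; `φ` is the ratio of the transmission
powers of the CoMP user and of the NOMA users. -/
def interCoMP (S : Network Ω K) (α φ : ℝ) (i : ℕ) (ω : Ω) : ℝ :=
  φ * ‖S.chanCoMP i ω‖ ^ 2 / pathLoss α ‖S.bs i ω‖

/-- A term of the inter-cell interference at base station `i`: the power received from
the NOMA user of cluster `j`. -/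
def interTerm [NeZero K] (S : Network Ω K) (α : ℝ) (i j : ℕ) (ω : Ω) : ℝ :=
  ‖S.chan i j (S.selected α j ω) ω‖ ^ 2 /
    pathLoss α ‖S.user j (S.selected α j ω) ω + S.bs j ω - S.bs i ω‖

/-- The inter-cell interference at base station `i`. -/
def interCell [NeZero K] (S : Network Ω K) (α : ℝ) (i : ℕ) (ω : Ω) : ℝ :=
  ∑' j : {j : ℕ // j ≠ i}, S.interTerm α i j ω

/-- The term `interTerm` with the interfering user moved to its base station. -/
def interTermBS [NeZero K] (S : Network Ω K) (α : ℝ) (i j : ℕ) (ω : Ω) : ℝ :=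
  ‖S.chan i j (S.selected α j ω) ω‖ ^ 2 / pathLoss α ‖S.bs j ω - S.bs i ω‖

/-- The inter-cell interference at base station `i`, with the offsets of the interfering users
from their base stations neglected. -/
def interCellBS [NeZero K] (S : Network Ω K) (α : ℝ) (i : ℕ) (ω : Ω) : ℝ :=
  ∑' j : {j : ℕ // j ≠ i}, S.interTermBS α i j ω

/-- The SINR with which base station `i` decodes its NOMA user; `ρ` is the normalized
transmission power of the NOMA users. -/
def sinr [NeZero K] (S : Network Ω K) (α ρ φ : ℝ) (i : ℕ) (ω : Ω) : ℝ :=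
  S.gain α i ω (S.selected α i ω) / (S.interCoMP α φ i ω + S.interCell α i ω + 1 / ρ)

/-- The outage probability of the NOMA user of the base station nearest to the CoMP user,
for the SINR threshold `ε`. -/
def nearestOutage [NeZero K] [MeasurableSpace Ω] (S : Network Ω K) (μ : Measure Ω)
    (α ρ φ ε : ℝ) : ℝ :=
  μ.real {ω | S.sinr α ρ φ 0 ω < ε}

end Network

/-- The Gauss–Chebyshev node `θ_n = cos ((2 n - 1) π / (2 N))`. -/
def chebNode (N n : ℕ) : ℝ := Real.cos ((2 * (n : ℝ) - 1) / (2 * (N : ℝ)) * Real.pi)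

/-- `w_n = π / (2 N) * √(1 - θ_n ^ 2) * (θ_n + 1)`. -/
def chebWeight (N n : ℕ) : ℝ :=
  Real.pi / (2 * (N : ℝ)) * Real.sqrt (1 - chebNode N n ^ 2) * (chebNode N n + 1)

/-- `c_n = (Rc / 2 * θ_n + Rc / 2) ^ α`. -/
def chebRate (α Rc : ℝ) (N n : ℕ) : ℝ := (Rc / 2 * chebNode N n + Rc / 2) ^ α

/-- The Gauss–Chebyshev approximation `1 - ∑ w_n exp (-c_n z)` of the distribution function of
an unordered composite channel gain. -/
def chebCDF (α Rc : ℝ) (N : ℕ) (z : ℝ) : ℝ :=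
  1 - ∑ n ∈ Finset.Icc 1 N, chebWeight N n * Real.exp (-(chebRate α Rc N n * z))

/-- `w̃_0 = 1` and `w̃_n = -w_n` for `1 ≤ n ≤ N`. -/
def signedWeight (N n : ℕ) : ℝ := if n = 0 then 1 else -chebWeight N n

/-- `c̃_0 = 0` and `c̃_n = c_n` for `1 ≤ n ≤ N`. -/
def extRate (α Rc : ℝ) (N n : ℕ) : ℝ := if n = 0 then 0 else chebRate α Rc N n

/-- `μ = ∑ k_n c̃_n`. -/
def totalRate (α Rc : ℝ) (N : ℕ) (k : Fin (N + 1) → ℕ) : ℝ :=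
  ∑ n : Fin (N + 1), (k n : ℝ) * extRate α Rc N n

/-- The integrand over the distance `d` from the CoMP user to its nearest base station,
for path loss exponent `4`, where `s = ε μ`. -/
def nearestIntegrand (lam φ s d : ℝ) : ℝ :=
  Real.exp (1 / 2 * Real.pi * lam * Real.sqrt s *
      Real.arctan (Real.sqrt (-(1 / 2) + 1 / 2 * Real.sqrt (1 + 16 * d ^ 4 / s)))) *
    (1 / (1 + φ * s * (d ^ 4)⁻¹)) *
    (2 * lam * Real.pi * d * Real.exp (-(lam * Real.pi * d ^ 2)))

/-- The approximate single-integral expression for the outage probability, for path loss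
exponent `4`. -/
def nearestOutageApprox (K N : ℕ) (lam Rc ρ φ ε : ℝ) : ℝ :=
  1 + ∑ k ∈ (Finset.piAntidiag (Finset.univ : Finset (Fin (N + 1))) K).filter
      (fun k => k 0 ≠ K),
    (Nat.multinomial Finset.univ k : ℝ) *
      (∏ n : Fin (N + 1), signedWeight N n ^ k n *
        Real.exp (-((k n : ℝ) * extRate 4 Rc N n * ε * (1 / ρ)))) *
      Real.exp (-(2 * Real.pi * lam * ((ε * totalRate 4 Rc N k) ^ ((2 : ℝ) / 4) / 4) *
        ProbabilityTheory.beta (2 / 4) ((4 - 2) / 4))) *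
      ∫ d in Ioi (0 : ℝ), nearestIntegrand lam φ (ε * totalRate 4 Rc N k) d

end

open Filter Topology

noncomputable section

/-! The gains in the nearest cluster are independent of everything that enters the interference.
Given the level `T = ε (I_CoMP + I_inter + 1/ρ)`, all `K` gains stay below it with probability `F(T)
^ K`, where `F` is the distribution function of one gain (`gainCDF`). So the outage probability is
`E [F(T) ^ K]` (`nearestOutage_eq`). The formula is the same expectation after two substitutions:
`T'`, with the interfering users moved to their stations, for `T`, and the quadrature `F_N` for `F`.

Exactness. `F_N ^ K` is a signed combination of exponentials, so `E [F_N(T') ^ K]` reduces to the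
Laplace transform of the interference at `s = ε μ`. The choice of a NOMA user does not involve its
channel to a foreign station, so every interfering power is still a unit exponential. Given the
stations, the transform is therefore a product of factors `d ^ 4 / (d ^ 4 + s)`. For a Poisson
process with nearest point `x`, the disk of radius `‖x‖` is void, which costs `exp (-λ π ‖x‖ ^ 2)`,
and the points outside contribute the Poisson Laplace functional (`integral_nearest`). What remains
is the integral of `s / (‖y - x‖ ^ 4 + s)` over `‖x‖ < ‖y‖`. The whole plane gives the factor with
the beta function. The missing disk is computed in polar coordinates about `x` and leads to `∫
arctan (a cos² θ)`, which is evaluated by factoring `1 + i a cos² θ` and using the mean value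
property of the logarithm.

Finiteness. As `s → 0` the Laplace transform tends to `1`, so the interference is almost surely
finite when the users sit at their stations. The true interference is compared with it far away,
where the offsets are negligible.

Error. Changing the argument of `F` by a factor at most `κ` changes `F` by at most `κ - 1`, whatever
`Rc` is. If no station lies within `Rc / β` of the nearest one, neglecting the offsets changes `T`
by a factor at most `(1 - β) ^ (-4)`. A closer station exists with probability at most `π² λ (Rc /
β) ^ 2`, which is small with `Rc √λ`. Finally, for radii written as `Rc / 2 * (cos u + 1)`, the
Gauss–Chebyshev sum is the midpoint rule on `[0, π]` for a Lipschitz weight times a monotone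
function with values in `[0, 1]`. Its error is at most `(π² + π) / N`, uniformly in all parameters.
-/

/-! ### The integral of `arctan (a cos² θ)`. -/

open Complex in
lemma integral_log_one_add_mul_circleMap {q : ℂ} (hq : ‖q‖ < 1) :
    ∫ θ in (0 : ℝ)..2 * Real.pi, (Complex.log (1 + q * circleMap 0 1 θ)).im = 0 := by
  have hs : ∀ z ∈ Metric.closedBall (0 : ℂ) 1, 1 + q * z ∈ slitPlane := fun z hz => by
    left
    have h1 : ‖q * z‖ < 1 := by
      rw [norm_mul]
      exact mul_lt_one_of_nonneg_of_lt_one_left (norm_nonneg _) hq (by simpa using hz)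
    have h2 := (abs_lt.1 ((Complex.abs_re_le_norm (q * z)).trans_lt h1)).1
    simp only [add_re, one_re]; linarith
  -- `log (1 + q z)` is holomorphic on the closed unit disk, so its mean over the circle is its
  -- value `log 1 = 0` at the centre.
  have hd : DiffContOnCl ℂ (fun z => Complex.log (1 + q * z)) (Metric.ball 0 |1|) := by
    refine DifferentiableOn.diffContOnCl fun z hz => ?_
    rw [abs_one, closure_ball _ one_ne_zero] at hz
    exact ((by fun_prop : DifferentiableAt ℂ (fun z => 1 + q * z) z).clog
      (hs z hz)).differentiableWithinAt
  have h := hd.circleAverage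
  rw [Real.circleAverage_def] at h
  simp only [mul_zero, add_zero, Complex.log_one, smul_eq_zero, inv_eq_zero, mul_eq_zero,
    OfNat.ofNat_ne_zero, Real.pi_ne_zero, or_self, false_or] at h
  have hc : Continuous fun θ => Complex.log (1 + q * circleMap 0 1 θ) :=
    continuous_iff_continuousAt.2 fun θ => ContinuousAt.clog (by fun_prop)
      (hs _ (circleMap_mem_closedBall 0 zero_le_one θ))
  have h2 := Complex.imCLM.intervalIntegral_comp_comm
    (hc.intervalIntegrable (μ := volume) 0 (2 * Real.pi))
  rw [h] at h2
  simpa using h2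

/-- The hypotheses say `R exp (i S) = 1 + i y`, so `cos S > 0`. On `(-π, 3π/2)` this happens only on
the principal branch `(-π/2, π/2)`. -/
lemma arctan_eq_of_mul_cos_sin {R S y : ℝ} (hR : 0 < R) (hc : R * Real.cos S = 1)
    (hs : R * Real.sin S = y) (h1 : -Real.pi < S) (h2 : S < 3 * Real.pi / 2) :
    Real.arctan y = S := by
  have hcos : 0 < Real.cos S := by
    by_contra h
    nlinarith [not_lt.1 h]
  have hS1 : -(Real.pi / 2) < S := by
    by_contra h
    have := Real.cos_nonpos_of_pi_div_two_le_of_le (x := -S) (by linarith [not_lt.1 h])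
      (by linarith [Real.pi_pos])
    rw [Real.cos_neg] at this
    linarith
  have hS2 : S < Real.pi / 2 := by
    by_contra h
    have := Real.cos_nonpos_of_pi_div_two_le_of_le (x := S) (by linarith [not_lt.1 h])
      (by linarith [Real.pi_pos])
    linarith
  have ht : y = Real.tan S := by
    rw [Real.tan_eq_sin_div_cos, eq_div_iff hcos.ne', ← hs]
    calc R * Real.sin S * Real.cos S = (R * Real.cos S) * Real.sin S := by ring
      _ = _ := by rw [hc, one_mul]
  rw [ht, Real.arctan_tan hS1 hS2]

-- With `w = p + i y` the square root of `1 + i a` and `q = (w - 1) / (w + 1)`, one has `1 + i a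
-- cos² θ = (1 + p)/2 * (1 + i y) * (1 + q e) * (1 + q e')` for `e = exp (2 i θ)` and `e' = exp (-2
-- i θ)`. Taking arguments, the left side gives the integrand, `1 + i y` gives the constant `arctan
-- y`, and the last two factors integrate to zero because `‖q‖ < 1`.
open Complex in
theorem integral_arctan_mul_cos_sq {a : ℝ} (ha : 0 ≤ a) :
    ∫ θ in -(Real.pi / 2)..Real.pi / 2, Real.arctan (a * Real.cos θ ^ 2) =
      Real.pi * Real.arctan (Real.sqrt (-(1 / 2) + 1 / 2 * Real.sqrt (1 + a ^ 2))) := by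
  set t := Real.sqrt (1 + a ^ 2) with ht
  have ht2 : t ^ 2 = 1 + a ^ 2 := Real.sq_sqrt (by positivity)
  have ht1 : 1 ≤ t := Real.one_le_sqrt.2 (by nlinarith)
  set y := Real.sqrt (-(1 / 2) + 1 / 2 * t) with hy
  set p := Real.sqrt (1 / 2 + 1 / 2 * t) with hp
  have hy2 : y ^ 2 = -(1 / 2) + 1 / 2 * t := Real.sq_sqrt (by linarith)
  have hp2 : p ^ 2 = 1 / 2 + 1 / 2 * t := Real.sq_sqrt (by linarith)
  have hp0 : 0 < p := Real.sqrt_pos.2 (by linarith)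
  have hy0 : 0 ≤ y := Real.sqrt_nonneg _
  have hpy : 2 * p * y = a := by
    have : (2 * p * y) ^ 2 = a ^ 2 := by
      rw [mul_pow, mul_pow, hy2, hp2]; linear_combination ht2
    exact (pow_left_inj₀ (by positivity) ha two_ne_zero).1 this
  set w : ℂ := ⟨p, y⟩ with hw
  have hw2 : w ^ 2 = 1 + a * I := by
    apply Complex.ext
    · simp [hw, sq]; nlinarith
    · simp [hw, sq]; linarith
  have hwre : w.re = p := rfl
  have hw1 : w + 1 ≠ 0 := fun h => by
    have := congrArg Complex.re h
    simp [hwre] at this; linarith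
  set q : ℂ := (w - 1) / (w + 1) with hqdef
  have hq : ‖q‖ < 1 := by
    rw [hqdef, norm_div, div_lt_one (norm_pos_iff.2 hw1)]
    refine lt_of_pow_lt_pow_left₀ 2 (norm_nonneg _) ?_
    rw [← Complex.normSq_eq_norm_sq, ← Complex.normSq_eq_norm_sq, normSq_apply, normSq_apply]
    simp [hw]; nlinarith
  -- The constant factor `(1 + p)/2 * (1 + i y)` is `(w + 1)² / 4`. After multiplying out, only `e
  -- e' = 1` and `w² = 1 + i a` are needed.
  have hfac : ∀ e e' : ℂ, e * e' = 1 →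
      ((1 + p) / 2 : ℝ) * (1 + y * I) * (1 + q * e) * (1 + q * e') =
        1 + a * I * ((2 + e + e') / 4) := fun e e' he => by
    have hc : (((1 + p) / 2 : ℝ) : ℂ) * (1 + y * I) = (w + 1) ^ 2 / 4 := by
      have e1 : (w + 1) ^ 2 = w ^ 2 + 2 * w + 1 := by ring
      have e2 : w = p + y * I := by apply Complex.ext <;> simp [hw]
      rw [e1, hw2, e2, ← hpy]
      push_cast; ring
    rw [hc, hqdef]
    have : a * I = w ^ 2 - 1 := by rw [hw2]; ring
    rw [this]
    field_simp
    linear_combination ((w - 1) ^ 2) * he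
  have hre : ∀ z : ℂ, ‖z‖ = 1 → 0 < (1 + q * z).re := fun z hz => by
    have h1 : ‖q * z‖ < 1 := by rw [norm_mul, hz, mul_one]; exact hq
    have h2 := (abs_lt.1 ((Complex.abs_re_le_norm (q * z)).trans_lt h1)).1
    simp only [add_re, one_re]; linarith
  set U : ℝ → ℝ := fun φ => (Complex.log (1 + q * circleMap 0 1 φ)).im with hU
  have hUc : Continuous U :=
    Complex.continuous_im.comp (continuous_iff_continuousAt.2 fun θ => ContinuousAt.clog
      (by fun_prop) (Or.inl (hre _ (by simp))))
  -- The argument of a product is the sum of the arguments only modulo `2π`. Here `arctan y` is in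
  -- `[0, π/2)` and the other two are in `(-π/2, π/2)`, so the sum lies in `(-π, 3π/2)`. The
  -- conjugate angle is written `2π - 2θ` so that it too sweeps `[0, 2π]`.
  have hpt : ∀ θ, Real.arctan (a * Real.cos θ ^ 2) =
      Real.arctan y + U (2 * θ) + U (2 * Real.pi - 2 * θ) := fun θ => by
    set e := circleMap 0 1 (2 * θ)
    set e' := circleMap 0 1 (2 * Real.pi - 2 * θ)
    have hee : e * e' = 1 := by
      simp only [e, e', circleMap_zero]
      push_cast
      simp only [one_mul]
      rw [← Complex.exp_add]
      rw [show (2 * θ * I + (2 * Real.pi - 2 * θ) * I : ℂ) = 2 * Real.pi * I by ring,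
        Complex.exp_two_pi_mul_I]
    have hcos : (2 + e + e') / 4 = ((Real.cos θ ^ 2 : ℝ) : ℂ) := by
      have e3 : e' = Complex.exp (-(2 * θ) * I) := by
        simp only [e', circleMap_zero]
        push_cast
        rw [one_mul, sub_mul, Complex.exp_sub, Complex.exp_two_pi_mul_I, neg_mul, Complex.exp_neg,
          one_div]
      have e4 : e = Complex.exp ((2 * θ) * I) := by
        simp only [e, circleMap_zero]; push_cast; rw [one_mul]
      rw [Real.cos_sq]
      push_cast
      rw [e3, e4, Complex.cos]
      ring
    have hz1 := hre e (by simp [e])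
    have hz2 := hre e' (by simp [e'])
    have key := hfac e e' hee
    rw [hcos] at key
    have hb1 := abs_lt.1 (Complex.abs_arg_lt_pi_div_two_iff.2 (Or.inl hz1))
    have hb2 := abs_lt.1 (Complex.abs_arg_lt_pi_div_two_iff.2 (Or.inl hz2))
    have hA1 : 0 ≤ Real.arctan y := Real.arctan_nonneg.2 hy0
    have hA2 := Real.arctan_lt_pi_div_two y
    have hyI : (1 : ℂ) + y * I = (Real.sqrt (1 + y ^ 2) : ℝ) * Complex.exp (Real.arctan y * I) := by
      have hs : Real.sqrt (1 + y ^ 2) ≠ 0 := (Real.sqrt_pos.2 (by positivity)).ne'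
      apply Complex.ext
      · rw [Complex.re_ofReal_mul, Complex.exp_ofReal_mul_I_re, Real.cos_arctan,
          mul_one_div_cancel hs]
        simp
      · rw [Complex.im_ofReal_mul, Complex.exp_ofReal_mul_I_im, Real.sin_arctan,
          mul_div_cancel₀ _ hs]
        simp
    have hS : Real.arctan y + U (2 * θ) + U (2 * Real.pi - 2 * θ) =
        Real.arctan y + (1 + q * e).arg + (1 + q * e').arg := by
      simp only [hU, Complex.log_im]; rfl
    rw [hS]
    set R := (1 + p) / 2 * Real.sqrt (1 + y ^ 2) * ‖1 + q * e‖ * ‖1 + q * e'‖ with hR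
    have hR0 : 0 < R := by
      have n1 : 0 < ‖1 + q * e‖ := norm_pos_iff.2 fun h => by simp [h] at hz1
      have n2 : 0 < ‖1 + q * e'‖ := norm_pos_iff.2 fun h => by simp [h] at hz2
      positivity
    have hprod : (R : ℂ) * Complex.exp ((Real.arctan y + (1 + q * e).arg + (1 + q * e').arg : ℝ)
        * I) = 1 + a * I * ((Real.cos θ ^ 2 : ℝ) : ℂ) := by
      rw [← key, hyI]
      conv_rhs => rw [← Complex.norm_mul_exp_arg_mul_I (1 + q * e),
        ← Complex.norm_mul_exp_arg_mul_I (1 + q * e')]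
      rw [hR]
      push_cast
      rw [add_mul, add_mul, Complex.exp_add, Complex.exp_add]
      ring
    have r1 := congrArg Complex.re hprod
    have r2 := congrArg Complex.im hprod
    rw [Complex.re_ofReal_mul, Complex.exp_ofReal_mul_I_re] at r1
    rw [Complex.im_ofReal_mul, Complex.exp_ofReal_mul_I_im] at r2
    refine arctan_eq_of_mul_cos_sin hR0 (r1.trans ?_) (r2.trans ?_) (by linarith) (by linarith)
    · simp [-Complex.ofReal_pow]
    · simp [-Complex.ofReal_pow]
  have hper : Function.Periodic (fun θ => Real.arctan (a * Real.cos θ ^ 2)) Real.pi := fun θ => by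
    simp [Real.cos_add_pi]
  have hsh := hper.intervalIntegral_add_eq (-(Real.pi / 2)) 0
  rw [show -(Real.pi / 2) + Real.pi = Real.pi / 2 by ring, zero_add] at hsh
  rw [hsh]
  simp_rw [hpt]
  have i1 : ∫ θ in (0 : ℝ)..Real.pi, U (2 * θ) = 0 := by
    rw [intervalIntegral.integral_comp_mul_left (fun φ => U φ) two_ne_zero, mul_zero,
      integral_log_one_add_mul_circleMap hq, smul_zero]
  have i2 : ∫ θ in (0 : ℝ)..Real.pi, U (2 * Real.pi - 2 * θ) = 0 := by
    rw [intervalIntegral.integral_comp_sub_mul (fun φ => U φ) two_ne_zero, mul_zero, sub_self,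
      sub_zero, integral_log_one_add_mul_circleMap hq, smul_zero]
  rw [intervalIntegral.integral_add, intervalIntegral.integral_add, i1, i2]
  · simp
  all_goals exact Continuous.intervalIntegrable (by fun_prop) _ _

/-! ### Integrals of `s / (‖y - x‖ ^ 4 + s)` over the plane and over a disk. -/

lemma hasDerivAt_arctan_sq_div {s : ℝ} (hs : 0 < s) (r : ℝ) :
    HasDerivAt (fun r => Real.sqrt s / 2 * Real.arctan (r ^ 2 / Real.sqrt s))
      (r * (s / (r ^ 4 + s))) r := by
  have h1 : 0 < Real.sqrt s := Real.sqrt_pos.2 hs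
  have h2 : Real.sqrt s ^ 2 = s := Real.sq_sqrt hs.le
  refine ((((hasDerivAt_pow 2 r).div_const (Real.sqrt s)).arctan).const_mul
    (Real.sqrt s / 2)).congr_deriv ?_
  have h3 : r ^ 4 + s ≠ 0 := by positivity
  have h4 : 1 + (r ^ 2 / Real.sqrt s) ^ 2 = (r ^ 4 + s) / s := by
    rw [div_pow, h2]; field_simp; ring
  rw [h4]
  field_simp
  simp

lemma integral_Ioi_mul_div_pow_four_add {s : ℝ} (hs : 0 < s) :
    IntegrableOn (fun r : ℝ => r * (s / (r ^ 4 + s))) (Ioi 0) ∧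
      ∫ r in Ioi (0 : ℝ), r * (s / (r ^ 4 + s)) = Real.pi * Real.sqrt s / 4 := by
  have h1 : 0 < Real.sqrt s := Real.sqrt_pos.2 hs
  have hlim : Tendsto (fun r : ℝ => Real.sqrt s / 2 * Real.arctan (r ^ 2 / Real.sqrt s)) atTop
      (𝓝 (Real.sqrt s / 2 * (Real.pi / 2))) :=
    ((tendsto_nhds_of_tendsto_nhdsWithin Real.tendsto_arctan_atTop).comp
      ((tendsto_pow_atTop two_ne_zero).atTop_div_const h1)).const_mul _
  have hpos : ∀ r ∈ Ioi (0 : ℝ), 0 ≤ r * (s / (r ^ 4 + s)) := fun r hr => by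
    have : 0 < r := hr
    positivity
  refine ⟨integrableOn_Ioi_deriv_of_nonneg' (fun r _ => hasDerivAt_arctan_sq_div hs r) hpos hlim, ?_⟩
  rw [integral_Ioi_of_hasDerivAt_of_nonneg' (fun r _ => hasDerivAt_arctan_sq_div hs r) hpos hlim]
  simp; ring

lemma volume_real_ball_plane (x : Plane) {r : ℝ} (hr : 0 ≤ r) :
    volume.real (Metric.ball x r) = Real.pi * r ^ 2 := by
  rw [measureReal_def, EuclideanSpace.volume_ball]
  have : Real.Gamma (1 + 1) = 1 := by rw [one_add_one_eq_two, Real.Gamma_two]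
  simp [hr, Real.pi_pos.le, Real.sq_sqrt, this]
  ring

lemma integral_fun_norm_plane (f : ℝ → ℝ) :
    ∫ x : Plane, f ‖x‖ = 2 * Real.pi * ∫ r in Ioi (0 : ℝ), r * f r := by
  rw [integral_fun_norm_addHaar volume f]
  rw [volume_real_ball_plane _ zero_le_one]
  simp [mul_assoc]

lemma integrable_fun_norm_plane {f : ℝ → ℝ} :
    Integrable (fun x : Plane => f ‖x‖) ↔ IntegrableOn (fun r => r * f r) (Ioi 0) := by
  rw [integrable_fun_norm_addHaar volume (f := f)]
  simp

lemma integrable_div_norm_pow_four_add {s : ℝ} (hs : 0 < s) :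
    Integrable fun x : Plane => s / (‖x‖ ^ 4 + s) :=
  (integrable_fun_norm_plane (f := fun r => s / (r ^ 4 + s))).2
    (integral_Ioi_mul_div_pow_four_add hs).1

lemma integral_div_norm_pow_four_add {s : ℝ} (hs : 0 < s) :
    ∫ x : Plane, s / (‖x‖ ^ 4 + s) = Real.pi ^ 2 * Real.sqrt s / 2 := by
  rw [integral_fun_norm_plane (fun r => s / (r ^ 4 + s)), (integral_Ioi_mul_div_pow_four_add hs).2]
  ring

lemma exists_linearIsometryEquiv_complex (x : Plane) :
    ∃ T : Plane ≃ₗᵢ[ℝ] ℂ, T x = ‖x‖ := by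
  let T0 : Plane ≃ₗᵢ[ℝ] ℂ := Complex.orthonormalBasisOneI.repr.symm
  refine ⟨T0.trans (rotation (Circle.exp (-(T0 x).arg))), ?_⟩
  rw [LinearIsometryEquiv.trans_apply, rotation_apply, Circle.coe_exp]
  have h := Complex.norm_mul_exp_arg_mul_I (T0 x)
  rw [T0.norm_map] at h
  generalize (T0 x).arg = ψ at h ⊢
  rw [← h, mul_left_comm, ← Complex.exp_add]
  simp

lemma norm_polarCoord_symm_sub_le_iff {d r θ : ℝ} (hr : 0 < r) (hd : 0 ≤ d) :
    ‖(d : ℂ) - Complex.polarCoord.symm (r, θ)‖ ≤ d ↔ r ≤ 2 * d * Real.cos θ := by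
  rw [← pow_le_pow_iff_left₀ (norm_nonneg _) hd two_ne_zero, ← Complex.normSq_eq_norm_sq,
    Complex.normSq_apply, Complex.polarCoord_symm_apply]
  simp only [Complex.sub_re, Complex.sub_im, Complex.mul_re, Complex.mul_im, Complex.add_re,
    Complex.add_im, Complex.ofReal_re, Complex.ofReal_im, Complex.I_re, Complex.I_im]
  have h1 := Real.sin_sq_add_cos_sq θ
  have h2 : (d - (r * (Real.cos θ + (Real.sin θ * 0 - 0 * 1)) -
      0 * (0 + (Real.sin θ * 1 + 0 * 0)))) *
      (d - (r * (Real.cos θ + (Real.sin θ * 0 - 0 * 1)) - 0 * (0 + (Real.sin θ * 1 + 0 * 0)))) +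
      (0 - (r * (0 + (Real.sin θ * 1 + 0 * 0)) + 0 * (Real.cos θ + (Real.sin θ * 0 - 0 * 1)))) *
      (0 - (r * (0 + (Real.sin θ * 1 + 0 * 0)) + 0 * (Real.cos θ + (Real.sin θ * 0 - 0 * 1)))) =
      d ^ 2 + r * (r - 2 * d * Real.cos θ) := by
    linear_combination r ^ 2 * h1
  rw [h2]
  constructor
  · intro h
    have : r * (r - 2 * d * Real.cos θ) ≤ 0 := by linarith
    by_contra hc
    have := mul_pos hr (sub_pos.2 (not_le.1 hc))
    linarith
  · intro h
    have := mul_nonneg hr.le (sub_nonneg.2 h)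
    linarith

/-- Seen from `x`, the disk has the origin on its boundary circle. After rotating `x` to the
positive axis it is `r ≤ 2 d cos θ` in polar coordinates. The radial integral is `√s / 2 * arctan (4
d² cos² θ / √s)`, which leaves the angular integral computed above. -/
lemma setIntegral_closedBall_div {s : ℝ} (hs : 0 < s) (x : Plane) :
    ∫ y in Metric.closedBall (0 : Plane) ‖x‖, s / (‖y - x‖ ^ 4 + s) =
      1 / 2 * Real.pi * Real.sqrt s * Real.arctan (Real.sqrt (-(1 / 2) +
        1 / 2 * Real.sqrt (1 + 16 * ‖x‖ ^ 4 / s))) := by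
  obtain ⟨T, hT⟩ := exists_linearIsometryEquiv_complex x
  set d := ‖x‖ with hd
  have hd0 : 0 ≤ d := norm_nonneg x
  set G : ℂ → ℝ := {z : ℂ | ‖(d : ℂ) - z‖ ≤ d}.indicator fun z => s / (‖z‖ ^ 4 + s) with hG
  have e1 : ∫ y in Metric.closedBall (0 : Plane) d, s / (‖y - x‖ ^ 4 + s) = ∫ z, G z := by
    rw [← integral_indicator Metric.isClosed_closedBall.measurableSet,
      ← integral_sub_left_eq_self _ volume x,
      ← T.measurePreserving.integral_comp T.toHomeomorph.measurableEmbedding]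
    refine integral_congr_ae (Eventually.of_forall fun v => ?_)
    have h1 : ‖(d : ℂ) - T v‖ = ‖x - v‖ := by rw [← hT, ← map_sub, T.norm_map]
    have h2 : x - v - x = -v := by abel
    simp only [hG, indicator, mem_ofPred_eq, h1, T.norm_map, mem_closedBall_zero_iff, h2, norm_neg]
  rw [e1, ← Complex.integral_comp_polarCoord_symm]
  set H : ℝ × ℝ → ℝ := fun p => if p.1 ≤ 2 * d * Real.cos p.2 then p.1 * (s / (p.1 ^ 4 + s)) else 0
    with hH
  have ht : polarCoord.target = Ioi (0 : ℝ) ×ˢ Ioo (-Real.pi) Real.pi := rfl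
  have e2 : ∀ p ∈ polarCoord.target, p.1 • G (Complex.polarCoord.symm p) = H p := fun p hp => by
    have hr : 0 < p.1 := hp.1
    simp only [hG, indicator, mem_ofPred_eq]
    rw [show p = (p.1, p.2) from rfl, if_congr (norm_polarCoord_symm_sub_le_iff hr hd0) rfl rfl,
      Complex.norm_polarCoord_symm]
    simp only [hH, smul_eq_mul, abs_of_pos hr]
    split_ifs <;> simp
  rw [setIntegral_congr_fun polarCoord.open_target.measurableSet e2, ht]
  have hHm : Measurable H := by
    refine Measurable.ite (measurableSet_le measurable_fst (by fun_prop)) (by fun_prop)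
      measurable_const
  -- `H` vanishes for `r > 2 d`, so integrability is only needed on a bounded box. It permits
  -- swapping the order so that the radius is integrated first.
  have hint : IntegrableOn H (Ioi (0 : ℝ) ×ˢ Ioo (-Real.pi) Real.pi) := by
    have hsub : Ioc 0 (2 * d) ×ˢ Ioo (-Real.pi) Real.pi ⊆ Ioi (0 : ℝ) ×ˢ Ioo (-Real.pi) Real.pi :=
      prod_mono Ioc_subset_Ioi_self le_rfl
    have h1 : IntegrableOn H (Ioc 0 (2 * d) ×ˢ Ioo (-Real.pi) Real.pi) := by
      refine Measure.integrableOn_of_bounded (M := 2 * d) ?_ hHm.aestronglyMeasurable ?_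
      · rw [Measure.volume_eq_prod, Measure.prod_prod]
        exact ENNReal.mul_ne_top measure_Ioc_lt_top.ne measure_Ioo_lt_top.ne
      · refine (ae_restrict_iff' (measurableSet_Ioc.prod measurableSet_Ioo)).2
          (Eventually.of_forall fun p hp => ?_)
        have hr : 0 < p.1 := hp.1.1
        have hr2 : p.1 ≤ 2 * d := hp.1.2
        simp only [hH]
        split_ifs
        · rw [Real.norm_of_nonneg (by positivity)]
          have : s / (p.1 ^ 4 + s) ≤ 1 := (div_le_one (by positivity)).2 (by
            linarith [pow_pos hr 4])
          nlinarith
        · simp only [norm_zero]; linarith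
    refine h1.of_forall_sdiff_eq_zero (measurableSet_Ioi.prod measurableSet_Ioo) fun p hp => ?_
    have hr : 0 < p.1 := hp.1.1
    simp only [hH]
    rw [if_neg]
    intro hle
    refine hp.2 ⟨⟨hr, hle.trans ?_⟩, hp.1.2⟩
    have := Real.cos_le_one p.2
    nlinarith
  have hsw := setIntegral_prod_swap (μ := volume) (ν := volume) (Ioo (-Real.pi) Real.pi)
    (Ioi (0 : ℝ)) (fun p => H p.swap)
  simp only [Prod.swap_swap] at hsw
  rw [Measure.volume_eq_prod, hsw, setIntegral_prod]
  swap
  · rw [Measure.volume_eq_prod] at hint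
    exact hint.swap
  simp only [Prod.swap_prod_mk]
  have hinner : ∀ θ ∈ Ioo (-Real.pi) Real.pi, ∫ r in Ioi (0 : ℝ), H (r, θ) =
      (Ioc (-(Real.pi / 2)) (Real.pi / 2)).indicator (fun θ => Real.sqrt s / 2 *
        Real.arctan (4 * d ^ 2 / Real.sqrt s * Real.cos θ ^ 2)) θ := fun θ hθ => by
    have e3 : ∫ r in Ioi (0 : ℝ), H (r, θ) =
        ∫ r in Ioc 0 (2 * d * Real.cos θ), r * (s / (r ^ 4 + s)) := by
      rw [← Ioi_inter_Iic, ← setIntegral_indicator measurableSet_Iic]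
      rfl
    rw [e3]
    by_cases hc : θ ∈ Ioc (-(Real.pi / 2)) (Real.pi / 2)
    · have hcos : 0 ≤ Real.cos θ := Real.cos_nonneg_of_mem_Icc ⟨hc.1.le, hc.2⟩
      have hle : 0 ≤ 2 * d * Real.cos θ := by positivity
      rw [indicator_of_mem hc, ← intervalIntegral.integral_of_le hle,
        intervalIntegral.integral_eq_sub_of_hasDerivAt
          (fun r _ => hasDerivAt_arctan_sq_div hs r)]
      · simp only [ne_eq, OfNat.ofNat_ne_zero, not_false_eq_true, zero_pow, zero_div,
          Real.arctan_zero, mul_zero, sub_zero]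
        congr 2; ring
      · refine (Continuous.mul continuous_id (Continuous.div continuous_const (by fun_prop)
          fun r => ?_)).intervalIntegrable _ _
        positivity
    · rw [indicator_of_notMem hc]
      have hcos : Real.cos θ ≤ 0 := by
        rcases lt_or_ge (Real.pi / 2) θ with h1 | h1
        · exact Real.cos_nonpos_of_pi_div_two_le_of_le h1.le (by linarith [hθ.2, Real.pi_pos])
        · have h2 : θ ≤ -(Real.pi / 2) := by
            by_contra h2
            exact hc ⟨not_le.1 h2, h1⟩
          rw [← Real.cos_neg]
          exact Real.cos_nonpos_of_pi_div_two_le_of_le (by linarith)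
            (by linarith [hθ.1, Real.pi_pos])
      rw [Ioc_eq_empty, setIntegral_empty]
      have := mul_nonneg hd0 (neg_nonneg.2 hcos)
      exact not_lt.2 (by linarith)
  have hsub : Ioo (-Real.pi) Real.pi ∩ Ioc (-(Real.pi / 2)) (Real.pi / 2) =
      Ioc (-(Real.pi / 2)) (Real.pi / 2) := by
    refine inter_eq_right.2 fun θ hθ => ⟨?_, ?_⟩
    · linarith [hθ.1, Real.pi_pos]
    · linarith [hθ.2, Real.pi_pos]
  rw [setIntegral_congr_fun measurableSet_Ioo hinner, setIntegral_indicator measurableSet_Ioc,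
    hsub, ← intervalIntegral.integral_of_le (by linarith [Real.pi_pos]),
    intervalIntegral.integral_const_mul, integral_arctan_mul_cos_sq (by positivity)]
  have : (4 * d ^ 2 / Real.sqrt s) ^ 2 = 16 * d ^ 4 / s := by
    rw [div_pow, Real.sq_sqrt hs.le]; ring
  rw [this]
  ring

/-- The mean of `s / (‖y - x‖ ^ 4 + s)` over the points farther from the origin than `x`. -/
theorem setIntegral_norm_lt_div {s : ℝ} (hs : 0 < s) (x : Plane) :
    ∫ y in {y : Plane | ‖x‖ < ‖y‖}, s / (‖y - x‖ ^ 4 + s) =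
      Real.pi ^ 2 * Real.sqrt s / 2 -
      1 / 2 * Real.pi * Real.sqrt s * Real.arctan (Real.sqrt (-(1 / 2) +
        1 / 2 * Real.sqrt (1 + 16 * ‖x‖ ^ 4 / s))) := by
  have hi := (integrable_div_norm_pow_four_add hs).comp_sub_right x
  have h := integral_add_compl (Metric.isClosed_closedBall.measurableSet
    (s := Metric.closedBall (0 : Plane) ‖x‖)) hi
  have h2 := integral_sub_right_eq_self (μ := (volume : Measure Plane))
    (fun y : Plane => s / (‖y‖ ^ 4 + s)) x
  rw [setIntegral_closedBall_div hs, h2, integral_div_norm_pow_four_add hs] at h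
  have e : (Metric.closedBall (0 : Plane) ‖x‖)ᶜ = {y : Plane | ‖x‖ < ‖y‖} := by
    ext y; simp
  rw [e] at h
  linarith

/-! ### Infinite products over the points of a sequence. -/

/-- The product of `v` over the points of a sequence, for `v` with values in `[0, 1]`. -/
def ptProd {α : Type*} (v : α → ℝ) (x : ℕ → α) : ℝ := ⨅ n, ∏ j ∈ Finset.range n, v (x j)

section ptProd
variable {α : Type*} {v w : α → ℝ} {x : ℕ → α}

lemma ptProd_bddBelow (h0 : ∀ y, 0 ≤ v y) :
    BddBelow (range fun n => ∏ j ∈ Finset.range n, v (x j)) :=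
  ⟨0, by rintro _ ⟨n, rfl⟩; exact Finset.prod_nonneg fun _ _ => h0 _⟩

lemma ptProd_antitone (h0 : ∀ y, 0 ≤ v y) (h1 : ∀ y, v y ≤ 1) :
    Antitone fun n => ∏ j ∈ Finset.range n, v (x j) := by
  refine antitone_nat_of_succ_le fun n => ?_
  rw [Finset.prod_range_succ]
  exact mul_le_of_le_one_right (Finset.prod_nonneg fun _ _ => h0 _) (h1 _)

/-- Factors in `[0, 1]` make the partial products antitone, so the infimum in `ptProd` is their
limit. No summability is needed, and divergence to `0` is allowed. -/
lemma tendsto_ptProd (h0 : ∀ y, 0 ≤ v y) (h1 : ∀ y, v y ≤ 1) :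
    Tendsto (fun n => ∏ j ∈ Finset.range n, v (x j)) atTop (𝓝 (ptProd v x)) :=
  tendsto_atTop_ciInf (ptProd_antitone h0 h1) (ptProd_bddBelow h0)

lemma ptProd_nonneg (h0 : ∀ y, 0 ≤ v y) : 0 ≤ ptProd v x :=
  le_ciInf fun _ => Finset.prod_nonneg fun _ _ => h0 _

lemma ptProd_le_prod (h0 : ∀ y, 0 ≤ v y) (n : ℕ) :
    ptProd v x ≤ ∏ j ∈ Finset.range n, v (x j) :=
  ciInf_le (ptProd_bddBelow h0) n

lemma ptProd_le_one (h0 : ∀ y, 0 ≤ v y) : ptProd v x ≤ 1 := by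
  simpa using ptProd_le_prod (x := x) h0 0

lemma ptProd_mono (h0 : ∀ y, 0 ≤ v y) (h : ∀ y, v y ≤ w y) : ptProd v x ≤ ptProd w x :=
  le_ciInf fun n => (ptProd_le_prod h0 n).trans
    (Finset.prod_le_prod (fun _ _ => h0 _) fun _ _ => h _)

lemma ptProd_eq_prod (h0 : ∀ y, 0 ≤ v y) (h1 : ∀ y, v y ≤ 1) (J : Finset ℕ)
    (hJ : ∀ j, j ∉ J → v (x j) = 1) : ptProd v x = ∏ j ∈ J, v (x j) := by
  refine tendsto_nhds_unique (tendsto_ptProd h0 h1) (tendsto_const_nhds.congr' ?_)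
  obtain ⟨m, hm⟩ := J.exists_nat_subset_range
  filter_upwards [eventually_ge_atTop m] with n hn
  exact Finset.prod_subset (hm.trans (Finset.range_mono hn)) fun j _ hj => hJ j hj

lemma ptProd_eq_zero (h0 : ∀ y, 0 ≤ v y) {j : ℕ} (hj : v (x j) = 0) : ptProd v x = 0 :=
  le_antisymm ((ptProd_le_prod h0 (j + 1)).trans_eq
    (Finset.prod_eq_zero (Finset.mem_range.2 j.lt_succ_self) hj)) (ptProd_nonneg h0)

lemma ptProd_eq_tail (h0 : ∀ y, 0 ≤ v y) (h1 : ∀ y, v y ≤ 1) (hx : v (x 0) = 1) :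
    ptProd v x = ptProd v fun j => x (j + 1) := by
  refine tendsto_nhds_unique ((tendsto_add_atTop_iff_nat 1).2 (tendsto_ptProd h0 h1)) ?_
  simp_rw [Finset.prod_range_succ', hx, mul_one]
  exact tendsto_ptProd h0 h1

lemma measurable_ptProd {Ω : Type*} [MeasurableSpace Ω] [MeasurableSpace α] {X : ℕ → Ω → α}
    {f : Ω → α → ℝ} (hf : Measurable (Function.uncurry f)) (hX : ∀ i, Measurable (X i)) :
    Measurable fun ω => ptProd (f ω) fun j => X j ω := by
  unfold ptProd
  refine Measurable.iInf fun n => Finset.measurable_prod _ fun j _ => ?_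
  exact hf.comp (measurable_id.prodMk (hX j))

end ptProd

/-! ### Poisson counts and products of step functions over the points. -/

lemma integral_pow_poissonMeasure (r : NNReal) (a : ℝ) :
    ∫ n : ℕ, a ^ n ∂(poissonMeasure r) = Real.exp (-(r * (1 - a))) := by
  rw [integral_poissonMeasure]
  have h := (NormedSpace.expSeries_div_hasSum_exp (r * a : ℝ)).mul_left (Real.exp (-r))
  rw [← Real.exp_eq_exp_ℝ, ← Real.exp_add] at h
  convert h.tsum_eq using 1
  · congr 1; ext n; simp [mul_pow]; ring
  · ring_nf

lemma integral_eq_one_poissonMeasure (r : NNReal) :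
    ∫ n : ℕ, (if n = 1 then (1 : ℝ) else 0) ∂(poissonMeasure r) = r * Real.exp (-r) := by
  rw [integral_poissonMeasure, tsum_eq_single 1]
  · simp [mul_comm]
  · intro n hn; simp [hn]

namespace IsHPPP
variable {Ω : Type*} [MeasurableSpace Ω] {μ : Measure Ω} {lam : ℝ} {X : ℕ → Ω → Plane}

/-- `Measure.map` along a map that is not almost everywhere measurable is `0`, whereas the count law
has mass one. -/
lemma aemeasurable_pointCount (h : IsHPPP μ lam X) {B : Set Plane} (hB : MeasurableSet B)
    (hB' : volume B < ⊤) : AEMeasurable (pointCount X B) μ := by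
  by_contra hc
  have h1 := h.count_law B hB hB'
  rw [Measure.map_of_not_aemeasurable hc] at h1
  have h2 : ((poissonMeasure (lam * volume.real B).toNNReal).map (fun n : ℕ => (n : ℕ∞))) univ
      = 1 := by
    rw [Measure.map_apply (measurable_of_countable _) MeasurableSet.univ]; simp
  rw [← h1] at h2
  simp at h2

lemma integral_pointCount (h : IsHPPP μ lam X) {B : Set Plane} (hB : MeasurableSet B)
    (hB' : volume B < ⊤) (ψ : ℕ∞ → ℝ) :
    ∫ ω, ψ (pointCount X B ω) ∂μ =
      ∫ n : ℕ, ψ n ∂(poissonMeasure (lam * volume.real B).toNNReal) := by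
  rw [← integral_map (h.aemeasurable_pointCount hB hB')
    (measurable_of_countable ψ).aestronglyMeasurable, h.count_law B hB hB',
    integral_map (measurable_of_countable _).aemeasurable
      (measurable_of_countable ψ).aestronglyMeasurable]

lemma ae_pointCount_ne_top (h : IsHPPP μ lam X) {B : Set Plane} (hB : MeasurableSet B)
    (hB' : volume B < ⊤) : ∀ᵐ ω ∂μ, pointCount X B ω ≠ ⊤ := by
  have hm := h.aemeasurable_pointCount hB hB'
  have : ∀ᵐ n ∂(μ.map (pointCount X B)), n ≠ (⊤ : ℕ∞) := by
    rw [h.count_law B hB hB', ae_map_iff (measurable_of_countable _).aemeasurable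
      (Set.to_countable _).measurableSet]
    exact Filter.Eventually.of_forall fun n => ENat.natCast_ne_top n
  exact ae_of_ae_map hm this

lemma ae_finite (h : IsHPPP μ lam X) {B : Set Plane} (hB : MeasurableSet B)
    (hB' : volume B < ⊤) : ∀ᵐ ω ∂μ, {j | X j ω ∈ B}.Finite := by
  filter_upwards [h.ae_pointCount_ne_top hB hB'] with ω hω
  exact Set.encard_ne_top_iff.1 hω

/-- A function with values `i / k` turns the product over points into `∏ (i / k) ^ n_i`, where `n_i`
counts the points at level `i`. The levels below `k` and the set `C` are disjoint, so their counts
are independent Poisson variables: the levels contribute generating functions and `C` the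
probability of exactly one point. -/
lemma integral_ptProd_levels (h : IsHPPP μ lam X) (hl : 0 < lam) {k : ℕ} (hk : 0 < k)
    {q : Plane → ℕ} (hq : Measurable q) (hqk : ∀ y, q y ≤ k) (hv : volume {y | q y < k} < ⊤)
    {C : Set Plane} (hC : MeasurableSet C) (hC' : volume C < ⊤) (hCq : ∀ y ∈ C, q y = k) :
    ∫ ω, (if pointCount X C ω = 1 then 1 else 0) *
        ptProd (fun y => (q y : ℝ) / k) (fun j => X j ω) ∂μ =
      lam * volume.real C * Real.exp (-(lam * volume.real C)) *
        Real.exp (-(lam * ∫ y, (1 - (q y : ℝ) / k))) := by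
  have hk0 : (0 : ℝ) < k := by exact_mod_cast hk
  -- Level `k` has infinite area but contributes only factors `1`. Its slot is free and is used for
  -- `C`, which lies inside it.
  set B : Fin (k + 1) → Set Plane := fun i => if (i : ℕ) = k then C else q ⁻¹' {(i : ℕ)} with hBdef
  have hBlt : ∀ i : Fin k, B i.castSucc = q ⁻¹' {(i : ℕ)} := fun i => by
    simp [hBdef, i.2.ne]
  have hBlast : B (Fin.last k) = C := by simp [hBdef]
  have hBm : ∀ i, MeasurableSet (B i) := by
    intro i; simp only [hBdef]; split_ifs
    · exact hC
    · exact hq (measurableSet_singleton _)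
  have hBv : ∀ i, volume (B i) < ⊤ := by
    intro i; refine Fin.lastCases ?_ (fun i => ?_) i
    · rwa [hBlast]
    · rw [hBlt]; refine (measure_mono ?_).trans_lt hv
      intro y hy; simp only [mem_preimage, mem_singleton_iff] at hy
      simp only [mem_ofPred_eq, hy, i.2]
  have hBd : Pairwise fun a b => Disjoint (B a) (B b) := by
    intro a b hab
    rw [Set.disjoint_left]
    intro y hya hyb
    have key : ∀ i : Fin (k + 1), y ∈ B i → q y = i := by
      intro i hi; simp only [hBdef] at hi; split_ifs at hi with hik
      · rw [hCq y hi, hik]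
      · exact hi
    exact hab (Fin.ext ((key a hya).symm.trans (key b hyb)))
  have hind := h.count_indep (k + 1) B hBm hBv hBd
  set ψ : Fin (k + 1) → ℕ∞ → ℝ := fun i n =>
    if (i : ℕ) = k then (if n = 1 then 1 else 0) else ((i : ℝ) / k) ^ n.toNat with hψ
  have hψlt : ∀ i : Fin k, ψ i.castSucc = fun n => ((i : ℝ) / k) ^ n.toNat := fun i => by
    ext n; simp [hψ, i.2.ne]
  have hψlast : ψ (Fin.last k) = fun n => if n = 1 then 1 else 0 := by
    ext n; simp [hψ]
  have hI := hind.integral_fun_prod_comp (f := ψ)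
    (fun i => h.aemeasurable_pointCount (hBm i) (hBv i))
    (fun i => (measurable_of_countable _).aestronglyMeasurable)
  have hL : ∫ ω, (if pointCount X C ω = 1 then 1 else 0) *
        ptProd (fun y => (q y : ℝ) / k) (fun j => X j ω) ∂μ =
      ∫ ω, ∏ i, ψ i (pointCount X (B i) ω) ∂μ := by
    refine integral_congr_ae ?_
    filter_upwards [h.ae_finite (hq (measurableSet_Iio (a := k))) hv] with ω hω
    have hω' : {j | q (X j ω) < k}.Finite := hω
    rw [Fin.prod_univ_castSucc, hBlast, hψlast, mul_comm]
    congr 1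
    rw [ptProd_eq_prod (fun y => by positivity)
      (fun y => (div_le_one hk0).2 (by exact_mod_cast hqk y)) hω'.toFinset]
    · rw [← Finset.prod_fiberwise_of_maps_to (t := Finset.range k) (g := fun j => q (X j ω))]
      · rw [← Fin.prod_univ_eq_prod_range
          (fun i => ∏ j ∈ hω'.toFinset with q (X j ω) = i, (q (X j ω) : ℝ) / k)]
        refine Finset.prod_congr rfl fun i _ => ?_
        rw [hBlt, hψlt, Finset.prod_congr rfl (g := fun _ => (i : ℝ) / k), Finset.prod_const]
        · congr 1
          have : pointCount X (q ⁻¹' {(i : ℕ)}) ω =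
              ({j ∈ hω'.toFinset | q (X j ω) = i} : Finset ℕ).card := by
            rw [← Set.encard_coe_eq_coe_finsetCard]
            unfold pointCount
            congr 1
            ext j
            simp only [mem_preimage, mem_singleton_iff, mem_ofPred_eq, Finset.coe_filter,
              Finite.mem_toFinset]
            exact ⟨fun hj => ⟨hj ▸ i.2, hj⟩, fun hj => hj.2⟩
          rw [this]; simp
        · intro j hj; rw [(Finset.mem_filter.1 hj).2]
      · intro j hj; simpa using hj
    · intro j hj
      have : q (X j ω) = k := le_antisymm (hqk _) (by simpa using hj)
      simp [this, hk0.ne']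
  rw [hL, hI, Fin.prod_univ_castSucc, hBlast, hψlast, mul_comm]
  congr 1
  · rw [h.integral_pointCount hC hC' fun n => if n = 1 then 1 else 0]
    have := integral_eq_one_poissonMeasure (lam * volume.real C).toNNReal
    rw [Real.coe_toNNReal _ (by positivity)] at this
    rw [← this]
    simp
  · have h1 : ∀ y, 1 - (q y : ℝ) / k =
        ∑ i : Fin k, (q ⁻¹' {(i : ℕ)}).indicator (fun _ => 1 - (i : ℝ) / k) y := by
      intro y
      rcases (hqk y).lt_or_eq with hlt | heq
      · rw [Finset.sum_eq_single (⟨q y, hlt⟩ : Fin k)]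
        · simp
        · intro i _ hi
          refine indicator_of_notMem (fun hy => hi ?_) _
          exact Fin.ext (by simpa using hy.symm)
        · simp
      · rw [Finset.sum_eq_zero, heq, div_self hk0.ne', sub_self]
        intro i _
        refine indicator_of_notMem (fun hy => ?_) _
        rw [mem_preimage, heq] at hy
        exact i.2.ne hy.symm
    simp_rw [h1]
    have hBm' := fun i : Fin k => hq (measurableSet_singleton (i : ℕ))
    have hBv' : ∀ i : Fin k, volume (q ⁻¹' {(i : ℕ)}) < ⊤ := fun i => hBlt i ▸ hBv _
    rw [integral_finsetSum _ fun i _ =>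
      (integrable_indicator_iff (hBm' i)).2 (integrableOn_const (hBv' i).ne),
      Finset.mul_sum, ← Finset.sum_neg_distrib, Real.exp_sum]
    refine Finset.prod_congr rfl fun i _ => ?_
    rw [hBlt, hψlt, h.integral_pointCount (hBm' i) (hBv' i)
      fun n => ((i : ℝ) / k) ^ n.toNat]
    simp only [ENat.toNat_natCast]
    rw [integral_pow_poissonMeasure, Real.coe_toNNReal _ (by positivity),
      integral_indicator_const _ (hBm' i), smul_eq_mul, mul_assoc]

end IsHPPP

/-! ### The Laplace functional, and the joint law of the nearest point and the other points. -/

lemma integrable_exp_neg_mul_norm_sq_plane {a : ℝ} (ha : 0 < a) :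
    Integrable fun x : Plane => Real.exp (-a * ‖x‖ ^ 2) := by
  have h := (GaussianFourier.integrable_cexp_neg_mul_sq_norm_add (V := Plane) (b := (a : ℂ))
    (by simpa using ha) 0 0).norm
  refine h.congr (Eventually.of_forall fun x => ?_)
  simp only [Complex.norm_exp]
  congr 1
  simp [← Complex.ofReal_pow, ← Complex.ofReal_neg, ← Complex.ofReal_mul]

lemma integral_exp_neg_mul_norm_sq_plane {a : ℝ} (ha : 0 < a) :
    ∫ x : Plane, Real.exp (-a * ‖x‖ ^ 2) = Real.pi / a := by
  rw [GaussianFourier.integral_rexp_neg_mul_sq_norm ha]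
  simp

namespace IsHPPP
variable {Ω : Type*} [MeasurableSpace Ω] {μ : Measure Ω} [IsProbabilityMeasure μ] {lam : ℝ}
  {X : ℕ → Ω → Plane}

/-- The levels `⌈v (k + 1)⌉ / (k + 1)` converge to `v`. Rounding up keeps the value `1` wherever `v
= 1`, so all approximations differ from `1` only inside one set of finite area, and dominated
convergence applies. -/
lemma integral_ptProd (h : IsHPPP μ lam X) (hl : 0 < lam) {v : Plane → ℝ} (hvm : Measurable v)
    (h0 : ∀ y, 0 ≤ v y) (h1 : ∀ y, v y ≤ 1) (hv : volume {y | v y ≠ 1} < ⊤)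
    {C : Set Plane} (hC : MeasurableSet C) (hC' : volume C < ⊤) (hCv : ∀ y ∈ C, v y = 1) :
    ∫ ω, (if pointCount X C ω = 1 then 1 else 0) * ptProd v (fun j => X j ω) ∂μ =
      lam * volume.real C * Real.exp (-(lam * volume.real C)) *
        Real.exp (-(lam * ∫ y, (1 - v y))) := by
  set q : ℕ → Plane → ℕ := fun k y => ⌈v y * ((k + 1 : ℕ) : ℝ)⌉₊ with hq
  have hqm : ∀ k, Measurable (q k) := fun k => (hvm.mul_const _).nat_ceil
  have hqle : ∀ k y, q k y ≤ k + 1 := fun k y => Nat.ceil_le.2 (by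
    have : (0 : ℝ) ≤ ((k + 1 : ℕ) : ℝ) := by positivity
    nlinarith [h1 y])
  have hq1 : ∀ k y, v y = 1 → q k y = k + 1 := fun k y hy => by
    simp only [hq, hy, one_mul, Nat.ceil_natCast]
  have hsub : ∀ k, {y | q k y < k + 1} ⊆ {y | v y ≠ 1} := fun k y hy hy1 =>
    (hy : q k y < k + 1).ne (hq1 k y hy1)
  have hlev := fun k => h.integral_ptProd_levels hl k.succ_pos (hqm k) (hqle k)
    ((measure_mono (hsub k)).trans_lt hv) hC hC' fun y hy => hq1 k y (hCv y hy)
  have hconv : ∀ y, Tendsto (fun k => (q k y : ℝ) / ((k + 1 : ℕ) : ℝ)) atTop (𝓝 (v y)) :=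
    fun y => ((tendsto_nat_ceil_mul_div_atTop (h0 y)).comp tendsto_natCast_atTop_atTop).comp
      (tendsto_add_atTop_nat 1)
  have hq0 : ∀ k y, 0 ≤ (q k y : ℝ) / ((k + 1 : ℕ) : ℝ) := fun k y => by positivity
  have hq1' : ∀ k y, (q k y : ℝ) / ((k + 1 : ℕ) : ℝ) ≤ 1 := fun k y =>
    (div_le_one (by positivity)).2 (by exact_mod_cast hqle k y)
  have hvq : ∀ k y, v y = 1 → (q k y : ℝ) / ((k + 1 : ℕ) : ℝ) = 1 := fun k y hy => by
    rw [hq1 k y hy, div_self (by positivity)]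
  have hvms : MeasurableSet {y | v y ≠ 1} := hvm (measurableSet_singleton 1).compl
  refine tendsto_nhds_unique (f := fun k : ℕ => ∫ ω, (if pointCount X C ω = 1 then 1 else 0) *
    ptProd (fun y => (q k y : ℝ) / ((k + 1 : ℕ) : ℝ)) (fun j => X j ω) ∂μ) (l := atTop) ?_ ?_
  · refine tendsto_integral_of_dominated_convergence (fun _ => 1) (fun k => ?_)
      (integrable_const 1) (fun k => Eventually.of_forall fun ω => ?_) ?_
    · refine AEStronglyMeasurable.mul ?_ ?_
      · exact ((measurable_of_countable fun n : ℕ∞ => if n = 1 then (1 : ℝ) else 0).comp_aemeasurable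
          (h.aemeasurable_pointCount hC hC')).aestronglyMeasurable
      · refine (measurable_ptProd (f := fun _ y => (q k y : ℝ) / ((k + 1 : ℕ) : ℝ)) ?_
          h.measurable_point).aestronglyMeasurable
        exact ((measurable_from_nat.comp (hqm k)).div_const _).comp measurable_snd
    · have ha := ptProd_nonneg (x := fun j => X j ω) (hq0 k)
      have hb := ptProd_le_one (x := fun j => X j ω) (hq0 k)
      split_ifs
      · rwa [one_mul, Real.norm_of_nonneg ha]
      · simp
    · filter_upwards [h.ae_finite hvms hv] with ω hω
      refine Tendsto.const_mul _ ?_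
      have e : ∀ j, j ∉ hω.toFinset → v (X j ω) = 1 := fun j hj => by simpa using hj
      rw [ptProd_eq_prod h0 h1 hω.toFinset e]
      simp_rw [fun k => ptProd_eq_prod (x := fun j => X j ω) (hq0 k) (hq1' k) hω.toFinset
        fun j hj => hvq k _ (e j hj)]
      exact tendsto_finsetProd _ fun j _ => hconv _
  · simp_rw [hlev]
    refine Tendsto.const_mul _ ((Real.continuous_exp.tendsto _).comp
      (Tendsto.neg (Tendsto.const_mul _ ?_)))
    refine tendsto_integral_of_dominated_convergence ({y | v y ≠ 1}.indicator fun _ => 1)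
      (fun k => ?_) ((integrable_indicator_iff hvms).2 (integrableOn_const hv.ne))
      (fun k => Eventually.of_forall fun y => ?_)
      (Eventually.of_forall fun y => (hconv y).const_sub 1)
    · exact (measurable_const.sub
        ((measurable_from_nat.comp (hqm k)).div_const _)).aestronglyMeasurable
    · by_cases hy : v y = 1
      · have := hvq k y hy
        simp only [this]; simp [hy]
      · rw [indicator_of_mem (by exact hy), Real.norm_of_nonneg (sub_nonneg.2 (hq1' k y))]
        linarith [hq0 k y]

/-- This is a discrete form of the law of the nearest point. Up to a null set, `X 0` lies in the
cell `C` and `‖X 1‖ ≥ b` exactly when `C` holds one point and the rest of the ball of radius `b`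
holds none. The probability `λ |C| exp (-λ |C|)` of one point and the void probability `exp (-λ (π
b² - |C|))` combine to `λ |C| exp (-λ π b²)`. Summing over cells gives the integral of a step
function. -/
lemma integral_cells (h : IsHPPP μ lam X) (hl : 0 < lam)
    (ho : ∀ᵐ ω ∂μ, Monotone fun i => ‖X i ω‖) {ι : Plane → ℕ} (hι : Measurable ι)
    {g : ℕ → ℝ} (g0 : ∀ i, 0 ≤ g i) (g1 : ∀ i, g i ≤ 1) {f : ℕ → Plane → ℝ}
    (hf : ∀ i, Measurable (f i)) (f0 : ∀ i y, 0 ≤ f i y) (f1 : ∀ i y, f i y ≤ 1)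
    (hfv : ∀ i, volume {y | f i y ≠ 1} < ⊤) {b : ℕ → ℝ} (hb : ∀ x, ‖x‖ < b (ι x)) :
    ∫ ω, g (ι (X 0 ω)) * (if b (ι (X 0 ω)) ≤ ‖X 1 ω‖ then
        ptProd (f (ι (X 0 ω))) (fun j => X (j + 1) ω) else 0) ∂μ =
      ∫ x, lam * g (ι x) * Real.exp (-(lam * (Real.pi * b (ι x) ^ 2))) *
        Real.exp (-(lam * ∫ y in {y | b (ι x) ≤ ‖y‖}, (1 - f (ι x) y))) := by
  have hX := h.measurable_point
  have hS : ∀ i, MeasurableSet (ι ⁻¹' {i}) := fun i => hι (measurableSet_singleton i)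
  have hT : ∀ i, MeasurableSet ((fun ω => ι (X 0 ω)) ⁻¹' {i}) := fun i =>
    (hι.comp (hX 0)) (measurableSet_singleton i)
  have hd : Pairwise (Function.onFun Disjoint fun i => ι ⁻¹' {i}) :=
    fun i j hij => (disjoint_singleton.2 hij).preimage _
  have hU : ⋃ i, ι ⁻¹' {i} = univ := by
    rw [← preimage_iUnion, iUnion_of_singleton, preimage_univ]
  have hU' : ⋃ i, (fun ω => ι (X 0 ω)) ⁻¹' {i} = univ := by
    rw [← preimage_iUnion, iUnion_of_singleton, preimage_univ]
  have hd' : Pairwise (Function.onFun Disjoint fun i => (fun ω => ι (X 0 ω)) ⁻¹' {i}) :=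
    fun i j hij => (disjoint_singleton.2 hij).preimage _
  -- integrability of both sides
  have hfu : Measurable (Function.uncurry f) := measurable_from_prod_countable_right hf
  have hintL : Integrable (fun ω => g (ι (X 0 ω)) * (if b (ι (X 0 ω)) ≤ ‖X 1 ω‖ then
        ptProd (f (ι (X 0 ω))) (fun j => X (j + 1) ω) else 0)) μ := by
    refine Integrable.of_bound (C := 1) (Measurable.aestronglyMeasurable ?_)
      (Eventually.of_forall fun ω => ?_)
    · refine (measurable_from_nat.comp (hι.comp (hX 0))).mul (Measurable.ite ?_ ?_
        measurable_const)
      · exact measurableSet_le (measurable_from_nat.comp (hι.comp (hX 0))) (hX 1).norm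
      · refine measurable_ptProd (f := fun ω => f (ι (X 0 ω))) ?_ fun i => hX (i + 1)
        exact hfu.comp ((hι.comp ((hX 0).comp measurable_fst)).prodMk measurable_snd)
    · have ha := ptProd_nonneg (x := fun j => X (j + 1) ω) (f0 (ι (X 0 ω)))
      have hb := ptProd_le_one (x := fun j => X (j + 1) ω) (f0 (ι (X 0 ω)))
      rw [norm_mul, Real.norm_of_nonneg (g0 _)]
      split_ifs
      · rw [Real.norm_of_nonneg ha]; exact mul_le_one₀ (g1 _) ha hb
      · simp
  have hintR : Integrable fun x => lam * g (ι x) *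
        Real.exp (-(lam * (Real.pi * b (ι x) ^ 2))) *
        Real.exp (-(lam * ∫ y in {y | b (ι x) ≤ ‖y‖}, (1 - f (ι x) y))) := by
    have hG : Integrable fun x : Plane => lam * Real.exp (-(lam * Real.pi) * ‖x‖ ^ 2) :=
      (integrable_exp_neg_mul_norm_sq_plane (by positivity)).const_mul _
    refine hG.mono' (Measurable.aestronglyMeasurable ?_) (Eventually.of_forall fun x => ?_)
    · exact (measurable_from_nat (f := fun i => lam * g i *
        Real.exp (-(lam * (Real.pi * b i ^ 2))) *
        Real.exp (-(lam * ∫ y in {y | b i ≤ ‖y‖}, (1 - f i y))))).comp hι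
    · rw [Real.norm_of_nonneg (by have := g0 (ι x); positivity)]
      have e1 : Real.exp (-(lam * ∫ y in {y | b (ι x) ≤ ‖y‖}, (1 - f (ι x) y))) ≤ 1 := by
        rw [Real.exp_le_one_iff, neg_nonpos]
        exact mul_nonneg hl.le (integral_nonneg fun y => sub_nonneg.2 (f1 _ y))
      have e2 : Real.exp (-(lam * (Real.pi * b (ι x) ^ 2))) ≤
          Real.exp (-(lam * Real.pi) * ‖x‖ ^ 2) := by
        refine Real.exp_le_exp.2 ?_
        have : ‖x‖ ^ 2 ≤ b (ι x) ^ 2 := by gcongr; exact (hb x).le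
        have := mul_le_mul_of_nonneg_left this (mul_pos hl Real.pi_pos).le
        linarith
      calc _ ≤ lam * 1 * Real.exp (-(lam * Real.pi) * ‖x‖ ^ 2) * 1 := by
            gcongr; exact g1 _
        _ = _ := by ring
  rw [← setIntegral_univ (μ := μ), ← hU', integral_iUnion hT hd' hintL.integrableOn,
    ← setIntegral_univ, ← hU, integral_iUnion hS hd hintR.integrableOn]
  congr 1
  ext i
  set C := ι ⁻¹' {i} with hCdef
  have hCm : MeasurableSet C := hS i
  have hCb : ∀ y ∈ C, ‖y‖ < b i := fun y hy => by
    have := hb y; rwa [show ι y = i from hy] at this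
  rw [setIntegral_congr_fun (g := fun _ => lam * g i *
        Real.exp (-(lam * (Real.pi * b i ^ 2))) *
        Real.exp (-(lam * ∫ y in {y | b i ≤ ‖y‖}, (1 - f i y)))) hCm
        (fun x hx => by simp only [show ι x = i from hx]),
    setIntegral_const, smul_eq_mul, ← integral_indicator (hT i)]
  -- The value `0` on the ball outside `C` makes the product vanish unless that region is void. The
  -- value `1` on `C` makes the nearest point itself invisible.
  set v : Plane → ℝ := fun y => if ι y = i then 1 else if ‖y‖ < b i then 0 else f i y with hv
  have hvm : Measurable v := Measurable.ite hCm measurable_const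
    (Measurable.ite (measurableSet_lt measurable_norm measurable_const) measurable_const (hf i))
  have v0 : ∀ y, 0 ≤ v y := fun y => by
    simp only [hv]; split_ifs; exacts [zero_le_one, le_rfl, f0 i y]
  have v1 : ∀ y, v y ≤ 1 := fun y => by
    simp only [hv]; split_ifs; exacts [le_rfl, zero_le_one, f1 i y]
  have hCsub : C ⊆ Metric.ball 0 (b i) := fun y hy => by simpa using hCb y hy
  have hvv : volume {y | v y ≠ 1} < ⊤ := by
    refine (measure_mono (t := Metric.ball 0 (b i) ∪ {y | f i y ≠ 1}) ?_).trans_lt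
      (measure_union_lt_top measure_ball_lt_top (hfv i))
    intro y hy
    simp only [hv, mem_ofPred_eq] at hy
    split_ifs at hy with ha hb
    · exact absurd rfl hy
    · left; simpa using hb
    · right; exact hy
  have key := h.integral_ptProd hl hvm v0 v1 hvv hCm
    ((measure_mono hCsub).trans_lt measure_ball_lt_top) fun y hy => by
      simp only [hv]; rw [if_pos]; exact hy
  have hL : ∫ ω, ((fun ω => ι (X 0 ω)) ⁻¹' {i}).indicator (fun ω => g (ι (X 0 ω)) *
      (if b (ι (X 0 ω)) ≤ ‖X 1 ω‖ then
        ptProd (f (ι (X 0 ω))) (fun j => X (j + 1) ω) else 0)) ω ∂μ =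
      ∫ ω, g i * ((if pointCount X C ω = 1 then 1 else 0) * ptProd v (fun j => X j ω)) ∂μ := by
    refine integral_congr_ae ?_
    filter_upwards [ho] with ω hω
    by_cases h00 : ι (X 0 ω) = i
    · rw [indicator_of_mem (by exact h00), h00]
      congr 1
      have hv0 : v (X 0 ω) = 1 := by simp only [hv]; rw [if_pos h00]
      split_ifs with hb1 hc hc
      · rw [one_mul, ptProd_eq_tail v0 v1 hv0]
        unfold ptProd
        congr 1; ext n
        refine Finset.prod_congr rfl fun j _ => ?_
        have hj : b i ≤ ‖X (j + 1) ω‖ := hb1.trans (hω (Nat.le_add_left 1 j))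
        simp only [hv]
        rw [if_neg fun hc : ι _ = i => (hCb _ hc).not_ge hj, if_neg hj.not_gt]
      · refine absurd ?_ hc
        unfold pointCount
        rw [show {j | X j ω ∈ C} = {0} from ?_, encard_singleton]
        ext j
        simp only [mem_ofPred_eq, mem_singleton_iff]
        refine ⟨fun hj => ?_, fun hj => hj ▸ h00⟩
        by_contra hj0
        exact (hCb _ hj).not_ge (hb1.trans (hω (Nat.one_le_iff_ne_zero.2 hj0)))
      -- Here `C` has exactly one point but `X 1` is in the ball. If `X 1` were in `C`, there would
      -- be two points in `C`; otherwise `v (X 1) = 0`.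
      · rw [one_mul, eq_comm]
        by_cases h11 : ι (X 1 ω) = i
        · unfold pointCount at hc
          obtain ⟨a, ha⟩ := encard_eq_one.1 hc
          have e0 : (0 : ℕ) ∈ {j | X j ω ∈ C} := h00
          have e1 : (1 : ℕ) ∈ {j | X j ω ∈ C} := h11
          rw [ha, mem_singleton_iff] at e0 e1
          omega
        · refine ptProd_eq_zero v0 (j := 1) ?_
          simp only [hv]
          rw [if_neg h11, if_pos (not_le.1 hb1)]
      · rw [zero_mul]
    -- If `C` holds a point without holding `X 0`, then by the ordering `X 0` is in the ball outside
    -- `C`, where `v = 0`.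
    · rw [indicator_of_notMem (by exact h00), eq_comm]
      split_ifs with hc
      · unfold pointCount at hc
        obtain ⟨a, ha⟩ := encard_eq_one.1 hc
        have ea : X a ω ∈ C := by
          have : a ∈ {j | X j ω ∈ C} := by rw [ha]; rfl
          exact this
        rw [ptProd_eq_zero v0 (j := 0), mul_zero, mul_zero]
        simp only [hv]
        rw [if_neg h00, if_pos ((hω (Nat.zero_le a)).trans_lt (hCb _ ea))]
      · rw [zero_mul, mul_zero]
  rw [hL, integral_const_mul, key]
  -- For an empty cell `b i` may be negative, so the area formula fails, but both sides are zero.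
  rcases C.eq_empty_or_nonempty with hCe | ⟨y0, hy0⟩
  · simp [hCe]
  have hbp : 0 ≤ b i := (norm_nonneg y0).trans (hCb y0 hy0).le
  have hbm : MeasurableSet {y : Plane | b i ≤ ‖y‖} := measurableSet_le measurable_const
    measurable_norm
  have hint : ∫ y, (1 - v y) = (Real.pi * b i ^ 2 - volume.real C) +
      ∫ y in {y | b i ≤ ‖y‖}, (1 - f i y) := by
    have e : ∀ y, 1 - v y = (Metric.ball (0 : Plane) (b i) \ C).indicator (fun _ => 1) y +
        {y : Plane | b i ≤ ‖y‖}.indicator (fun y => 1 - f i y) y := by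
      intro y
      by_cases hyC : y ∈ C
      · rw [indicator_of_notMem fun hh => hh.2 hyC,
          indicator_of_notMem (s := {y : Plane | b i ≤ ‖y‖}) fun hh => (hCb y hyC).not_ge hh]
        simp only [hv]; rw [if_pos (by exact hyC)]; ring
      · by_cases hyb : ‖y‖ < b i
        · rw [indicator_of_mem (s := Metric.ball (0 : Plane) (b i) \ C) ⟨by simpa using hyb, hyC⟩,
            indicator_of_notMem (s := {y : Plane | b i ≤ ‖y‖}) fun hh => hyb.not_ge hh]
          simp only [hv]; rw [if_neg (by exact hyC), if_pos hyb]; ring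
        · rw [indicator_of_notMem fun hh => hyb (by simpa using hh.1),
            indicator_of_mem (s := {y : Plane | b i ≤ ‖y‖}) (not_lt.1 hyb)]
          simp only [hv]; rw [if_neg (by exact hyC), if_neg hyb]; ring
    simp_rw [e]
    have hmd := (Metric.isOpen_ball (x := (0 : Plane)) (ε := b i)).measurableSet.diff hCm
    rw [integral_add, integral_indicator_const _ hmd, integral_indicator hbm, smul_eq_mul, mul_one,
      measureReal_sdiff hCsub hCm, volume_real_ball_plane _ hbp]
    · exact (integrable_indicator_iff hmd).2 (integrableOn_const
        ((measure_mono sdiff_subset).trans_lt measure_ball_lt_top).ne)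
    · refine (integrable_indicator_iff hbm).2 (Integrable.integrableOn ?_)
      have hfm : MeasurableSet {y | f i y ≠ 1} := hf i (measurableSet_singleton 1).compl
      refine ((integrable_indicator_iff hfm (f := fun _ => (1 : ℝ))).2
        (integrableOn_const (hfv i).ne)).mono'
        (measurable_const.sub (hf i)).aestronglyMeasurable (Eventually.of_forall fun y => ?_)
      by_cases hy : f i y = 1
      · simp [hy]
      · rw [indicator_of_mem (by exact hy), Real.norm_of_nonneg (sub_nonneg.2 (f1 i y))]
        linarith [f0 i y]
  rw [hint, mul_add, neg_add, Real.exp_add, mul_sub, neg_sub, sub_eq_neg_add,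
    neg_add_eq_sub, Real.exp_sub, Real.exp_neg, Real.exp_neg (lam * (Real.pi * b i ^ 2))]
  have := (Real.exp_pos (lam * volume.real C)).ne'
  field_simp

end IsHPPP

lemma exists_measurable_index {α : Type*} [PseudoMetricSpace α] [MeasurableSpace α] [BorelSpace α]
    [TopologicalSpace.SeparableSpace α] [Nonempty α] {r : ℝ} (hr : 0 < r) :
    ∃ ι : α → ℕ, Measurable ι ∧
      ∀ x, dist x (TopologicalSpace.denseSeq α (ι x)) < r := by
  classical
  have hp : ∀ x : α, ∃ n, dist x (TopologicalSpace.denseSeq α n) < r := fun x =>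
    (TopologicalSpace.denseRange_denseSeq α).exists_dist_lt x hr
  refine ⟨fun x => Nat.find (hp x), measurable_find hp fun k => ?_, fun x => Nat.find_spec (hp x)⟩
  exact Metric.isOpen_ball.measurableSet (s := Metric.ball (TopologicalSpace.denseSeq α k) r)

lemma measurable_setIntegral_norm_lt {F : Plane × Plane → ℝ} (hF : Measurable F) :
    Measurable fun x => ∫ y in {y | ‖x‖ < ‖y‖}, F (x, y) := by
  have hms : MeasurableSet {p : Plane × Plane | ‖p.1‖ < ‖p.2‖} :=
    measurableSet_lt measurable_fst.norm measurable_snd.norm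
  have e : ∀ x, ∫ y in {y | ‖x‖ < ‖y‖}, F (x, y) =
      ∫ y, {p : Plane × Plane | ‖p.1‖ < ‖p.2‖}.indicator F (x, y) := fun x => by
    rw [← integral_indicator (measurableSet_lt measurable_const measurable_norm)]
    rfl
  simp_rw [e]
  exact (hF.indicator hms).stronglyMeasurable.integral_prod_right'.measurable

namespace IsHPPP
variable {Ω : Type*} [MeasurableSpace Ω] {μ : Measure Ω} [IsProbabilityMeasure μ] {lam : ℝ}
  {X : ℕ → Ω → Plane}

/-- The cells shrink to points and their radii `b` decrease the gap to `‖x‖` from strictly above. If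
`‖X 0‖ < ‖X 1‖`, the condition `b ≤ ‖X 1‖` eventually holds; otherwise it never does. Since `f = 1`
far away, almost surely only finitely many factors matter, and continuity in the nearest point gives
the limit. -/
lemma integral_nearest_of_bounded (h : IsHPPP μ lam X) (hl : 0 < lam)
    (ho : ∀ᵐ ω ∂μ, Monotone fun i => ‖X i ω‖)
    {g : Plane → ℝ} (gc : Continuous g) (g0 : ∀ x, 0 ≤ g x) (g1 : ∀ x, g x ≤ 1)
    {f : Plane → Plane → ℝ} (fm : ∀ x, Measurable (f x)) (fc : ∀ y, Continuous fun x => f x y)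
    (f0 : ∀ x y, 0 ≤ f x y) (f1 : ∀ x y, f x y ≤ 1) {R : ℝ}
    (fR : ∀ x y, R ≤ ‖y‖ → f x y = 1) :
    ∫ ω, g (X 0 ω) * (if ‖X 0 ω‖ < ‖X 1 ω‖ then
        ptProd (f (X 0 ω)) (fun j => X (j + 1) ω) else 0) ∂μ =
      ∫ x, lam * g x * Real.exp (-(lam * (Real.pi * ‖x‖ ^ 2))) *
        Real.exp (-(lam * ∫ y in {y | ‖x‖ < ‖y‖}, (1 - f x y))) := by
  have hX := h.measurable_point
  set r : ℕ → ℝ := fun n => 1 / ((n : ℝ) + 1) with hr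
  have hr0 : ∀ n, 0 < r n := fun n => by positivity
  have hrlim : Tendsto r atTop (𝓝 0) := tendsto_one_div_add_atTop_nhds_zero_nat
  choose ι hιm hι using fun n => exists_measurable_index (α := Plane) (hr0 n)
  set e := TopologicalSpace.denseSeq Plane
  set p : ℕ → Plane → Plane := fun n x => e (ι n x) with hp
  set b : ℕ → Plane → ℝ := fun n x => ‖p n x‖ + r n with hbdef
  have hplim : ∀ x, Tendsto (fun n => p n x) atTop (𝓝 x) := fun x => by
    rw [tendsto_iff_dist_tendsto_zero]
    refine squeeze_zero (fun _ => dist_nonneg) (fun n => ?_) hrlim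
    rw [dist_comm]; exact (hι n x).le
  have hblt : ∀ n x, ‖x‖ < b n x := fun n x => by
    have h1 := hι n x
    rw [dist_eq_norm] at h1
    have h2 := norm_sub_norm_le x (p n x)
    simp only [hbdef]; linarith [show ‖x - p n x‖ < r n from h1]
  have hblim : ∀ x, Tendsto (fun n => b n x) atTop (𝓝 ‖x‖) := fun x => by
    simpa using (hplim x).norm.add hrlim
  have hball : volume (Metric.ball (0 : Plane) R) < ⊤ := measure_ball_lt_top
  have hfR : ∀ x, {y | f x y ≠ 1} ⊆ Metric.ball 0 R := fun x y hy => by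
    by_contra hc
    exact hy (fR x y (by simpa using hc))
  have hcell := fun n => h.integral_cells hl ho (hιm n) (g := fun i => g (e i)) (fun i => g0 _)
    (fun i => g1 _) (f := fun i => f (e i)) (fun i => fm _) (fun i => f0 _) (fun i => f1 _)
    (fun i => (measure_mono (hfR _)).trans_lt hball) (b := fun i => ‖e i‖ + r n) (hblt n)
  have hfu : Measurable (Function.uncurry fun i => f (e i)) :=
    measurable_from_prod_countable_right fun i => fm (e i)
  refine tendsto_nhds_unique (f := fun n => ∫ ω, g (p n (X 0 ω)) * (if b n (X 0 ω) ≤ ‖X 1 ω‖ then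
        ptProd (f (p n (X 0 ω))) (fun j => X (j + 1) ω) else 0) ∂μ) (l := atTop) ?_ ?_
  · refine tendsto_integral_of_dominated_convergence (fun _ => 1) (fun n => ?_)
      (integrable_const 1) (fun n => Eventually.of_forall fun ω => ?_) ?_
    · refine ((measurable_from_nat (f := fun i => g (e i))).comp ((hιm n).comp (hX 0))).mul
        (Measurable.ite ?_ ?_ measurable_const) |>.aestronglyMeasurable
      · exact measurableSet_le ((measurable_from_nat (f := fun i => ‖e i‖ + r n)).comp
          ((hιm n).comp (hX 0))) (hX 1).norm
      · refine measurable_ptProd (f := fun ω => f (p n (X 0 ω))) ?_ fun i => hX (i + 1)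
        exact hfu.comp (((hιm n).comp ((hX 0).comp measurable_fst)).prodMk measurable_snd)
    · have ha := ptProd_nonneg (x := fun j => X (j + 1) ω) (f0 (p n (X 0 ω)))
      have hb := ptProd_le_one (x := fun j => X (j + 1) ω) (f0 (p n (X 0 ω)))
      rw [norm_mul, Real.norm_of_nonneg (g0 _)]
      split_ifs
      · rw [Real.norm_of_nonneg ha]; exact mul_le_one₀ (g1 _) ha hb
      · simp
    · filter_upwards [h.ae_finite Metric.isOpen_ball.measurableSet hball] with ω hω
      refine ((gc.tendsto _).comp (hplim _)).mul ?_
      split_ifs with hlt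
      · have hev : ∀ᶠ n in atTop, b n (X 0 ω) ≤ ‖X 1 ω‖ :=
          (hblim _).eventually_le_const hlt
        have hJ : {j | X (j + 1) ω ∈ Metric.ball (0 : Plane) R}.Finite :=
          hω.preimage (f := fun j => j + 1) (add_left_injective 1).injOn
        have hone : ∀ x j, j ∉ hJ.toFinset → f x (X (j + 1) ω) = 1 := fun x j hj =>
          fR x _ (by simpa using hj)
        rw [ptProd_eq_prod (f0 _) (f1 _) hJ.toFinset (hone _)]
        refine (tendsto_finsetProd hJ.toFinset fun j _ =>
          ((fc (X (j + 1) ω)).tendsto _).comp (hplim (X 0 ω))).congr' ?_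
        filter_upwards [hev] with n hn
        rw [if_pos hn, ptProd_eq_prod (f0 _) (f1 _) hJ.toFinset (hone _)]
        rfl
      · refine tendsto_const_nhds.congr fun n => ?_
        rw [if_neg ((not_lt.1 hlt).trans_lt (hblt n _)).not_ge]
  · simp only [hp, hbdef]
    simp_rw [hcell]
    have hG : Integrable fun x : Plane => lam * Real.exp (-(lam * Real.pi) * ‖x‖ ^ 2) :=
      (integrable_exp_neg_mul_norm_sq_plane (mul_pos hl Real.pi_pos)).const_mul _
    refine tendsto_integral_of_dominated_convergence _ (fun n => ?_) hG
      (fun n => Eventually.of_forall fun x => ?_) (Eventually.of_forall fun x => ?_)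
    · exact ((measurable_from_nat (f := fun i => lam * g (e i) *
        Real.exp (-(lam * (Real.pi * (‖e i‖ + r n) ^ 2))) *
        Real.exp (-(lam * ∫ y in {y | ‖e i‖ + r n ≤ ‖y‖}, (1 - f (e i) y))))).comp
          (hιm n)).aestronglyMeasurable
    · rw [Real.norm_of_nonneg (by have := g0 (e (ι n x)); positivity)]
      have e1 : Real.exp (-(lam * ∫ y in {y | ‖e (ι n x)‖ + r n ≤ ‖y‖},
          (1 - f (e (ι n x)) y))) ≤ 1 := by
        rw [Real.exp_le_one_iff, neg_nonpos]
        exact mul_nonneg hl.le (integral_nonneg fun y => sub_nonneg.2 (f1 _ y))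
      have e2 : Real.exp (-(lam * (Real.pi * (‖e (ι n x)‖ + r n) ^ 2))) ≤
          Real.exp (-(lam * Real.pi) * ‖x‖ ^ 2) := by
        refine Real.exp_le_exp.2 ?_
        have : ‖x‖ ^ 2 ≤ (‖e (ι n x)‖ + r n) ^ 2 := by gcongr; exact (hblt n x).le
        have := mul_le_mul_of_nonneg_left this (mul_pos hl Real.pi_pos).le
        linarith
      calc _ ≤ lam * 1 * Real.exp (-(lam * Real.pi) * ‖x‖ ^ 2) * 1 := by
            gcongr; exact g1 _
        _ = _ := by ring
    · refine Tendsto.mul (Tendsto.mul (((gc.tendsto _).comp (hplim x)).const_mul _)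
        ((Real.continuous_exp.tendsto _).comp
          ((((hblim x).pow 2).const_mul _).const_mul _).neg))
        ((Real.continuous_exp.tendsto _).comp (Tendsto.neg (Tendsto.const_mul _ ?_)))
      have hms : ∀ t, MeasurableSet {y : Plane | t ≤ ‖y‖} := fun t =>
        measurableSet_le measurable_const measurable_norm
      have hms' : MeasurableSet {y : Plane | ‖x‖ < ‖y‖} :=
        measurableSet_lt measurable_const measurable_norm
      simp_rw [← integral_indicator (hms _), ← integral_indicator hms']
      refine tendsto_integral_of_dominated_convergence
        ((Metric.ball (0 : Plane) R).indicator fun _ => 1) (fun n => ?_)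
        ((integrable_indicator_iff Metric.isOpen_ball.measurableSet).2
          (integrableOn_const hball.ne))
        (fun n => Eventually.of_forall fun y => ?_) (Eventually.of_forall fun y => ?_)
      · exact ((measurable_const.sub (fm _)).indicator (hms _)).aestronglyMeasurable
      · refine (norm_indicator_le_norm_self _ _).trans ?_
        by_cases hy : y ∈ Metric.ball (0 : Plane) R
        · rw [indicator_of_mem hy, Real.norm_of_nonneg (sub_nonneg.2 (f1 _ y))]
          linarith [f0 (e (ι n x)) y]
        · rw [fR _ y (by simpa using hy), indicator_of_notMem hy]; simp
      · by_cases hy : ‖x‖ < ‖y‖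
        · rw [indicator_of_mem (s := {y : Plane | ‖x‖ < ‖y‖}) hy]
          refine ((((fc y).tendsto _).comp (hplim x)).const_sub 1).congr' ?_
          filter_upwards [(hblim x).eventually_le_const hy] with n hn
          rw [indicator_of_mem (s := {y : Plane | ‖e (ι n x)‖ + r n ≤ ‖y‖}) hn]
          rfl
        · rw [indicator_of_notMem (s := {y : Plane | ‖x‖ < ‖y‖}) hy]
          refine tendsto_const_nhds.congr fun n => ?_
          rw [indicator_of_notMem (s := {y : Plane | ‖e (ι n x)‖ + r n ≤ ‖y‖})]
          exact ((not_lt.1 hy).trans_lt (hblt n x)).not_ge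

/-- With `f = g = 1` the formula gives the probability of no tie as `∫ λ exp (-λ π ‖x‖²)`, and this
Gaussian integral is `1`. -/
lemma ae_norm_lt (h : IsHPPP μ lam X) (hl : 0 < lam)
    (ho : ∀ᵐ ω ∂μ, Monotone fun i => ‖X i ω‖) : ∀ᵐ ω ∂μ, ‖X 0 ω‖ < ‖X 1 ω‖ := by
  have hX := h.measurable_point
  have key := h.integral_nearest_of_bounded hl ho (g := fun _ => 1) continuous_const
    (fun _ => zero_le_one) (fun _ => le_rfl) (f := fun _ _ => 1) (fun _ => measurable_const)
    (fun _ => continuous_const) (fun _ _ => zero_le_one) (fun _ _ => le_rfl) (R := 0)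
    (fun _ _ _ => rfl)
  have hm : MeasurableSet {ω | ‖X 0 ω‖ < ‖X 1 ω‖} := measurableSet_lt (hX 0).norm (hX 1).norm
  have h1 : μ.real {ω | ‖X 0 ω‖ < ‖X 1 ω‖} = 1 := by
    rw [← integral_indicator_one hm]
    calc _ = _ := integral_congr_ae (Eventually.of_forall fun ω => ?_)
      _ = _ := key
      _ = 1 := ?_
    · simp only [indicator, mem_ofPred_eq, Pi.one_apply, one_mul]
      split_ifs
      · simp [ptProd]
      · rfl
    · simp only [sub_self, integral_zero, mul_zero, neg_zero, Real.exp_zero, mul_one]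
      rw [integral_const_mul]
      have := integral_exp_neg_mul_norm_sq_plane (mul_pos hl Real.pi_pos)
      simp only [neg_mul, mul_assoc] at this ⊢
      rw [this]
      field_simp
  rw [measureReal_def, ENNReal.toReal_eq_one_iff] at h1
  exact (prob_compl_eq_zero_iff hm).2 h1

/-- The joint law of the nearest point and of the remaining points of a homogeneous Poisson
process, tested against products. -/
theorem integral_nearest (h : IsHPPP μ lam X) (hl : 0 < lam)
    (ho : ∀ᵐ ω ∂μ, Monotone fun i => ‖X i ω‖)
    {g : Plane → ℝ} (gc : Continuous g) (g0 : ∀ x, 0 ≤ g x) (g1 : ∀ x, g x ≤ 1)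
    {f : Plane → Plane → ℝ} (fm : Measurable (Function.uncurry f))
    (fc : ∀ y, Continuous fun x => f x y)
    (f0 : ∀ x y, 0 ≤ f x y) (f1 : ∀ x y, f x y ≤ 1) (fi : ∀ x, Integrable fun y => 1 - f x y) :
    ∫ ω, g (X 0 ω) * ptProd (f (X 0 ω)) (fun j => X (j + 1) ω) ∂μ =
      ∫ x, lam * g x * Real.exp (-(lam * (Real.pi * ‖x‖ ^ 2))) *
        Real.exp (-(lam * ∫ y in {y | ‖x‖ < ‖y‖}, (1 - f x y))) := by
  have hX := h.measurable_point
  -- Truncating `f` to `1` outside the ball of radius `n` brings the bounded case into play.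
  set F : ℕ → Plane → Plane → ℝ := fun n x y => if ‖y‖ < n then f x y else 1 with hF
  have F0 : ∀ n x y, 0 ≤ F n x y := fun n x y => by
    simp only [hF]; split_ifs; exacts [f0 x y, zero_le_one]
  have F1 : ∀ n x y, F n x y ≤ 1 := fun n x y => by
    simp only [hF]; split_ifs; exacts [f1 x y, le_rfl]
  have Ff : ∀ n x y, f x y ≤ F n x y := fun n x y => by
    simp only [hF]; split_ifs; exacts [le_rfl, f1 x y]
  have Fev : ∀ y : Plane, ∀ᶠ n : ℕ in atTop, ∀ x, F n x y = f x y := fun y => by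
    filter_upwards [tendsto_natCast_atTop_atTop.eventually_gt_atTop ‖y‖] with n hn x
    simp only [hF]; rw [if_pos hn]
  have Fm : ∀ n, Measurable (Function.uncurry (F n)) := fun n =>
    Measurable.ite (measurableSet_lt measurable_snd.norm measurable_const) fm measurable_const
  have Fm' : ∀ n x, Measurable (F n x) := fun n x => (Fm n).of_uncurry_left
  have Fc : ∀ n y, Continuous fun x => F n x y := fun n y => by
    simp only [hF]; split_ifs
    exacts [fc y, continuous_const]
  have F2 : ∀ (n : ℕ) (x y : Plane), (n : ℝ) ≤ ‖y‖ → F n x y = 1 := fun n x y hy => by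
    simp only [hF]; rw [if_neg hy.not_gt]
  clear_value F
  have hb := fun n : ℕ => h.integral_nearest_of_bounded hl ho gc g0 g1 (Fm' n) (Fc n) (F0 n)
    (F1 n) (F2 n)
  have hb' : ∀ n : ℕ, ∫ ω, g (X 0 ω) * ptProd (F n (X 0 ω)) (fun j => X (j + 1) ω) ∂μ =
      ∫ x, lam * g x * Real.exp (-(lam * (Real.pi * ‖x‖ ^ 2))) *
        Real.exp (-(lam * ∫ y in {y | ‖x‖ < ‖y‖}, (1 - F n x y))) := fun n => by
    rw [← hb n]
    refine integral_congr_ae ?_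
    filter_upwards [h.ae_norm_lt hl ho] with ω hω
    rw [if_pos hω]
  refine tendsto_nhds_unique (f := fun n => ∫ ω, g (X 0 ω) *
    ptProd (F n (X 0 ω)) (fun j => X (j + 1) ω) ∂μ) (l := atTop) ?_ ?_
  · refine tendsto_integral_of_dominated_convergence (fun _ => 1) (fun n => ?_)
      (integrable_const 1) (fun n => Eventually.of_forall fun ω => ?_)
      (Eventually.of_forall fun ω => ?_)
    · refine ((gc.measurable.comp (hX 0)).mul ?_).aestronglyMeasurable
      refine measurable_ptProd (f := fun ω => F n (X 0 ω)) ?_ fun i => hX (i + 1)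
      exact (Fm n).comp (((hX 0).comp measurable_fst).prodMk measurable_snd)
    · have ha := ptProd_nonneg (x := fun j => X (j + 1) ω) (F0 n (X 0 ω))
      have hb := ptProd_le_one (x := fun j => X (j + 1) ω) (F0 n (X 0 ω))
      rw [norm_mul, Real.norm_of_nonneg (g0 _), Real.norm_of_nonneg ha]
      exact mul_le_one₀ (g1 _) ha hb
    -- Truncation only increases the product, which gives the lower bound. For the upper bound, a
    -- finite partial product already close to the limit is eventually unaffected by truncation and
    -- dominates the truncated product.
    · refine Tendsto.const_mul _ (tendsto_order.2 ⟨fun a ha => Eventually.of_forall fun n =>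
        ha.trans_le (ptProd_mono (f0 _) (Ff n _)), fun a ha => ?_⟩)
      obtain ⟨m, hm⟩ := ((tendsto_ptProd (x := fun j => X (j + 1) ω) (f0 (X 0 ω))
        (f1 (X 0 ω))).eventually_lt_const ha).exists
      filter_upwards [(Finset.eventually_all (Finset.range m)).2
        fun j _ => Fev (X (j + 1) ω)] with n hn
      refine (ptProd_le_prod (F0 n _) m).trans_lt ?_
      rwa [Finset.prod_congr rfl fun j hj => hn j hj _]
  · simp_rw [hb']
    have hG : Integrable fun x : Plane => lam * Real.exp (-(lam * Real.pi) * ‖x‖ ^ 2) :=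
      (integrable_exp_neg_mul_norm_sq_plane (mul_pos hl Real.pi_pos)).const_mul _
    refine tendsto_integral_of_dominated_convergence _ (fun n => ?_) hG
      (fun n => Eventually.of_forall fun x => ?_) (Eventually.of_forall fun x => ?_)
    · have h1 := measurable_setIntegral_norm_lt (F := fun p => 1 - F n p.1 p.2)
        (measurable_const.sub (Fm n))
      exact (((gc.measurable.const_mul _).mul (by fun_prop)).mul
        ((h1.const_mul lam).neg.exp)).aestronglyMeasurable
    · rw [Real.norm_of_nonneg (by have := g0 x; positivity)]
      have e1 : Real.exp (-(lam * ∫ y in {y | ‖x‖ < ‖y‖}, (1 - F n x y))) ≤ 1 := by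
        rw [Real.exp_le_one_iff, neg_nonpos]
        exact mul_nonneg hl.le (integral_nonneg fun y => sub_nonneg.2 (F1 n _ y))
      calc _ ≤ lam * 1 * Real.exp (-(lam * (Real.pi * ‖x‖ ^ 2))) * 1 := by
            gcongr; exact g1 _
        _ = _ := by ring_nf
    · refine Tendsto.const_mul _
        ((Real.continuous_exp.tendsto _).comp (Tendsto.neg (Tendsto.const_mul _ ?_)))
      refine tendsto_integral_of_dominated_convergence _ (fun n => ?_) (fi x).integrableOn
        (fun n => Eventually.of_forall fun y => ?_) (Eventually.of_forall fun y => ?_)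
      · exact (measurable_const.sub ((Fm n).of_uncurry_left)).aestronglyMeasurable
      · rw [Real.norm_of_nonneg (sub_nonneg.2 (F1 n x y))]
        linarith [Ff n x y]
      · refine tendsto_const_nhds.congr' ?_
        filter_upwards [Fev y] with n hn
        rw [hn x]

end IsHPPP

/-! ### Path loss exponent four: the integral in the formula. -/

/-- The arctangent stays below `π / 2` and the fraction below `1`, so a constant times `d exp (-λ π
d²)` dominates. -/
lemma integrableOn_nearestIntegrand {lam φ s : ℝ} (hl : 0 < lam) (hφ : 0 < φ) (hs : 0 < s) :
    IntegrableOn (nearestIntegrand lam φ s) (Ioi (0 : ℝ)) := by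
  set M := Real.exp (1 / 2 * Real.pi * lam * Real.sqrt s * (Real.pi / 2)) with hM
  have hI : IntegrableOn (fun d : ℝ => M * (2 * lam * Real.pi) *
      (d * Real.exp (-(lam * Real.pi) * d ^ 2))) (Ioi 0) := by
    have := (integrable_mul_exp_neg_mul_sq (mul_pos hl Real.pi_pos)).const_mul
      (M * (2 * lam * Real.pi))
    exact this.integrableOn
  refine hI.mono' ?_ ?_
  · unfold nearestIntegrand
    exact Measurable.aestronglyMeasurable (by fun_prop)
  · refine (ae_restrict_iff' measurableSet_Ioi).2 (Eventually.of_forall fun d hd => ?_)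
    have hd0 : 0 < d := hd
    unfold nearestIntegrand
    rw [Real.norm_of_nonneg (by positivity)]
    have e1 : Real.exp (1 / 2 * Real.pi * lam * Real.sqrt s *
      Real.arctan (Real.sqrt (-(1 / 2) + 1 / 2 * Real.sqrt (1 + 16 * d ^ 4 / s)))) ≤ M :=
      Real.exp_le_exp.2 (mul_le_mul_of_nonneg_left (Real.arctan_lt_pi_div_two _).le (by positivity))
    have e2 : 1 / (1 + φ * s * (d ^ 4)⁻¹) ≤ 1 :=
      (div_le_one (by positivity)).2 (le_add_of_nonneg_right (by positivity))
    calc _ ≤ M * 1 * (2 * lam * Real.pi * d * Real.exp (-(lam * Real.pi * d ^ 2))) := by gcongr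
      _ = _ := by ring_nf

namespace IsHPPP
variable {Ω : Type*} [MeasurableSpace Ω] {μ : Measure Ω} [IsProbabilityMeasure μ] {lam : ℝ}
  {X : ℕ → Ω → Plane}

/-- The factor `1 / (1 + s / ‖y - x‖ ^ 4)` is written as `‖y - x‖ ^ 4 / (‖y - x‖ ^ 4 + s)`, which is
continuous also at `y = x`. -/
lemma integral_nearest_pathLoss (h : IsHPPP μ lam X) (hl : 0 < lam)
    (ho : ∀ᵐ ω ∂μ, Monotone fun i => ‖X i ω‖)
    {g : Plane → ℝ} (gc : Continuous g) (g0 : ∀ x, 0 ≤ g x) (g1 : ∀ x, g x ≤ 1)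
    {s : ℝ} (hs : 0 < s) :
    ∫ ω, g (X 0 ω) * ptProd (fun y => ‖y - X 0 ω‖ ^ 4 / (‖y - X 0 ω‖ ^ 4 + s))
        (fun j => X (j + 1) ω) ∂μ =
      Real.exp (-(Real.pi ^ 2 * lam * Real.sqrt s / 2)) *
      ∫ x : Plane, lam * g x * Real.exp (-(lam * (Real.pi * ‖x‖ ^ 2))) *
        Real.exp (1 / 2 * Real.pi * lam * Real.sqrt s * Real.arctan (Real.sqrt (-(1 / 2) +
          1 / 2 * Real.sqrt (1 + 16 * ‖x‖ ^ 4 / s)))) := by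
  have hne : ∀ x y : Plane, ‖y - x‖ ^ 4 + s ≠ 0 := fun x y => by positivity
  have h1 : ∀ x y : Plane, 1 - ‖y - x‖ ^ 4 / (‖y - x‖ ^ 4 + s) = s / (‖y - x‖ ^ 4 + s) :=
    fun x y => by rw [eq_div_iff (hne x y)]; field_simp [hne x y]; ring
  have hfm : Measurable (Function.uncurry fun x y : Plane =>
      ‖y - x‖ ^ 4 / (‖y - x‖ ^ 4 + s)) := by
    simp only [Function.uncurry_def]; fun_prop
  have hfc : ∀ y : Plane, Continuous fun x : Plane => ‖y - x‖ ^ 4 / (‖y - x‖ ^ 4 + s) :=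
    fun y => Continuous.div (by fun_prop) (by fun_prop) fun x => hne x y
  rw [h.integral_nearest hl ho gc g0 g1 hfm hfc]
  · rw [← integral_const_mul]
    refine integral_congr_ae (Eventually.of_forall fun x => ?_)
    simp only [h1]
    rw [setIntegral_norm_lt_div hs x, mul_sub, neg_sub, sub_eq_add_neg, Real.exp_add]
    ring_nf
  · exact fun x y => by positivity
  · exact fun x y => (div_le_one (by positivity)).2 (by linarith)
  · intro x
    simp only [h1]
    exact (integrable_div_norm_pow_four_add hs).comp_sub_right x

lemma integral_nearest_pathLoss_eq (h : IsHPPP μ lam X) (hl : 0 < lam)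
    (ho : ∀ᵐ ω ∂μ, Monotone fun i => ‖X i ω‖) {φ s : ℝ} (hφ : 0 < φ) (hs : 0 < s) :
    ∫ ω, ‖X 0 ω‖ ^ 4 / (‖X 0 ω‖ ^ 4 + φ * s) *
        ptProd (fun y => ‖y - X 0 ω‖ ^ 4 / (‖y - X 0 ω‖ ^ 4 + s)) (fun j => X (j + 1) ω) ∂μ =
      Real.exp (-(Real.pi ^ 2 * lam * Real.sqrt s / 2)) *
        ∫ d in Ioi (0 : ℝ), nearestIntegrand lam φ s d := by
  have hφs : 0 < φ * s := mul_pos hφ hs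
  rw [h.integral_nearest_pathLoss hl ho (g := fun x => ‖x‖ ^ 4 / (‖x‖ ^ 4 + φ * s))
    (Continuous.div (by fun_prop) (by fun_prop) fun x => by positivity) (fun x => by positivity)
    (fun x => (div_le_one (by positivity)).2 (by linarith)) hs]
  congr 1
  rw [integral_fun_norm_plane (fun r => lam * (r ^ 4 / (r ^ 4 + φ * s)) *
    Real.exp (-(lam * (Real.pi * r ^ 2))) *
        Real.exp (1 / 2 * Real.pi * lam * Real.sqrt s * Real.arctan (Real.sqrt (-(1 / 2) +
          1 / 2 * Real.sqrt (1 + 16 * r ^ 4 / s))))), ← integral_const_mul]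
  refine setIntegral_congr_fun measurableSet_Ioi fun d hd => ?_
  have hd0 : 0 < d := hd
  have e : 1 / (1 + φ * s * (d ^ 4)⁻¹) = d ^ 4 / (d ^ 4 + φ * s) := by field_simp
  simp only [nearestIntegrand]
  rw [e]
  ring_nf

/-- The arctangent is nonnegative, so the integral over `x` is at least `1`, and `exp (-a) ≥ 1 - a`
does the rest. The bound serves both for the finiteness of the interference and for the probability
of a close station. -/
lemma le_integral_nearest_pathLoss (h : IsHPPP μ lam X) (hl : 0 < lam)
    (ho : ∀ᵐ ω ∂μ, Monotone fun i => ‖X i ω‖) {s : ℝ} (hs : 0 < s) :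
    1 - Real.pi ^ 2 * lam * Real.sqrt s / 2 ≤
    ∫ ω, ptProd (fun y => ‖y - X 0 ω‖ ^ 4 / (‖y - X 0 ω‖ ^ 4 + s)) (fun j => X (j + 1) ω) ∂μ := by
  have := h.integral_nearest_pathLoss hl ho (g := fun _ => 1) continuous_const
    (fun _ => zero_le_one) (fun _ => le_rfl) hs
  simp only [one_mul, mul_one] at this
  rw [this]
  have hA : Integrable fun x : Plane => lam * Real.exp (-(lam * (Real.pi * ‖x‖ ^ 2))) := by
    have := (integrable_exp_neg_mul_norm_sq_plane (mul_pos hl Real.pi_pos)).const_mul lam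
    simpa only [neg_mul, mul_assoc] using this
  have hA1 : ∫ x : Plane, lam * Real.exp (-(lam * (Real.pi * ‖x‖ ^ 2))) = 1 := by
    have := integral_exp_neg_mul_norm_sq_plane (mul_pos hl Real.pi_pos)
    simp only [neg_mul, mul_assoc] at this
    rw [integral_const_mul, this]
    field_simp
  have hB : 1 ≤ ∫ x : Plane, lam * Real.exp (-(lam * (Real.pi * ‖x‖ ^ 2))) *
        Real.exp (1 / 2 * Real.pi * lam * Real.sqrt s * Real.arctan (Real.sqrt (-(1 / 2) +
          1 / 2 * Real.sqrt (1 + 16 * ‖x‖ ^ 4 / s)))) := by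
    refine hA1.ge.trans (integral_mono hA ?_ fun x => ?_)
    · refine (hA.mul_const (Real.exp (1 / 2 * Real.pi * lam * Real.sqrt s *
        (Real.pi / 2)))).mono' (Measurable.aestronglyMeasurable (by fun_prop))
        (Eventually.of_forall fun x => ?_)
      rw [Real.norm_of_nonneg (by positivity)]
      exact mul_le_mul_of_nonneg_left (Real.exp_le_exp.2 (mul_le_mul_of_nonneg_left
        (Real.arctan_lt_pi_div_two _).le (by positivity))) (by positivity)
    · refine le_mul_of_one_le_right (by positivity) (Real.one_le_exp ?_)
      have := Real.arctan_nonneg.2 (Real.sqrt_nonneg (-(1 / 2) +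
          1 / 2 * Real.sqrt (1 + 16 * ‖x‖ ^ 4 / s)))
      positivity
  calc 1 - Real.pi ^ 2 * lam * Real.sqrt s / 2
      ≤ Real.exp (-(Real.pi ^ 2 * lam * Real.sqrt s / 2)) * 1 := by
        rw [mul_one]; linarith [Real.add_one_le_exp (-(Real.pi ^ 2 * lam * Real.sqrt s / 2))]
    _ ≤ _ := by gcongr

end IsHPPP

/-! ### The distribution function of a gain and its Gauss–Chebyshev quadrature. -/

/-- The distribution function of the gain `‖h‖ ^ 2 / ‖y‖ ^ 4` for a Rayleigh coefficient `h` and a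
point `y` uniform in a disk of radius `Rc`, with `‖y‖ = Rc / 2 * (cos u + 1)`. -/
def gainCDF (Rc t : ℝ) : ℝ :=
  1 - ∫ u in (0 : ℝ)..Real.pi, (1 + Real.cos u) / 2 * Real.sin u *
    Real.exp (-((Rc / 2 * Real.cos u + Rc / 2) ^ 4 * t))

/-- The weight is `sin u / 2 + sin (2 u) / 4`, with Lipschitz constant `1/2 + 2/4 = 1`. -/
lemma abs_sin_weight_sub_le (u v : ℝ) :
    |(1 + Real.cos v) / 2 * Real.sin v - (1 + Real.cos u) / 2 * Real.sin u| ≤ |v - u| := by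
  have e : ∀ u, (1 + Real.cos u) / 2 * Real.sin u = 1 / 2 * Real.sin u + 1 / 4 * Real.sin (2 * u) :=
    fun u => by rw [Real.sin_two_mul]; ring
  have hs : ∀ a b : ℝ, |Real.sin a - Real.sin b| ≤ |a - b| := fun a b => by
    simpa [Real.dist_eq] using Real.lipschitzWith_sin.dist_le_mul a b
  rw [e, e]
  have h1 := hs v u
  have h2 := hs (2 * v) (2 * u)
  rw [← mul_sub, abs_mul, abs_two] at h2
  calc _ = |1 / 2 * (Real.sin v - Real.sin u) + 1 / 4 * (Real.sin (2 * v) - Real.sin (2 * u))| := by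
        ring_nf
    _ ≤ |1 / 2 * (Real.sin v - Real.sin u)| + |1 / 4 * (Real.sin (2 * v) - Real.sin (2 * u))| :=
        abs_add_le _ _
    _ = 1 / 2 * |Real.sin v - Real.sin u| + 1 / 4 * |Real.sin (2 * v) - Real.sin (2 * u)| := by
        rw [abs_mul, abs_mul, abs_of_pos (by norm_num : (0 : ℝ) < 1 / 2),
          abs_of_pos (by norm_num : (0 : ℝ) < 1 / 4)]
    _ ≤ _ := by linarith

lemma abs_sin_weight_le_one (u : ℝ) : |(1 + Real.cos u) / 2 * Real.sin u| ≤ 1 := by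
  rw [abs_mul]
  refine mul_le_one₀ ?_ (abs_nonneg _) (Real.abs_sin_le_one u)
  rw [abs_of_nonneg (by linarith [Real.neg_one_le_cos u])]
  linarith [Real.cos_le_one u]

lemma sin_weight_nonneg {u : ℝ} (hu : u ∈ Icc 0 Real.pi) :
    0 ≤ (1 + Real.cos u) / 2 * Real.sin u :=
  mul_nonneg (by linarith [Real.neg_one_le_cos u]) (Real.sin_nonneg_of_mem_Icc hu)

lemma integral_sin_weight :
    ∫ u in (0 : ℝ)..Real.pi, (1 + Real.cos u) / 2 * Real.sin u = 1 := by
  rw [intervalIntegral.integral_eq_sub_of_hasDerivAt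
    (f := fun u => -(1 / 2) * Real.cos u - 1 / 4 * Real.cos u ^ 2)]
  · simp; norm_num
  · intro u _
    refine (((Real.hasDerivAt_cos u).const_mul _).sub
      (((Real.hasDerivAt_cos u).pow 2).const_mul _)).congr_deriv ?_
    simp; ring
  · exact Continuous.intervalIntegrable (by fun_prop) _ _

/-- Midpoint rule for the product of a bounded Lipschitz function and a monotone function with
values in `[0, 1]`. -/
lemma abs_integral_sub_midpoint_le {p E : ℝ → ℝ} (hp : Continuous p) (hE : Continuous E)
    (hp1 : ∀ u, |p u| ≤ 1) (hpl : ∀ u v, |p v - p u| ≤ |v - u|)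
    (hE0 : ∀ u, 0 ≤ E u) (hE1 : ∀ u, E u ≤ 1) {b : ℝ} (hb : 0 ≤ b) (hm : MonotoneOn E (Icc 0 b))
    {N : ℕ} (hN : 0 < N) :
    |(∫ u in (0 : ℝ)..b, p u * E u) -
      ∑ n ∈ Finset.range N, b / N * (p ((2 * n + 1) / (2 * N) * b) * E ((2 * n + 1) / (2 * N) * b))|
      ≤ (b ^ 2 + b) / N := by
  have hN0 : (0 : ℝ) < N := by exact_mod_cast hN
  set h := b / N with hh
  have hh0 : 0 ≤ h := by positivity
  have hhN : N * h = b := by rw [hh]; field_simp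
  set a : ℕ → ℝ := fun n => n * h with ha
  set m : ℕ → ℝ := fun n => (2 * n + 1) / (2 * N) * b with hmdef
  have ham : ∀ n : ℕ, m n = n * h + h / 2 := fun n => by simp only [hmdef, hh]; field_simp
  have hG : Continuous fun u => p u * E u := hp.mul hE
  have hsum : ∫ u in (0 : ℝ)..b, p u * E u =
      ∑ n ∈ Finset.range N, ∫ u in a n..a (n + 1), p u * E u := by
    rw [intervalIntegral.sum_integral_adjacent_intervals
      fun k _ => hG.intervalIntegrable _ _]
    simp [ha, hhN]
  rw [hsum, ← Finset.sum_sub_distrib]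
  -- On one cell the Lipschitz factor varies by at most `h` and the monotone factor by at most its
  -- increment. The increments telescope to at most `1`, so the total error is at most `h (b + 1)`.
  have hcell : ∀ n ∈ Finset.range N, |(∫ u in a n..a (n + 1), p u * E u) -
      h * (p (m n) * E (m n))| ≤ h * (h + (E (a (n + 1)) - E (a n))) := by
    intro n hn
    have hn' : (n : ℝ) + 1 ≤ N := by exact_mod_cast Finset.mem_range.1 hn
    have hw : a (n + 1) - a n = h := by simp only [ha]; push_cast; ring
    have hab : a n ≤ a (n + 1) := by linarith
    have ha0 : 0 ≤ a n := by simp only [ha]; positivity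
    have hab' : a (n + 1) ≤ b := by
      simp only [ha]; push_cast
      calc _ ≤ N * h := by gcongr
        _ = b := hhN
    have e : h * (p (m n) * E (m n)) = ∫ u in a n..a (n + 1), p (m n) * E (m n) := by
      rw [intervalIntegral.integral_const, hw, smul_eq_mul]
    rw [e, ← intervalIntegral.integral_sub (hG.intervalIntegrable _ _)
      (continuous_const.intervalIntegrable _ _)]
    have := intervalIntegral.norm_integral_le_of_norm_le_const (a := a n) (b := a (n + 1))
      (C := h + (E (a (n + 1)) - E (a n))) (f := fun u => p u * E u - p (m n) * E (m n)) ?_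
    · rw [hw, abs_of_nonneg hh0, Real.norm_eq_abs] at this
      linarith
    · intro u hu
      rw [uIoc_of_le hab] at hu
      have hmn : a n ≤ m n ∧ m n ≤ a (n + 1) := by
        rw [ham]; simp only [ha]; push_cast; constructor <;> linarith
      have i1 : a n ∈ Icc 0 b := ⟨ha0, hab.trans hab'⟩
      have i2 : a (n + 1) ∈ Icc 0 b := ⟨ha0.trans hab, hab'⟩
      have iu : u ∈ Icc 0 b := ⟨ha0.trans hu.1.le, hu.2.trans hab'⟩
      have im : m n ∈ Icc 0 b := ⟨ha0.trans hmn.1, hmn.2.trans hab'⟩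
      have d1 : |E u - E (m n)| ≤ E (a (n + 1)) - E (a n) := by
        have := hm i1 iu hu.1.le
        have := hm iu i2 hu.2
        have := hm i1 im hmn.1
        have := hm im i2 hmn.2
        rw [abs_le]; constructor <;> linarith
      have d2 : |u - m n| ≤ h := by
        rw [abs_le]; constructor <;> linarith [hu.1, hu.2, hmn.1, hmn.2]
      calc ‖p u * E u - p (m n) * E (m n)‖
          = |(p u - p (m n)) * E u + p (m n) * (E u - E (m n))| := by
            rw [Real.norm_eq_abs]; ring_nf
        _ ≤ |(p u - p (m n)) * E u| + |p (m n) * (E u - E (m n))| := abs_add_le _ _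
        _ = |p u - p (m n)| * E u + |p (m n)| * |E u - E (m n)| := by
            rw [abs_mul, abs_mul, abs_of_nonneg (hE0 u)]
        _ ≤ h * 1 + 1 * (E (a (n + 1)) - E (a n)) := by
            gcongr
            · exact hE0 u
            · exact (hpl _ _).trans d2
            · exact hE1 u
            · exact hp1 _
        _ = _ := by ring
  refine (Finset.abs_sum_le_sum_abs _ _).trans ((Finset.sum_le_sum hcell).trans ?_)
  rw [← Finset.mul_sum, Finset.sum_add_distrib, Finset.sum_range_sub (fun n => E (a n))]
  simp only [Finset.sum_const, Finset.card_range, nsmul_eq_mul, hhN]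
  have := hE1 (a N)
  have := hE0 (a 0)
  calc h * (b + (E (a N) - E (a 0))) ≤ h * (b + 1) := by gcongr; linarith
    _ = _ := by rw [hh]; ring

lemma monotoneOn_exp_neg_dist {Rc t : ℝ} (hR : 0 ≤ Rc) (ht : 0 ≤ t) :
    MonotoneOn (fun u => Real.exp (-((Rc / 2 * Real.cos u + Rc / 2) ^ 4 * t)))
      (Icc 0 Real.pi) := by
  intro u hu v hv huv
  have h1 := Real.antitoneOn_cos hu hv huv
  have h2 : 0 ≤ Rc / 2 * Real.cos v + Rc / 2 := by nlinarith [Real.neg_one_le_cos v]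
  refine Real.exp_le_exp.2 (neg_le_neg (mul_le_mul_of_nonneg_right
    (pow_le_pow_left₀ h2 ?_ 4) ht))
  gcongr

/-- The nodes are the cosines of the midpoints of `N` equal subintervals of `[0, π]`, and `√(1 -
θ²)` is the sine there, so the sum is exactly the midpoint rule for the integral in `gainCDF`. Only
monotonicity in `u` and values in `[0, 1]` are used for the exponential, so the bound does not
depend on `Rc` or `t`. -/
theorem abs_chebCDF_sub_gainCDF_le {Rc t : ℝ} (hR : 0 ≤ Rc) (ht : 0 ≤ t) {N : ℕ} (hN : 0 < N) :
    |chebCDF 4 Rc N t - gainCDF Rc t| ≤ (Real.pi ^ 2 + Real.pi) / N := by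
  have hN0 : (0 : ℝ) < N := by exact_mod_cast hN
  have key := abs_integral_sub_midpoint_le (p := fun u => (1 + Real.cos u) / 2 * Real.sin u)
    (E := fun u => Real.exp (-((Rc / 2 * Real.cos u + Rc / 2) ^ 4 * t))) (by fun_prop)
    (by fun_prop) abs_sin_weight_le_one abs_sin_weight_sub_le (fun u => (Real.exp_pos _).le)
    (fun u => Real.exp_le_one_iff.2 (neg_nonpos.2 (by positivity))) Real.pi_pos.le
    (monotoneOn_exp_neg_dist hR ht) hN
  have e : ∑ n ∈ Finset.Icc 1 N, chebWeight N n * Real.exp (-(chebRate 4 Rc N n * t)) =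
      ∑ n ∈ Finset.range N, Real.pi / N * ((1 + Real.cos ((2 * n + 1) / (2 * N) * Real.pi)) / 2 *
        Real.sin ((2 * n + 1) / (2 * N) * Real.pi) *
        Real.exp (-((Rc / 2 * Real.cos ((2 * n + 1) / (2 * N) * Real.pi) + Rc / 2) ^ 4 * t))) := by
    rw [← Finset.Ico_add_one_right_eq_Icc, Finset.sum_Ico_eq_sum_range]
    simp only [Nat.add_sub_cancel]
    refine Finset.sum_congr rfl fun n hn => ?_
    have hn' : (n : ℝ) + 1 ≤ N := by exact_mod_cast Finset.mem_range.1 hn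
    have hnode : chebNode N (1 + n) = Real.cos ((2 * n + 1) / (2 * N) * Real.pi) := by
      unfold chebNode; congr 1; push_cast; ring
    have hle : (2 * (n : ℝ) + 1) / (2 * N) ≤ 1 := (div_le_one (by positivity)).2 (by linarith)
    have hsin : 0 ≤ Real.sin ((2 * n + 1) / (2 * N) * Real.pi) :=
      Real.sin_nonneg_of_nonneg_of_le_pi (by positivity)
        (mul_le_of_le_one_left Real.pi_pos.le hle)
    unfold chebWeight chebRate
    rw [hnode, ← Real.abs_sin_eq_sqrt_one_sub_cos_sq, abs_of_nonneg hsin]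
    rw [show (4 : ℝ) = ((4 : ℕ) : ℝ) by norm_num, Real.rpow_natCast]
    ring
  unfold chebCDF gainCDF
  rw [e]
  convert key using 2
  ring

lemma continuous_gain_integrand (Rc t : ℝ) : Continuous fun u => (1 + Real.cos u) / 2 *
    Real.sin u * Real.exp (-((Rc / 2 * Real.cos u + Rc / 2) ^ 4 * t)) := by fun_prop

lemma gainCDF_nonneg {Rc t : ℝ} (ht : 0 ≤ t) : 0 ≤ gainCDF Rc t := by
  unfold gainCDF
  rw [sub_nonneg]
  refine le_of_le_of_eq (b := ∫ u in (0 : ℝ)..Real.pi, (1 + Real.cos u) / 2 * Real.sin u)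
    ?_ integral_sin_weight
  refine intervalIntegral.integral_mono_on Real.pi_pos.le
    ((continuous_gain_integrand Rc t).intervalIntegrable _ _)
    (Continuous.intervalIntegrable (by fun_prop) _ _) fun u hu => ?_
  exact mul_le_of_le_one_right (sin_weight_nonneg hu)
    (Real.exp_le_one_iff.2 (neg_nonpos.2 (by positivity)))

lemma gainCDF_le_one {Rc t : ℝ} : gainCDF Rc t ≤ 1 := by
  unfold gainCDF
  rw [sub_le_self_iff]
  exact intervalIntegral.integral_nonneg Real.pi_pos.le fun u hu =>
    mul_nonneg (sin_weight_nonneg hu) (Real.exp_pos _).le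

lemma continuous_gainCDF (Rc : ℝ) : Continuous (gainCDF Rc) := by
  unfold gainCDF
  refine continuous_const.sub (intervalIntegral.continuous_parametric_intervalIntegral_of_continuous'
    ?_ _ _)
  fun_prop

/-- The difference is at most `exp (-x) (y - x) ≤ (κ - 1) x exp (-x)`, and `x exp (-x) ≤ 1`. -/
lemma abs_exp_neg_sub_exp_neg_le {κ x y : ℝ} (hxy : x ≤ y) (hy : y ≤ κ * x)
    (hκ : 1 ≤ κ) : |Real.exp (-x) - Real.exp (-y)| ≤ κ - 1 := by
  have h0 : Real.exp (-y) ≤ Real.exp (-x) := Real.exp_le_exp.2 (neg_le_neg hxy)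
  rw [abs_of_nonneg (sub_nonneg.2 h0)]
  have h1 : Real.exp (-y) = Real.exp (-x) * Real.exp (-(y - x)) := by
    rw [← Real.exp_add]; ring_nf
  have h2 := Real.add_one_le_exp (-(y - x))
  have h3 : Real.exp (-x) * x ≤ 1 := by
    rw [Real.exp_neg, inv_mul_le_iff₀ (Real.exp_pos x)]
    linarith [Real.add_one_le_exp x]
  calc Real.exp (-x) - Real.exp (-y) = Real.exp (-x) * (1 - Real.exp (-(y - x))) := by
        rw [h1]; ring
    _ ≤ Real.exp (-x) * ((κ - 1) * x) := by gcongr; linarith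
    _ = (κ - 1) * (Real.exp (-x) * x) := by ring
    _ ≤ (κ - 1) * 1 := by gcongr
    _ = _ := mul_one _

/-- `1 - gainCDF` averages functions `exp (-c t)` against a probability weight. The bound for each
exponential is independent of the rate `c`, hence survives averaging for every `Rc`. -/
theorem abs_gainCDF_sub_le {Rc κ t t' : ℝ} (htt : t ≤ t') (ht' : t' ≤ κ * t)
    (hκ : 1 ≤ κ) : |gainCDF Rc t - gainCDF Rc t'| ≤ κ - 1 := by
  unfold gainCDF
  rw [sub_sub_sub_cancel_left, ← intervalIntegral.integral_sub
    ((continuous_gain_integrand Rc t').intervalIntegrable _ _)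
    ((continuous_gain_integrand Rc t).intervalIntegrable _ _)]
  have hc : Continuous fun u : ℝ => (1 + Real.cos u) / 2 * Real.sin u * (κ - 1) := by fun_prop
  have hb : ∫ u in (0 : ℝ)..Real.pi, (1 + Real.cos u) / 2 * Real.sin u * (κ - 1) = κ - 1 := by
    rw [intervalIntegral.integral_mul_const, integral_sin_weight, one_mul]
  rw [← hb, ← Real.norm_eq_abs]
  refine intervalIntegral.norm_integral_le_of_norm_le Real.pi_pos.le
    (Eventually.of_forall fun u hu => ?_) (hc.intervalIntegrable 0 Real.pi)
  rw [← mul_sub, norm_mul, Real.norm_of_nonneg (sin_weight_nonneg (Ioc_subset_Icc_self hu)),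
    Real.norm_eq_abs, abs_sub_comm]
  refine mul_le_mul_of_nonneg_left (abs_exp_neg_sub_exp_neg_le ?_ ?_ hκ)
    (sin_weight_nonneg (Ioc_subset_Icc_self hu))
  · gcongr
  · rw [mul_left_comm]; gcongr

/-- The radius has density `2 r / Rc²` on `[0, Rc]`. The substitution `r = Rc / 2 * (cos u + 1)`
turns this into the weight in `gainCDF`. -/
lemma integral_exp_neg_uniform_disk {Rc : ℝ} (hR : 0 < Rc) (t : ℝ) :
    ∫ y, Real.exp (-(t * ‖y‖ ^ 4)) ∂(cond volume (Metric.closedBall (0 : Plane) Rc)) =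
      1 - gainCDF Rc t := by
  have hv : volume.real (Metric.closedBall (0 : Plane) Rc) = Real.pi * Rc ^ 2 := by
    rw [measureReal_def, Measure.addHaar_closedBall_eq_addHaar_ball, ← measureReal_def,
      volume_real_ball_plane _ hR.le]
  rw [ProbabilityTheory.cond, integral_smul_measure, ENNReal.toReal_inv, ← measureReal_def, hv,
    ← integral_indicator Metric.isClosed_closedBall.measurableSet]
  have e1 : ∀ y : Plane, (Metric.closedBall (0 : Plane) Rc).indicator
      (fun y => Real.exp (-(t * ‖y‖ ^ 4))) y =
      (Iic Rc).indicator (fun r => Real.exp (-(t * r ^ 4))) ‖y‖ := fun y => by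
    simp only [indicator, mem_closedBall_zero_iff, mem_Iic]
  simp_rw [e1]
  rw [integral_fun_norm_plane ((Iic Rc).indicator fun r => Real.exp (-(t * r ^ 4)))]
  have e2 : ∀ r, r * (Iic Rc).indicator (fun r => Real.exp (-(t * r ^ 4))) r =
      (Iic Rc).indicator (fun r => r * Real.exp (-(t * r ^ 4))) r := fun r => by
    simp only [indicator]; split_ifs <;> simp
  simp_rw [e2]
  rw [setIntegral_indicator measurableSet_Iic, Ioi_inter_Iic,
    ← intervalIntegral.integral_of_le hR.le]
  have hsub := intervalIntegral.integral_comp_mul_deriv (a := 0) (b := Real.pi)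
    (f := fun u => Rc / 2 * Real.cos u + Rc / 2) (f' := fun u => Rc / 2 * -Real.sin u)
    (g := fun r => r * Real.exp (-(t * r ^ 4)))
    (fun u _ => ((Real.hasDerivAt_cos u).const_mul _).add_const _) (by fun_prop) (by fun_prop)
  simp only [Real.cos_zero, Real.cos_pi, mul_one, mul_neg, neg_add_cancel, add_halves,
    Function.comp_def] at hsub
  -- The radius decreases from `Rc` to `0` as `u` runs from `0` to `π`.
  rw [intervalIntegral.integral_symm Rc 0] at *
  rw [← hsub, gainCDF, sub_sub_cancel, smul_eq_mul, ← intervalIntegral.integral_neg,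
    ← mul_assoc, ← intervalIntegral.integral_const_mul]
  refine intervalIntegral.integral_congr fun u _ => ?_
  rw [mul_comm t]
  field_simp
  ring

/-! ### Integrals against the Rayleigh law. -/

section Rayleigh

lemma measurable_rayleigh_density : Measurable fun r : ℝ =>
    ENNReal.ofReal (if 0 ≤ r then 2 * r * Real.exp (-r ^ 2) else 0) :=
  (Measurable.ite measurableSet_Ici (by fun_prop) measurable_const).ennreal_ofReal

lemma integral_rayleighLaw (f : ℝ → ℝ) :
    ∫ r, f r ∂rayleighLaw = ∫ r in Ioi (0 : ℝ), 2 * r * Real.exp (-r ^ 2) * f r := by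
  unfold rayleighLaw
  rw [integral_withDensity_eq_integral_toReal_smul measurable_rayleigh_density
    (Eventually.of_forall fun _ => ENNReal.ofReal_lt_top), ← integral_Ici_eq_integral_Ioi,
    ← integral_indicator measurableSet_Ici]
  refine integral_congr_ae (Eventually.of_forall fun r => ?_)
  by_cases hr : 0 ≤ r
  · have : 0 ≤ 2 * r * Real.exp (-r ^ 2) := by positivity
    simp only [indicator, mem_Ici, hr, if_true, smul_eq_mul, ENNReal.toReal_ofReal this]
  · simp [indicator, hr]

lemma rayleighLaw_absolutelyContinuous : rayleighLaw ≪ volume :=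
  withDensity_absolutelyContinuous _ _

lemma rayleighLaw_sq_eq (w : ℝ) : rayleighLaw {r | r ^ 2 = w} = 0 := by
  refine rayleighLaw_absolutelyContinuous (Set.Finite.measure_zero ?_ _)
  refine (Set.toFinite {Real.sqrt w, -Real.sqrt w}).subset fun r hr => ?_
  have hr' : r ^ 2 = w := hr
  have : Real.sqrt w = |r| := by rw [← hr', Real.sqrt_sq_eq_abs]
  rw [this]
  rcases abs_choice r with h | h <;> rw [h] <;> simp

lemma integral_exp_neg_mul_sq_rayleighLaw {a : ℝ} (ha : 0 ≤ a) :
    ∫ r, Real.exp (-(a * r ^ 2)) ∂rayleighLaw = 1 / (1 + a) := by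
  have h1 : 0 < 1 + a := by linarith
  have hd : ∀ r ∈ Ici (0 : ℝ), HasDerivAt (fun r => -(1 / (1 + a)) * Real.exp (-((1 + a) * r ^ 2)))
      (2 * r * Real.exp (-((1 + a) * r ^ 2))) r := fun r _ => by
    refine (((((hasDerivAt_pow 2 r).const_mul (1 + a)).neg).exp).const_mul _).congr_deriv ?_
    field_simp
    simp only [Nat.cast_ofNat, Nat.add_one_sub_one, pow_one, Pi.neg_apply]
    ring
  have hlim : Tendsto (fun r : ℝ => -(1 / (1 + a)) * Real.exp (-((1 + a) * r ^ 2))) atTop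
      (𝓝 (-(1 / (1 + a)) * 0)) :=
    (Real.tendsto_exp_atBot.comp (tendsto_neg_atTop_atBot.comp
      ((tendsto_pow_atTop two_ne_zero).const_mul_atTop h1))).const_mul _
  have := integral_Ioi_of_hasDerivAt_of_nonneg' hd (fun r hr => by
    have : 0 < r := hr
    positivity) hlim
  rw [integral_rayleighLaw]
  calc _ = ∫ r in Ioi (0 : ℝ), 2 * r * Real.exp (-((1 + a) * r ^ 2)) := by
        refine setIntegral_congr_fun measurableSet_Ioi fun r _ => ?_
        rw [mul_assoc, ← Real.exp_add]; ring_nf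
    _ = _ := by rw [this]; simp

lemma integral_sq_lt_rayleighLaw {c : ℝ} (hc : 0 ≤ c) :
    ∫ r, (if r ^ 2 < c then (1 : ℝ) else 0) ∂rayleighLaw = 1 - Real.exp (-c) := by
  rw [integral_rayleighLaw]
  have hs := Real.sqrt_nonneg c
  have e : ∀ r ∈ Ioi (0 : ℝ), 2 * r * Real.exp (-r ^ 2) * (if r ^ 2 < c then (1 : ℝ) else 0) =
      (Iio (Real.sqrt c)).indicator (fun r => 2 * r * Real.exp (-r ^ 2)) r := fun r hr => by
    have hr0 : 0 < r := hr
    simp only [indicator, mem_Iio, Real.lt_sqrt hr0.le]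
    split_ifs <;> simp
  rw [setIntegral_congr_fun measurableSet_Ioi e, setIntegral_indicator measurableSet_Iio,
    Ioi_inter_Iio, ← integral_Ioc_eq_integral_Ioo, ← intervalIntegral.integral_of_le hs,
    intervalIntegral.integral_eq_sub_of_hasDerivAt (f := fun r => -Real.exp (-r ^ 2))]
  · simp [Real.sq_sqrt hc]; ring
  · intro r _
    refine (((hasDerivAt_pow 2 r).neg.exp).neg).congr_deriv ?_
    simp; ring
  · exact Continuous.intervalIntegrable (by fun_prop) _ _

end Rayleigh

/-! ### Merging and grouping independent families. -/

section Independence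

variable {Ω : Type*} {mΩ : MeasurableSpace Ω} {μ : Measure Ω}

lemma iIndep_sumElim {ι κ : Type*} {m₁ : ι → MeasurableSpace Ω} {m₂ : κ → MeasurableSpace Ω}
    (h₁ : iIndep m₁ μ) (h₂ : iIndep m₂ μ) (h : Indep (⨆ i, m₁ i) (⨆ i, m₂ i) μ) :
    iIndep (Sum.elim m₁ m₂) μ := by
  classical
  rw [iIndep_iff] at h₁ h₂ ⊢
  intro s f hf
  have e : ⋂ i ∈ s, f i = (⋂ i ∈ s.toLeft, f (Sum.inl i)) ∩ ⋂ i ∈ s.toRight, f (Sum.inr i) := by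
    ext ω
    simp [Sum.forall]
  have hl : ∀ i ∈ s.toLeft, MeasurableSet[m₁ i] (f (Sum.inl i)) := fun i hi =>
    hf (Sum.inl i) (Finset.mem_toLeft.1 hi)
  have hr : ∀ i ∈ s.toRight, MeasurableSet[m₂ i] (f (Sum.inr i)) := fun i hi =>
    hf (Sum.inr i) (Finset.mem_toRight.1 hi)
  rw [e, (Indep_iff _ _ _).1 h _ _ (Finset.measurableSet_biInter _ fun i hi =>
      (le_iSup m₁ i) _ (hl i hi)) (Finset.measurableSet_biInter _ fun i hi =>
      (le_iSup m₂ i) _ (hr i hi)), h₁ _ hl, h₂ _ hr]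
  rw [← Finset.prod_disjSum s.toLeft s.toRight fun i => μ (f i), Finset.toLeft_disjSum_toRight]

/-- By induction on the finite set of blocks: each new block is independent of the union of the
earlier ones, since the index sets are disjoint. -/
lemma iIndep_biSup_of_disjoint {ι J : Type*} {m : ι → MeasurableSpace Ω} [IsProbabilityMeasure μ]
    (hle : ∀ i, m i ≤ mΩ) (h : iIndep m μ) {s : J → Set ι} (hs : Pairwise fun a b => Disjoint (s a) (s b)) :
    iIndep (fun j => ⨆ i ∈ s j, m i) μ := by
  classical
  rw [iIndep_iff]
  intro t
  induction t using Finset.induction_on with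
  | empty => intro f _; simp
  | insert a t ha ih =>
    intro f hf
    have hd : Disjoint (s a) (⋃ j ∈ t, s j) := by
      rw [disjoint_iUnion₂_right]
      exact fun j hj => hs fun e => ha (e ▸ hj)
    have hind := indep_iSup_of_disjoint hle h hd
    rw [Finset.set_biInter_insert, Finset.prod_insert ha, ← ih fun i hi =>
      hf i (Finset.mem_insert_of_mem hi)]
    refine (Indep_iff _ _ _).1 hind _ _ (hf a (Finset.mem_insert_self a t))
      (Finset.measurableSet_biInter _ fun j hj => ?_)
    have : ⨆ i ∈ s j, m i ≤ ⨆ i ∈ ⋃ j ∈ t, s j, m i :=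
      biSup_mono fun i hi => mem_biUnion hj hi
    exact this _ (hf j (Finset.mem_insert_of_mem hj))

lemma indepFun_of_disjoint {ι α β : Type*} {m : ι → MeasurableSpace Ω} (hle : ∀ i, m i ≤ mΩ)
    (h : iIndep m μ) {s t : Set ι} (hs : Disjoint s t) [MeasurableSpace α] [MeasurableSpace β]
    {X : Ω → α} {Y : Ω → β} (hX : Measurable[⨆ i ∈ s, m i] X) (hY : Measurable[⨆ i ∈ t, m i] Y) :
    IndepFun X Y μ := by
  rw [IndepFun_iff_Indep]
  exact indep_of_indep_of_le_left (indep_of_indep_of_le_right (indep_iSup_of_disjoint hle h hs)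
    hY.comap_le) hX.comap_le

/-- Fubini's theorem for a function of two independent random variables. -/
lemma integral_comp_of_indepFun [IsProbabilityMeasure μ] {α β : Type*} [MeasurableSpace α] [MeasurableSpace β]
    {X : Ω → α} {Y : Ω → β} (h : IndepFun X Y μ) (hX : Measurable X) (hY : Measurable Y)
    {F : α → β → ℝ} (hF : Measurable (Function.uncurry F)) {C : ℝ} (hC : ∀ x y, |F x y| ≤ C) :
    ∫ ω, F (X ω) (Y ω) ∂μ = ∫ ω', ∫ ω, F (X ω) (Y ω') ∂μ ∂μ := by
  have : IsProbabilityMeasure (μ.map X) := Measure.isProbabilityMeasure_map hX.aemeasurable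
  have : IsProbabilityMeasure (μ.map Y) := Measure.isProbabilityMeasure_map hY.aemeasurable
  have hmap := (indepFun_iff_map_prod_eq_prod_map_map hX.aemeasurable hY.aemeasurable).1 h
  have hint : Integrable (Function.uncurry F) ((μ.map X).prod (μ.map Y)) :=
    Integrable.of_bound hF.aestronglyMeasurable C (Eventually.of_forall fun p => hC p.1 p.2)
  calc ∫ ω, F (X ω) (Y ω) ∂μ = ∫ p, Function.uncurry F p ∂(μ.map fun ω => (X ω, Y ω)) := by
        rw [integral_map (hX.prodMk hY).aemeasurable hF.aestronglyMeasurable]; rfl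
    _ = ∫ y, ∫ x, F x y ∂(μ.map X) ∂(μ.map Y) := by
        rw [hmap, integral_prod_symm _ hint]; rfl
    _ = ∫ ω', ∫ x, F x (Y ω') ∂(μ.map X) ∂μ := by
        rw [integral_map hY.aemeasurable]
        exact hF.stronglyMeasurable.integral_prod_left.aestronglyMeasurable
    _ = _ := by
        refine integral_congr_ae (Eventually.of_forall fun ω' => ?_)
        simp only
        rw [integral_map hX.aemeasurable]
        exact (hF.of_uncurry_right).aestronglyMeasurable

end Independence

/-! ### The sources of randomness of the network and their independence. -/

/-- The independent sources of randomness of a network. -/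
inductive Source (K : ℕ)
  | bs
  | user (i : ℕ) (k : Fin K)
  | chan (i j : ℕ) (k : Fin K)
  | comp (i : ℕ)

/-- The sources of randomness, listed as a sum type. -/
def Source.toSum {K : ℕ} : Source K → Unit ⊕ ((ℕ × Fin K) ⊕ ((ℕ × ℕ × Fin K) ⊕ ℕ))
  | .bs => .inl ()
  | .user i k => .inr (.inl (i, k))
  | .chan i j k => .inr (.inr (.inl (i, j, k)))
  | .comp i => .inr (.inr (.inr i))

lemma Source.toSum_injective {K : ℕ} : Function.Injective (Source.toSum (K := K)) := by
  intro a b hab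
  cases a <;> cases b <;> simp_all [Source.toSum]

lemma pathLoss_four (r : ℝ) : Network.pathLoss 4 r = r ^ 4 := by
  unfold Network.pathLoss
  rw [show (4 : ℝ) = ((4 : ℕ) : ℝ) by norm_num, Real.rpow_natCast]

/-- `selected` takes a maximiser by choice, which carries no measurability. The least maximising
index is measurable. -/
lemma exists_measurable_argmax (K : ℕ) [NeZero K] :
    ∃ am : (Fin K → ℝ) → Fin K, Measurable am ∧
      ∀ (v : Fin K → ℝ) (l : Fin K), v l ≤ v (am v) := by
  classical
  have hp : ∀ v : Fin K → ℝ, ∃ n, ∃ h : n < K, ∀ l, v l ≤ v ⟨n, h⟩ := fun v => by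
    obtain ⟨k, hk⟩ := Finite.exists_max v
    exact ⟨k, k.2, hk⟩
  have hm : Measurable fun v => Nat.find (hp v) := by
    refine measurable_find hp fun n => ?_
    by_cases h : n < K
    · simp only [h, exists_true_left]
      simp only [ofPred_forall]
      exact MeasurableSet.iInter fun l =>
        measurableSet_le (measurable_pi_apply l) (measurable_pi_apply _)
    · simp [h]
  refine ⟨fun v => ⟨Nat.find (hp v), (Nat.find_spec (hp v)).1⟩, ?_,
    fun v => (Nat.find_spec (hp v)).2⟩
  refine measurable_to_countable' fun k => ?_
  convert hm (measurableSet_singleton (k : ℕ)) using 1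
  ext v
  simp [Fin.ext_iff]

/-- A measurable choice of an index at which a vector is maximal. -/
def argmax {K : ℕ} [NeZero K] : (Fin K → ℝ) → Fin K := (exists_measurable_argmax K).choose

lemma measurable_argmax {K : ℕ} [NeZero K] : Measurable (argmax (K := K)) :=
  (exists_measurable_argmax K).choose_spec.1

lemma le_argmax {K : ℕ} [NeZero K] (v : Fin K → ℝ) (l : Fin K) : v l ≤ v (argmax v) :=
  (exists_measurable_argmax K).choose_spec.2 v l

namespace Network

variable {Ω : Type*} {K : ℕ}

/-- The σ-algebra generated by a source of randomness. -/
@[reducible] def sourceAlg (S : Network Ω K) : Source K → MeasurableSpace Ω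
  | .bs => MeasurableSpace.comap (fun ω i => S.bs i ω) inferInstance
  | .user i k => MeasurableSpace.comap (S.user i k) inferInstance
  | .chan i j k => MeasurableSpace.comap (S.chan i j k) inferInstance
  | .comp i => MeasurableSpace.comap (S.chanCoMP i) inferInstance

/-- The σ-algebra generated by a set of sources of randomness. -/
@[reducible] def alg (S : Network Ω K) (A : Set (Source K)) : MeasurableSpace Ω := ⨆ i ∈ A, S.sourceAlg i

lemma sourceAlg_le_alg (S : Network Ω K) {A : Set (Source K)} {i : Source K} (hi : i ∈ A) :
    S.sourceAlg i ≤ S.alg A := le_iSup₂_of_le i hi le_rfl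

lemma measurable_bs_alg (S : Network Ω K) {A : Set (Source K)} (h : .bs ∈ A) :
    Measurable[S.alg A] fun ω i => S.bs i ω :=
  measurable_iff_comap_le.2 (S.sourceAlg_le_alg h)

lemma measurable_user_alg (S : Network Ω K) {A : Set (Source K)} {i : ℕ} {k : Fin K}
    (h : .user i k ∈ A) : Measurable[S.alg A] (S.user i k) :=
  measurable_iff_comap_le.2 (S.sourceAlg_le_alg h)

lemma measurable_chan_alg (S : Network Ω K) {A : Set (Source K)} {i j : ℕ} {k : Fin K}
    (h : .chan i j k ∈ A) : Measurable[S.alg A] (S.chan i j k) :=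
  measurable_iff_comap_le.2 (S.sourceAlg_le_alg h)

lemma measurable_chanCoMP_alg (S : Network Ω K) {A : Set (Source K)} {i : ℕ}
    (h : .comp i ∈ A) : Measurable[S.alg A] (S.chanCoMP i) :=
  measurable_iff_comap_le.2 (S.sourceAlg_le_alg h)

/-- A measurable version of `selected`. -/
def best [NeZero K] (S : Network Ω K) (i : ℕ) (ω : Ω) : Fin K := argmax (S.gain 4 i ω)

lemma gain_le_best [NeZero K] (S : Network Ω K) (i : ℕ) (ω : Ω) (k : Fin K) :
    S.gain 4 i ω k ≤ S.gain 4 i ω (S.best i ω) := le_argmax _ _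

section Measurability

variable [MeasurableSpace Ω]

lemma measurable_gain (S : Network Ω K) {i : ℕ} {k : Fin K} (hu : Measurable (S.user i k))
    (hc : Measurable (S.chan i i k)) : Measurable fun ω => S.gain 4 i ω k := by
  unfold gain
  simp only [pathLoss_four]
  fun_prop

lemma measurable_best [NeZero K] (S : Network Ω K) {i : ℕ} (hu : ∀ k, Measurable (S.user i k))
    (hc : ∀ k, Measurable (S.chan i i k)) : Measurable (S.best i) :=
  measurable_argmax.comp (measurable_pi_lambda _ fun k => S.measurable_gain (hu k) (hc k))

lemma measurable_apply_fin {β : Type*} [MeasurableSpace β] {f : Fin K → Ω → β} {s : Ω → Fin K}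
    (hf : ∀ k, Measurable (f k)) (hs : Measurable s) : Measurable fun ω => f (s ω) ω :=
  (measurable_from_prod_countable_right (f := fun p : Fin K × Ω => f p.1 p.2) hf).comp
    (hs.prodMk measurable_id)

end Measurability

namespace IsModel

variable [mΩ : MeasurableSpace Ω] {μ : Measure Ω} {S : Network Ω K} {lam Rc : ℝ}

lemma sourceAlg_le (h : S.IsModel μ lam Rc) (i : Source K) : S.sourceAlg i ≤ mΩ := by
  cases i with
  | bs => exact (measurable_pi_lambda _ fun i => h.bs_poisson.measurable_point i).comap_le
  | user i k => exact (h.user_meas i k).comap_le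
  | chan i j k => exact (h.chan_meas i j k).comap_le
  | comp i => exact (h.chanCoMP_meas i).comap_le

lemma alg_le (h : S.IsModel μ lam Rc) (A : Set (Source K)) : S.alg A ≤ mΩ :=
  iSup₂_le fun i _ => h.sourceAlg_le i

/-- The model states independence within each family and, in nested form, of each family from the
later ones. Gluing from the innermost pair outwards gives joint independence of all single sources.
-/
theorem iIndep_sourceAlg [IsProbabilityMeasure μ] (h : S.IsModel μ lam Rc) :
    iIndep S.sourceAlg μ := by
  let m0 : Unit → MeasurableSpace Ω := fun _ => S.sourceAlg .bs
  let m1 : ℕ × Fin K → MeasurableSpace Ω := fun p => S.sourceAlg (.user p.1 p.2)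
  let m2 : ℕ × ℕ × Fin K → MeasurableSpace Ω := fun p => S.sourceAlg (.chan p.1 p.2.1 p.2.2)
  let m3 : ℕ → MeasurableSpace Ω := fun i => S.sourceAlg (.comp i)
  have s1 : ⨆ p, m1 p ≤ MeasurableSpace.comap (fun ω i k => S.user i k ω) inferInstance :=
    iSup_le fun p => measurable_iff_comap_le.1
      ((measurable_pi_apply p.2).comp ((measurable_pi_apply p.1).comp
        (comap_measurable fun ω i k => S.user i k ω)))
  have s2 : ⨆ p, m2 p ≤ MeasurableSpace.comap (fun ω i j k => S.chan i j k ω) inferInstance :=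
    iSup_le fun p => measurable_iff_comap_le.1
      ((measurable_pi_apply p.2.2).comp ((measurable_pi_apply p.2.1).comp
        ((measurable_pi_apply p.1).comp (comap_measurable fun ω i j k => S.chan i j k ω))))
  have s3 : ⨆ p, m3 p ≤ MeasurableSpace.comap (fun ω i => S.chanCoMP i ω) inferInstance :=
    iSup_le fun p => measurable_iff_comap_le.1
      ((measurable_pi_apply p).comp (comap_measurable fun ω i => S.chanCoMP i ω))
  have i23 : Indep (⨆ p, m2 p) (⨆ p, m3 p) μ :=
    indep_of_indep_of_le_left (indep_of_indep_of_le_right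
      ((IndepFun_iff_Indep _ _ _).1 h.chan_indep_chanCoMP) s3) s2
  have s23 : ⨆ p, Sum.elim m2 m3 p ≤ MeasurableSpace.comap
      (fun ω => ((fun i j k => S.chan i j k ω), (fun i => S.chanCoMP i ω))) inferInstance := by
    have hm := comap_measurable (m := inferInstance)
      (fun ω => ((fun i j k => S.chan i j k ω), (fun i => S.chanCoMP i ω)))
    rw [iSup_sum]
    exact sup_le (s2.trans (measurable_fst.comp hm).comap_le)
      (s3.trans (measurable_snd.comp hm).comap_le)
  have i123 : Indep (⨆ p, m1 p) (⨆ p, Sum.elim m2 m3 p) μ :=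
    indep_of_indep_of_le_left (indep_of_indep_of_le_right
      ((IndepFun_iff_Indep _ _ _).1 h.user_indep_chan) s23) s1
  have s123 : ⨆ p, Sum.elim m1 (Sum.elim m2 m3) p ≤ MeasurableSpace.comap
      (fun ω => ((fun i k => S.user i k ω), (fun i j k => S.chan i j k ω),
        (fun i => S.chanCoMP i ω))) inferInstance := by
    have hm := comap_measurable (m := inferInstance) (fun ω => ((fun i k => S.user i k ω),
      (fun i j k => S.chan i j k ω), (fun i => S.chanCoMP i ω)))
    rw [iSup_sum]
    exact sup_le (s1.trans (measurable_fst.comp hm).comap_le)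
      (s23.trans (measurable_snd.comp hm).comap_le)
  have i0123 : Indep (⨆ p, m0 p) (⨆ p, Sum.elim m1 (Sum.elim m2 m3) p) μ :=
    indep_of_indep_of_le_left (indep_of_indep_of_le_right
      ((IndepFun_iff_Indep _ _ _).1 h.bs_indep_rest) s123) (iSup_le fun _ => le_rfl)
  have h1 : iIndep m1 μ := h.user_indep.iIndep
  have h2 : iIndep m2 μ := h.chan_indep.iIndep
  have h3 : iIndep m3 μ := h.chanCoMP_indep.iIndep
  have key := iIndep_sumElim (m₁ := m0) iIndep.of_subsingleton
    (iIndep_sumElim h1 (iIndep_sumElim h2 h3 i23) i123) i0123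
  have e : S.sourceAlg = (Sum.elim m0 (Sum.elim m1 (Sum.elim m2 m3))) ∘ Source.toSum := by
    ext1 a; cases a <;> rfl
  rw [e]
  exact key.precomp Source.toSum_injective

lemma indepFun_of_disjoint [IsProbabilityMeasure μ] (h : S.IsModel μ lam Rc)
    {A B : Set (Source K)} (hAB : Disjoint A B) {α β : Type*} [MeasurableSpace α]
    [MeasurableSpace β] {X : Ω → α} {Y : Ω → β} (hX : Measurable[S.alg A] X)
    (hY : Measurable[S.alg B] Y) : IndepFun X Y μ :=
  _root_.indepFun_of_disjoint h.sourceAlg_le h.iIndep_sourceAlg hAB hX hY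

end IsModel

end Network

/-! ### Laws of the fading powers and of the gains. -/

namespace Network

variable {Ω : Type*} {K : ℕ}

/-- The fading powers of the interferers at the nearest base station: the CoMP user (index `0`)
and the NOMA users of the other clusters. -/
def fade [NeZero K] (S : Network Ω K) : ℕ → Ω → ℝ
  | 0, ω => ‖S.chanCoMP 0 ω‖ ^ 2
  | j + 1, ω => ‖S.chan 0 (j + 1) (S.best (j + 1) ω) ω‖ ^ 2

lemma fade_nonneg [NeZero K] (S : Network Ω K) (j : ℕ) (ω : Ω) : 0 ≤ S.fade j ω := by
  cases j <;> exact sq_nonneg _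

/-- The sources of randomness that determine `fade j`. -/
def fadeSource : ℕ → Set (Source K)
  | 0 => {.comp 0}
  | j + 1 => {s | ∃ k, s = .user (j + 1) k ∨ s = .chan (j + 1) (j + 1) k ∨ s = .chan 0 (j + 1) k}

/-- The sources of randomness that determine the channel gain of user `k` of cluster `i`. -/
def gainSource (i : ℕ) (k : Fin K) : Set (Source K) := {.user i k, .chan i i k}

lemma disjoint_fadeSource :
    Pairwise fun i j => Disjoint (fadeSource (K := K) i) (fadeSource j) := by
  intro i j hij
  rw [Set.disjoint_left]
  rintro s hi hj
  apply hij
  cases i with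
  | zero =>
    cases j with
    | zero => rfl
    | succ j =>
      obtain ⟨k, hk⟩ := hj
      have : s = .comp 0 := hi
      subst this
      simp at hk
  | succ i =>
    obtain ⟨k, hk⟩ := hi
    cases j with
    | zero =>
      have : s = .comp 0 := hj
      subst this
      simp at hk
    | succ j =>
      obtain ⟨l, hl⟩ := hj
      rcases hk with rfl | rfl | rfl <;> simp at hl <;> omega

lemma disjoint_gainSource (i : ℕ) :
    Pairwise fun k l => Disjoint (gainSource (K := K) i k) (gainSource i l) := by
  intro k l hkl
  simp [gainSource, hkl.symm]

lemma measurable_gain_alg (S : Network Ω K) (i : ℕ) (k : Fin K) {A : Set (Source K)}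
    (hA : gainSource i k ⊆ A) : Measurable[S.alg A] fun ω => S.gain 4 i ω k :=
  let _ : MeasurableSpace Ω := S.alg A
  S.measurable_gain (S.measurable_user_alg (hA (by simp [gainSource])))
    (S.measurable_chan_alg (hA (by simp [gainSource])))

lemma measurable_best_alg [NeZero K] (S : Network Ω K) (i : ℕ) {A : Set (Source K)}
    (hA : ∀ k, gainSource i k ⊆ A) : Measurable[S.alg A] (S.best i) :=
  let _ : MeasurableSpace Ω := S.alg A
  S.measurable_best (fun k => S.measurable_user_alg (hA k (by simp [gainSource])))
    (fun k => S.measurable_chan_alg (hA k (by simp [gainSource])))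

lemma measurable_fade [NeZero K] (S : Network Ω K) (j : ℕ) {A : Set (Source K)}
    (hA : fadeSource j ⊆ A) : Measurable[S.alg A] (S.fade j) := by
  let _ : MeasurableSpace Ω := S.alg A
  cases j with
  | zero =>
    exact (S.measurable_chanCoMP_alg (hA rfl)).norm.pow_const 2
  | succ j =>
    have hb : Measurable (S.best (j + 1)) := S.measurable_best_alg _ fun k => by
      refine Subset.trans ?_ hA
      rintro s (rfl | rfl)
      · exact ⟨k, .inl rfl⟩
      · exact ⟨k, .inr (.inl rfl)⟩
    exact (measurable_apply_fin
      (fun k => S.measurable_chan_alg (hA ⟨k, .inr (.inr rfl)⟩)) hb).norm.pow_const 2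

namespace IsModel

variable [mΩ : MeasurableSpace Ω] {μ : Measure Ω} [IsProbabilityMeasure μ]
  {S : Network Ω K} {lam Rc : ℝ}

lemma iIndepFun_of_disjoint (h : S.IsModel μ lam Rc) {J β : Type*} [MeasurableSpace β]
    {A : J → Set (Source K)} (hA : Pairwise fun i j => Disjoint (A i) (A j)) {Z : J → Ω → β}
    (hZ : ∀ j, Measurable[S.alg (A j)] (Z j)) : iIndepFun Z μ :=
  iIndep_of_iIndep_of_le (iIndep_biSup_of_disjoint h.sourceAlg_le h.iIndep_sourceAlg hA)
    fun j => (hZ j).comap_le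

lemma measurable_of_alg (h : S.IsModel μ lam Rc) {β : Type*} [MeasurableSpace β]
    {A : Set (Source K)} {Z : Ω → β} (hZ : Measurable[S.alg A] Z) : Measurable Z :=
  hZ.mono (h.alg_le A) le_rfl

lemma ae_norm_user_le (h : S.IsModel μ lam Rc) (i : ℕ) (k : Fin K) :
    ∀ᵐ ω ∂μ, ‖S.user i k ω‖ ≤ Rc := by
  have h1 : ∀ᵐ y ∂(μ.map (S.user i k)), y ∈ Metric.closedBall (0 : Plane) Rc := by
    rw [h.user_law i k]
    exact ae_cond_mem Metric.isClosed_closedBall.measurableSet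
  filter_upwards [ae_of_ae_map (h.user_meas i k).aemeasurable h1] with ω hω
  simpa using hω

lemma ae_user_ne_zero (h : S.IsModel μ lam Rc) (i : ℕ) (k : Fin K) :
    ∀ᵐ ω ∂μ, S.user i k ω ≠ 0 := by
  have h1 : ∀ᵐ y ∂(μ.map (S.user i k)), y ≠ 0 :=
    (h.user_law i k).absolutelyContinuous.ae_le (compl_mem_ae_iff.2 (measure_singleton 0))
  exact ae_of_ae_map (h.user_meas i k).aemeasurable h1

/-- A tie forces `‖h_k‖²` to equal `‖y_k‖ ^ 4` times the other gain. That quantity is independent of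
`h_k`, and the law of `‖h_k‖²` has no atoms. -/
lemma ae_gain_ne (h : S.IsModel μ lam Rc) (i : ℕ) {k l : Fin K} (hkl : k ≠ l) :
    ∀ᵐ ω ∂μ, S.gain 4 i ω k ≠ S.gain 4 i ω l := by
  let A : Set (Source K) := {.chan i i k}
  let B : Set (Source K) := {.user i k, .user i l, .chan i i l}
  have hX : Measurable[S.alg A] fun ω => ‖S.chan i i k ω‖ := by
    let m : MeasurableSpace Ω := S.alg A
    have h1 : Measurable (S.chan i i k) := S.measurable_chan_alg (by simp [A])
    exact h1.norm
  have hY : Measurable[S.alg B] fun ω => ‖S.user i k ω‖ ^ 4 * S.gain 4 i ω l := by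
    let m : MeasurableSpace Ω := S.alg B
    have h1 : Measurable (S.user i k) := S.measurable_user_alg (by simp [B])
    have h2 : Measurable fun ω => S.gain 4 i ω l :=
      S.measurable_gain_alg i l (by simp [gainSource, B])
    exact (h1.norm.pow_const 4).mul h2
  have hAB : Disjoint A B := by simp [A, B, hkl]
  have hi := h.indepFun_of_disjoint hAB hX hY
  have hFm : Measurable (Function.uncurry fun x y : ℝ => if x ^ 2 = y then (1 : ℝ) else 0) := by
    simp only [Function.uncurry_def]
    exact Measurable.ite (measurableSet_eq_fun (by fun_prop) (by fun_prop)) measurable_const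
      measurable_const
  have key := integral_comp_of_indepFun hi (h.measurable_of_alg hX) (h.measurable_of_alg hY)
    hFm (C := 1) (fun x y => by split_ifs <;> simp)
  have hz : ∀ y : ℝ, ∫ ω, (if ‖S.chan i i k ω‖ ^ 2 = y then (1 : ℝ) else 0) ∂μ = 0 := fun y => by
    have : ∀ᵐ r ∂(μ.map fun ω => ‖S.chan i i k ω‖), r ^ 2 ≠ y := by
      rw [h.chan_law, ae_iff]
      simpa using rayleighLaw_sq_eq y
    refine integral_eq_zero_of_ae ?_
    filter_upwards [ae_of_ae_map (h.measurable_of_alg hX).aemeasurable this] with ω hω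
    simp [hω]
  simp only [hz, integral_zero] at key
  have hint : Integrable (fun ω => if ‖S.chan i i k ω‖ ^ 2 = ‖S.user i k ω‖ ^ 4 * S.gain 4 i ω l
      then (1 : ℝ) else 0) μ :=
    Integrable.of_bound (hFm.comp ((h.measurable_of_alg hX).prodMk
      (h.measurable_of_alg hY))).aestronglyMeasurable 1
      (Eventually.of_forall fun ω => by split_ifs <;> simp)
  filter_upwards [(integral_eq_zero_iff_of_nonneg (fun ω => by positivity) hint).1 key,
    h.ae_user_ne_zero i k] with ω hω hu he
  have hu' : ‖S.user i k ω‖ ^ 4 ≠ 0 := by simpa using hu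
  have : ‖S.chan i i k ω‖ ^ 2 = ‖S.user i k ω‖ ^ 4 * S.gain 4 i ω l := by
    rw [← he, gain, pathLoss_four]
    field_simp
  simp [this] at hω

/-- Without ties the maximiser is unique, so the choice in `selected` agrees with the measurable
one. -/
lemma ae_selected_eq [NeZero K] (h : S.IsModel μ lam Rc) :
    ∀ᵐ ω ∂μ, ∀ i, S.selected 4 i ω = S.best i ω := by
  have : ∀ᵐ ω ∂μ, ∀ i, ∀ k l : Fin K, k ≠ l → S.gain 4 i ω k ≠ S.gain 4 i ω l :=
    ae_all_iff.2 fun i => ae_all_iff.2 fun k => ae_all_iff.2 fun l => by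
      by_cases hkl : k = l
      · exact Eventually.of_forall fun ω hne => (hne hkl).elim
      · filter_upwards [h.ae_gain_ne i hkl] with ω hω _ using hω
  filter_upwards [this] with ω hω i
  by_contra hne
  exact hω i _ _ hne (le_antisymm (S.gain_le_best i ω _)
    (Classical.choose_spec (Finite.exists_max (S.gain 4 i ω)) _))

/-- The selected index depends on the offsets and on the channels inside cluster `j + 1`, while the
power uses the channels to station `0`. These are disjoint sources, so conditioning on the selection
leaves a unit exponential. -/
lemma integral_exp_fade [NeZero K] (h : S.IsModel μ lam Rc) (j : ℕ) {a : ℝ} (ha : 0 ≤ a) :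
    ∫ ω, Real.exp (-(a * S.fade j ω)) ∂μ = 1 / (1 + a) := by
  have hr : AEStronglyMeasurable (fun r : ℝ => Real.exp (-(a * r ^ 2))) rayleighLaw :=
    Continuous.aestronglyMeasurable (by fun_prop)
  have hlap : ∀ f : Ω → ℂ, Measurable f → μ.map (fun ω => ‖f ω‖) = rayleighLaw →
      ∫ ω, Real.exp (-(a * ‖f ω‖ ^ 2)) ∂μ = 1 / (1 + a) := fun f hf hl => by
    rw [← integral_exp_neg_mul_sq_rayleighLaw ha, ← hl, integral_map hf.norm.aemeasurable
      (hl ▸ hr)]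
  cases j with
  | zero => exact hlap _ (h.chanCoMP_meas 0) (h.chanCoMP_law 0)
  | succ j =>
    let A : Set (Source K) := range fun k => .chan 0 (j + 1) k
    let B : Set (Source K) := ⋃ k, gainSource (j + 1) k
    have hX : Measurable[S.alg A] fun ω k => ‖S.chan 0 (j + 1) k ω‖ :=
      let _ : MeasurableSpace Ω := S.alg A
      measurable_pi_lambda _ fun k => (S.measurable_chan_alg (A := A) (mem_range_self k)).norm
    have hY : Measurable[S.alg B] (S.best (j + 1)) :=
      S.measurable_best_alg _ fun k => subset_iUnion (gainSource (j + 1)) k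
    have hAB : Disjoint A B := by
      rw [Set.disjoint_left]
      rintro _ ⟨k, rfl⟩ hB
      simp [B, gainSource] at hB
    have hFm : Measurable (Function.uncurry fun (x : Fin K → ℝ) (k : Fin K) =>
        Real.exp (-(a * x k ^ 2))) := by
      refine measurable_from_prod_countable_left fun k => ?_
      simp only [Function.uncurry_def]
      fun_prop
    have key := integral_comp_of_indepFun (h.indepFun_of_disjoint hAB hX hY)
      (h.measurable_of_alg hX) (h.measurable_of_alg hY) hFm (C := 1) fun x k => by
        rw [abs_of_nonneg (Real.exp_nonneg _), Real.exp_le_one_iff]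
        have := mul_nonneg ha (sq_nonneg (x k))
        linarith
    have e : ∀ k, ∫ ω, Real.exp (-(a * ‖S.chan 0 (j + 1) k ω‖ ^ 2)) ∂μ = 1 / (1 + a) :=
      fun k => hlap _ (h.chan_meas 0 (j + 1) k) (h.chan_law 0 (j + 1) k)
    simp only [e, integral_const, probReal_univ, one_smul] at key
    exact key

/-- The joint Laplace transform of finitely many fading powers, given the base stations. -/
lemma integral_mul_prod_exp_fade [NeZero K] (h : S.IsModel μ lam Rc) (n : ℕ)
    {a : ℕ → (ℕ → Plane) → ℝ} (ham : ∀ j, Measurable (a j)) (ha : ∀ j x, 0 ≤ a j x) :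
    ∫ ω, ∏ j ∈ Finset.range n, Real.exp (-(a j (fun i => S.bs i ω) * S.fade j ω)) ∂μ =
      ∫ ω, ∏ j ∈ Finset.range n, (1 / (1 + a j fun i => S.bs i ω)) ∂μ := by
  -- The Fubini lemma needs a bound at all arguments, not only at attained values. Absolute values
  -- keep each exponential at most `1`.
  have hX : Measurable[S.alg {s | s ≠ .bs}] fun ω j => |S.fade j ω| :=
    let _ : MeasurableSpace Ω := S.alg {s | s ≠ .bs}
    measurable_pi_lambda _ fun j => (S.measurable_fade j (by
      cases j with
      | zero => rintro s (rfl : s = .comp 0); simp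
      | succ j => rintro s ⟨k, rfl | rfl | rfl⟩ <;> simp)).norm
  have hY : Measurable[S.alg {.bs}] fun ω i => S.bs i ω := S.measurable_bs_alg rfl
  have hFm : Measurable (Function.uncurry fun (x : ℕ → ℝ) (y : ℕ → Plane) =>
      ∏ j ∈ Finset.range n, Real.exp (-(a j y * |x j|))) := by
    simp only [Function.uncurry_def]
    refine Finset.measurable_fun_prod _ fun j _ => ?_
    have h1 : Measurable fun p : (ℕ → ℝ) × (ℕ → Plane) => a j p.2 := (ham j).comp measurable_snd
    have h2 : Measurable fun p : (ℕ → ℝ) × (ℕ → Plane) => |p.1 j| :=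
      ((measurable_pi_apply j).comp measurable_fst).norm
    exact (h1.mul h2).neg.exp
  have key := integral_comp_of_indepFun (h.indepFun_of_disjoint
    (Set.disjoint_singleton_right.2 (by simp)) hX hY)
    (h.measurable_of_alg hX) (h.measurable_of_alg hY) hFm (C := 1) fun x y => by
      rw [Finset.abs_prod]
      refine Finset.prod_le_one (fun _ _ => abs_nonneg _) fun j _ => ?_
      rw [abs_of_nonneg (Real.exp_nonneg _), Real.exp_le_one_iff]
      have := mul_nonneg (ha j y) (abs_nonneg (x j))
      linarith
  simp only [abs_of_nonneg (S.fade_nonneg _ _)] at key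
  rw [key]
  refine integral_congr_ae (Eventually.of_forall fun ω' => ?_)
  simp only
  have hm : ∀ j, Measurable (S.fade j) := fun j =>
    h.measurable_of_alg (S.measurable_fade j Subset.rfl)
  have hind : iIndepFun (fun (j : Fin n) => S.fade j) μ :=
    (h.iIndepFun_of_disjoint disjoint_fadeSource fun j =>
      S.measurable_fade j Subset.rfl).precomp Fin.val_injective
  simp only [Finset.prod_range]
  rw [hind.integral_fun_prod_comp (f := fun (j : Fin n) x => Real.exp (-(a j (fun i => S.bs i ω') * x)))
    (fun j => (hm j).aemeasurable) fun j => Continuous.aestronglyMeasurable (by fun_prop)]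
  exact Finset.prod_congr rfl fun j _ => h.integral_exp_fade j (ha j _)

/-- Given the offset `y`, the event is `‖h‖² < t ‖y‖ ^ 4`, of probability `1 - exp (-t ‖y‖ ^ 4)`;
this is averaged over the disk. The null event `y = 0` is discarded, since the gain there is a
division by zero. -/
lemma integral_gain_lt (h : S.IsModel μ lam Rc) (hR : 0 < Rc) (i : ℕ) (k : Fin K) {t : ℝ}
    (ht : 0 ≤ t) :
    ∫ ω, (if S.gain 4 i ω k < t then (1 : ℝ) else 0) ∂μ = gainCDF Rc t := by
  let A : Set (Source K) := {.chan i i k}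
  have hX : Measurable[S.alg A] fun ω => ‖S.chan i i k ω‖ := by
    let _ : MeasurableSpace Ω := S.alg A
    have h1 : Measurable (S.chan i i k) := S.measurable_chan_alg (by simp [A])
    exact h1.norm
  have hY : Measurable[S.alg {.user i k}] (S.user i k) := S.measurable_user_alg (by simp)
  have hFm : Measurable (Function.uncurry fun (x : ℝ) (y : Plane) =>
      if x ^ 2 < t * ‖y‖ ^ 4 then (1 : ℝ) else 0) := by
    simp only [Function.uncurry_def]
    exact Measurable.ite (measurableSet_lt (by fun_prop) (by fun_prop)) measurable_const
      measurable_const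
  have key := integral_comp_of_indepFun (h.indepFun_of_disjoint (by simp [A]) hX hY)
    (h.measurable_of_alg hX) (h.measurable_of_alg hY) hFm (C := 1) (fun x y => by
      split_ifs <;> simp)
  have e1 : ∀ y : Plane, ∫ ω, (if ‖S.chan i i k ω‖ ^ 2 < t * ‖y‖ ^ 4 then (1 : ℝ) else 0) ∂μ =
      1 - Real.exp (-(t * ‖y‖ ^ 4)) := fun y => by
    rw [← integral_sq_lt_rayleighLaw (by positivity), ← h.chan_law i i k,
      integral_map (h.measurable_of_alg hX).aemeasurable]
    exact (Measurable.ite (measurableSet_lt (by fun_prop) (by fun_prop)) measurable_const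
      measurable_const).aestronglyMeasurable
  have hb : ∀ ω, ‖Real.exp (-(t * ‖S.user i k ω‖ ^ 4))‖ ≤ 1 := fun ω => by
    rw [Real.norm_of_nonneg (Real.exp_nonneg _), Real.exp_le_one_iff]
    have : 0 ≤ t * ‖S.user i k ω‖ ^ 4 := by positivity
    linarith
  have hu := h.user_meas i k
  have e2 : ∫ ω, Real.exp (-(t * ‖S.user i k ω‖ ^ 4)) ∂μ = 1 - gainCDF Rc t := by
    rw [← integral_exp_neg_uniform_disk hR, ← h.user_law i k, integral_map hu.aemeasurable]
    exact Continuous.aestronglyMeasurable (by fun_prop)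
  calc _ = ∫ ω, (if ‖S.chan i i k ω‖ ^ 2 < t * ‖S.user i k ω‖ ^ 4 then (1 : ℝ) else 0) ∂μ := by
        refine integral_congr_ae ?_
        filter_upwards [h.ae_user_ne_zero i k] with ω hω
        have : 0 < ‖S.user i k ω‖ ^ 4 := by positivity
        rw [gain, pathLoss_four]
        simp only [div_lt_iff₀ this]
    _ = _ := by
        simp only [e1] at key
        rw [key, integral_sub (integrable_const _) (Integrable.of_bound
          (Measurable.aestronglyMeasurable (by fun_prop)) 1 (Eventually.of_forall hb)), e2]
        simp

/-- The maximal channel gain of a cluster is below an independent level `T` with probability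
`E [F(T) ^ K]`, where `F` is the distribution function of a single gain. -/
lemma measureReal_forall_gain_lt (h : S.IsModel μ lam Rc) (hR : 0 < Rc) (i : ℕ)
    {B : Set (Source K)} (hB : ∀ k, Disjoint (gainSource i k) B) {T : Ω → ℝ}
    (hT : Measurable[S.alg B] T) (hT0 : ∀ ω, 0 ≤ T ω) :
    μ.real {ω | ∀ k, S.gain 4 i ω k < T ω} = ∫ ω, gainCDF Rc (T ω) ^ K ∂μ := by
  let A : Set (Source K) := ⋃ k, gainSource i k
  have hX : Measurable[S.alg A] fun ω k => S.gain 4 i ω k :=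
    let _ : MeasurableSpace Ω := S.alg A
    measurable_pi_lambda _ fun k =>
      S.measurable_gain_alg i k (subset_iUnion (gainSource i) k)
  have hAB : Disjoint A B := disjoint_iUnion_left.2 hB
  have hg : ∀ k, Measurable fun ω => S.gain 4 i ω k := fun k =>
    h.measurable_of_alg (S.measurable_gain_alg i k Subset.rfl)
  have hFm : Measurable (Function.uncurry fun (x : Fin K → ℝ) (t : ℝ) =>
      ∏ k, if x k < t then (1 : ℝ) else 0) := by
    simp only [Function.uncurry_def]
    exact Finset.measurable_fun_prod _ fun k _ => Measurable.ite
      (measurableSet_lt (by fun_prop) (by fun_prop)) measurable_const measurable_const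
  have key := integral_comp_of_indepFun (h.indepFun_of_disjoint hAB hX hT)
    (h.measurable_of_alg hX) (h.measurable_of_alg hT) hFm (C := 1) fun x t => by
      rw [Finset.abs_prod]
      exact Finset.prod_le_one (fun _ _ => abs_nonneg _) fun j _ => by split_ifs <;> simp
  have hs : MeasurableSet {ω | ∀ k, S.gain 4 i ω k < T ω} := by
    simp only [ofPred_forall]
    exact MeasurableSet.iInter fun k => measurableSet_lt (hg k) (h.measurable_of_alg hT)
  rw [← integral_indicator_one hs]
  calc _ = ∫ ω, ∏ k, (if S.gain 4 i ω k < T ω then (1 : ℝ) else 0) ∂μ := by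
        refine integral_congr_ae (Eventually.of_forall fun ω => ?_)
        simp only [indicator, Finset.prod_ite_zero]
        simp
    _ = _ := by
        rw [key]
        refine integral_congr_ae (Eventually.of_forall fun ω' => ?_)
        have hind : iIndepFun (fun (k : Fin K) ω => S.gain 4 i ω k) μ :=
          h.iIndepFun_of_disjoint (disjoint_gainSource i) fun k =>
            S.measurable_gain_alg i k Subset.rfl
        simp only
        rw [hind.integral_fun_prod_comp (f := fun _ x => if x < T ω' then (1 : ℝ) else 0)
          (fun k => (hg k).aemeasurable) fun k => (Measurable.ite measurableSet_Iio
            measurable_const measurable_const).aestronglyMeasurable]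
        simp [h.integral_gain_lt hR i _ (hT0 ω')]

end IsModel

end Network

/-! ### Laplace transform and finiteness of the interference. -/

/-- The positive natural numbers, listed by their predecessors. -/
def succEquiv : ℕ ≃ {j : ℕ // j ≠ 0} where
  toFun j := ⟨j + 1, j.succ_ne_zero⟩
  invFun j := j.1 - 1
  left_inv j := by simp
  right_inv j := Subtype.ext (Nat.succ_pred_eq_of_ne_zero j.2)

lemma summable_ne_zero_iff {f : ℕ → ℝ} :
    (Summable fun j : {j : ℕ // j ≠ 0} => f j) ↔ Summable fun j => f (j + 1) :=
  (succEquiv.summable_iff (f := fun j : {j : ℕ // j ≠ 0} => f j)).symm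

lemma tsum_ne_zero_eq (f : ℕ → ℝ) :
    ∑' j : {j : ℕ // j ≠ 0}, f j = ∑' j, f (j + 1) :=
  (succEquiv.tsum_eq (fun j : {j : ℕ // j ≠ 0} => f j)).symm

/-- For a divergent series `tsum` is `0`, which would suggest the limit `1`; the true limit `0`
needs its own case. Summability is only deduced later, from this very transform. -/
lemma tendsto_exp_neg_sum {f : ℕ → ℝ} (hf : ∀ j, 0 ≤ f j) {s : ℝ} (hs : 0 < s) :
    Tendsto (fun n => Real.exp (-(s * ∑ j ∈ Finset.range n, f j))) atTop
      (𝓝 (open Classical in if Summable f then Real.exp (-(s * ∑' j, f j)) else 0)) := by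
  split_ifs with h
  · exact ((Real.continuous_exp.tendsto _).comp (h.hasSum.tendsto_sum_nat.const_mul s).neg)
  · exact Real.tendsto_exp_neg_atTop_nhds_zero.comp
      (((not_summable_iff_tendsto_nat_atTop_of_nonneg hf).1 h).const_mul_atTop hs)

namespace IsHPPP

variable {Ω : Type*} [MeasurableSpace Ω] {μ : Measure Ω} [IsProbabilityMeasure μ] {lam : ℝ}
  {X : ℕ → Ω → Plane}

/-- The singleton `{0}` has area zero, so its count is Poisson with mean zero. -/
lemma ae_ne_zero (h : IsHPPP μ lam X) (i : ℕ) : ∀ᵐ ω ∂μ, X i ω ≠ 0 := by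
  have hv : volume ({0} : Set Plane) < ⊤ := by simp
  have hm := h.aemeasurable_pointCount (measurableSet_singleton 0) hv
  have key := h.integral_pointCount (measurableSet_singleton 0) hv
    (fun n => if n = 0 then (1 : ℝ) else 0)
  have e : ∀ n : ℕ, (if (n : ℕ∞) = 0 then (1 : ℝ) else 0) = 0 ^ n := fun n => by
    simp [zero_pow_eq]
  simp only [e, integral_pow_poissonMeasure] at key
  simp only [measureReal_def, measure_singleton, ENNReal.toReal_zero, mul_zero, Real.toNNReal_zero,
    NNReal.coe_zero, zero_mul, neg_zero, Real.exp_zero] at key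
  have hint : Integrable (fun ω => if pointCount X {0} ω = 0 then (1 : ℝ) else 0) μ :=
    Integrable.of_bound (((measurable_of_countable (fun n : ℕ∞ =>
      if n = 0 then (1 : ℝ) else 0)).comp_aemeasurable hm).aestronglyMeasurable) 1
      (Eventually.of_forall fun ω => by split_ifs <;> simp)
  have hz : ∫ ω, (1 - if pointCount X {0} ω = 0 then (1 : ℝ) else 0) ∂μ = 0 := by
    rw [integral_sub (integrable_const _) hint, key]; simp
  filter_upwards [(integral_eq_zero_iff_of_nonneg (fun ω => by
    simp only [Pi.zero_apply, Pi.sub_apply]; split_ifs <;> simp) ((integrable_const 1).sub hint)).1 hz] with ω hω hi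
  have : pointCount X {0} ω ≠ 0 := by
    simp only [pointCount, ne_eq, encard_eq_zero]
    exact Set.Nonempty.ne_empty ⟨i, hi⟩
  simp [this] at hω

lemma ae_ne_nearest (h : IsHPPP μ lam X) (hl : 0 < lam)
    (ho : ∀ᵐ ω ∂μ, Monotone fun i => ‖X i ω‖) : ∀ᵐ ω ∂μ, ∀ j, X (j + 1) ω ≠ X 0 ω := by
  filter_upwards [h.ae_norm_lt hl ho, ho] with ω h1 h2 j he
  have h3 : ‖X 1 ω‖ ≤ ‖X (j + 1) ω‖ := h2 (Nat.le_add_left 1 j)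
  rw [he] at h3
  exact absurd h1 (not_lt.2 h3)

end IsHPPP

namespace Network

variable {Ω : Type*} {K : ℕ} [NeZero K]

/-- The interference from cluster `j + 1` at the nearest base station, with the interfering user
moved to its base station. -/
def termBS (S : Network Ω K) (j : ℕ) (ω : Ω) : ℝ :=
  S.fade (j + 1) ω / ‖S.bs (j + 1) ω - S.bs 0 ω‖ ^ 4

/-- The interference from cluster `j + 1` at the nearest base station. -/
def termUser (S : Network Ω K) (j : ℕ) (ω : Ω) : ℝ :=
  S.fade (j + 1) ω /
    ‖S.user (j + 1) (S.best (j + 1) ω) ω + S.bs (j + 1) ω - S.bs 0 ω‖ ^ 4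

lemma termBS_nonneg (S : Network Ω K) (j : ℕ) (ω : Ω) : 0 ≤ S.termBS j ω :=
  div_nonneg (S.fade_nonneg _ _) (by positivity)

lemma termUser_nonneg (S : Network Ω K) (j : ℕ) (ω : Ω) : 0 ≤ S.termUser j ω :=
  div_nonneg (S.fade_nonneg _ _) (by positivity)

lemma interTermBS_eq (S : Network Ω K) {ω : Ω} (h : ∀ i, S.selected 4 i ω = S.best i ω) (j : ℕ) :
    S.interTermBS 4 0 (j + 1) ω = S.termBS j ω := by
  simp only [interTermBS, h, pathLoss_four, termBS, fade]

lemma interTerm_eq (S : Network Ω K) {ω : Ω} (h : ∀ i, S.selected 4 i ω = S.best i ω) (j : ℕ) :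
    S.interTerm 4 0 (j + 1) ω = S.termUser j ω := by
  simp only [interTerm, h, pathLoss_four, termUser, fade]

lemma interCoMP_eq (S : Network Ω K) (φ : ℝ) (ω : Ω) :
    S.interCoMP 4 φ 0 ω = φ * S.fade 0 ω / ‖S.bs 0 ω‖ ^ 4 := by
  simp only [interCoMP, pathLoss_four, fade]

lemma interCellBS_eq (S : Network Ω K) {ω : Ω} (h : ∀ i, S.selected 4 i ω = S.best i ω) :
    S.interCellBS 4 0 ω = ∑' j, S.termBS j ω := by
  simp only [← S.interTermBS_eq h]
  exact tsum_ne_zero_eq fun j => S.interTermBS 4 0 j ω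

lemma interCell_eq (S : Network Ω K) {ω : Ω} (h : ∀ i, S.selected 4 i ω = S.best i ω) :
    S.interCell 4 0 ω = ∑' j, S.termUser j ω := by
  simp only [← S.interTerm_eq h]
  exact tsum_ne_zero_eq fun j => S.interTerm 4 0 j ω

namespace IsModel

variable [mΩ : MeasurableSpace Ω] {μ : Measure Ω} [IsProbabilityMeasure μ]
  {S : Network Ω K} {lam Rc : ℝ}

lemma measurable_fade (h : S.IsModel μ lam Rc) (j : ℕ) : Measurable (S.fade j) :=
  h.measurable_of_alg (S.measurable_fade j Subset.rfl)

lemma measurable_termBS (h : S.IsModel μ lam Rc) (j : ℕ) : Measurable (S.termBS j) := by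
  have h1 := h.measurable_fade (j + 1)
  have h2 := h.bs_poisson.measurable_point (j + 1)
  have h3 := h.bs_poisson.measurable_point 0
  exact h1.div ((h2.sub h3).norm.pow_const 4)

/-- The Laplace transform of the interference from finitely many clusters. -/
lemma integral_exp_neg_partial (h : S.IsModel μ lam Rc) (hl : 0 < lam) {φ s : ℝ} (hφ : 0 ≤ φ)
    (hs : 0 < s) (n : ℕ) :
    ∫ ω, Real.exp (-(s * (φ * S.fade 0 ω / ‖S.bs 0 ω‖ ^ 4))) *
        Real.exp (-(s * ∑ j ∈ Finset.range n, S.termBS j ω)) ∂μ =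
      ∫ ω, ‖S.bs 0 ω‖ ^ 4 / (‖S.bs 0 ω‖ ^ 4 + φ * s) * ∏ j ∈ Finset.range n,
        (‖S.bs (j + 1) ω - S.bs 0 ω‖ ^ 4 / (‖S.bs (j + 1) ω - S.bs 0 ω‖ ^ 4 + s)) ∂μ := by
  -- Index `0` carries the CoMP user, whose distance is measured from the origin instead of from
  -- station `0`.
  let a : ℕ → (ℕ → Plane) → ℝ := fun j x =>
    if j = 0 then s * φ / ‖x 0‖ ^ 4 else s / ‖x j - x 0‖ ^ 4
  have ham : ∀ j, Measurable (a j) := fun j => by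
    by_cases hj : j = 0
    · simp only [a, hj, if_true]; fun_prop
    · simp only [a, hj, if_false]; fun_prop
  have ha : ∀ j x, 0 ≤ a j x := fun j x => by
    simp only [a]; split_ifs <;> positivity
  have key := h.integral_mul_prod_exp_fade (n + 1) ham ha
  simp only [Finset.prod_range_succ', a, Nat.succ_ne_zero, if_false, if_true] at key
  calc _ = _ := integral_congr_ae (Eventually.of_forall fun ω => ?_)
    _ = _ := key
    _ = _ := integral_congr_ae ?_
  · rw [mul_comm, Finset.mul_sum, ← Finset.sum_neg_distrib, Real.exp_sum]
    congr 1
    · refine Finset.prod_congr rfl fun j _ => ?_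
      rw [termBS]; congr 2; ring
    · congr 2; ring
  -- At distance `d = 0` the form `1 / (1 + s / d ^ 4)` would be `1` but `d ^ 4 / (d ^ 4 + s)` is
  -- `0`. Such coincidences have probability zero.
  · filter_upwards [h.bs_poisson.ae_ne_zero 0,
      h.bs_poisson.ae_ne_nearest hl h.bs_ordered] with ω h0 hne
    have h0' : 0 < ‖S.bs 0 ω‖ := norm_pos_iff.2 h0
    rw [mul_comm]
    congr 1
    · field_simp
    · refine Finset.prod_congr rfl fun j _ => ?_
      have : 0 < ‖S.bs (j + 1) ω - S.bs 0 ω‖ := norm_pos_iff.2 (sub_ne_zero.2 (hne j))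
      field_simp

/-- The Laplace transform of the interference at the nearest base station. -/
lemma integral_exp_neg_total (h : S.IsModel μ lam Rc) (hl : 0 < lam) {φ s : ℝ} (hφ : 0 ≤ φ)
    (hs : 0 < s) :
    ∫ ω, Real.exp (-(s * (φ * S.fade 0 ω / ‖S.bs 0 ω‖ ^ 4))) *
        (open Classical in if Summable fun j => S.termBS j ω then
          Real.exp (-(s * ∑' j, S.termBS j ω)) else 0) ∂μ =
      ∫ ω, ‖S.bs 0 ω‖ ^ 4 / (‖S.bs 0 ω‖ ^ 4 + φ * s) *
        ptProd (fun y => ‖y - S.bs 0 ω‖ ^ 4 / (‖y - S.bs 0 ω‖ ^ 4 + s))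
          (fun j => S.bs (j + 1) ω) ∂μ := by
  have hbs := h.bs_poisson.measurable_point
  have hfd := h.measurable_fade
  have htm := h.measurable_termBS
  have hv0 : ∀ x y : Plane, 0 ≤ ‖y - x‖ ^ 4 / (‖y - x‖ ^ 4 + s) := fun x y => by positivity
  have hv1 : ∀ x y : Plane, ‖y - x‖ ^ 4 / (‖y - x‖ ^ 4 + s) ≤ 1 := fun x y =>
    (div_le_one (by positivity)).2 (by linarith)
  have hg0 : ∀ ω, 0 ≤ ‖S.bs 0 ω‖ ^ 4 / (‖S.bs 0 ω‖ ^ 4 + φ * s) := fun ω => by positivity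
  have hg1 : ∀ ω, ‖S.bs 0 ω‖ ^ 4 / (‖S.bs 0 ω‖ ^ 4 + φ * s) ≤ 1 := fun ω =>
    div_le_one_of_le₀ (by nlinarith [mul_nonneg hφ hs.le]) (by positivity)
  have hc0 : ∀ ω, 0 ≤ φ * S.fade 0 ω / ‖S.bs 0 ω‖ ^ 4 := fun ω =>
    div_nonneg (mul_nonneg hφ (S.fade_nonneg 0 ω)) (by positivity)
  have hS0 : ∀ n ω, 0 ≤ ∑ j ∈ Finset.range n, S.termBS j ω := fun n ω =>
    Finset.sum_nonneg fun j _ => S.termBS_nonneg j ω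
  refine tendsto_nhds_unique (f := fun n => ∫ ω,
    Real.exp (-(s * (φ * S.fade 0 ω / ‖S.bs 0 ω‖ ^ 4))) *
        Real.exp (-(s * ∑ j ∈ Finset.range n, S.termBS j ω)) ∂μ) (l := atTop) ?_ ?_
  · refine tendsto_integral_of_dominated_convergence (fun _ => 1) (fun n => ?_)
      (integrable_const _) (fun n => Eventually.of_forall fun ω => ?_)
      (Eventually.of_forall fun ω => ?_)
    · exact Measurable.aestronglyMeasurable (by fun_prop)
    · rw [← Real.exp_add, Real.norm_of_nonneg (Real.exp_nonneg _), Real.exp_le_one_iff]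
      have := mul_nonneg hs.le (hc0 ω)
      have := mul_nonneg hs.le (hS0 n ω)
      linarith
    · exact (tendsto_exp_neg_sum (fun j => S.termBS_nonneg j ω) hs).const_mul _
  · simp only [h.integral_exp_neg_partial hl hφ hs]
    refine tendsto_integral_of_dominated_convergence (fun _ => 1) (fun n => ?_)
      (integrable_const _) (fun n => Eventually.of_forall fun ω => ?_)
      (Eventually.of_forall fun ω => ?_)
    · exact Measurable.aestronglyMeasurable (by fun_prop)
    · rw [Real.norm_of_nonneg (mul_nonneg (hg0 ω) (Finset.prod_nonneg fun j _ => hv0 _ _))]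
      exact mul_le_one₀ (hg1 ω) (Finset.prod_nonneg fun j _ => hv0 _ _)
        (Finset.prod_le_one (fun j _ => hv0 _ _) fun j _ => hv1 _ _)
    · exact (tendsto_ptProd (x := fun j => S.bs (j + 1) ω) (hv0 (S.bs 0 ω))
        (hv1 (S.bs 0 ω))).const_mul _

/-- With the transform set to `0` on divergence, Markov's inequality for one minus it gives `P
(divergence) ≤ π² λ √s / 2` for every `s > 0`. Now let `s → 0`. -/
lemma ae_summable_termBS (h : S.IsModel μ lam Rc) (hl : 0 < lam) :
    ∀ᵐ ω ∂μ, Summable fun j => S.termBS j ω := by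
  classical
  let f : ℝ → Ω → ℝ := fun s ω => if Summable fun j => S.termBS j ω then
          Real.exp (-(s * ∑' j, S.termBS j ω)) else 0
  have htm := h.measurable_termBS
  have hf0 : ∀ {s}, 0 < s → ∀ ω, 0 ≤ f s ω := fun {s} hs ω => by
    simp only [f]; split_ifs <;> positivity
  have hf1 : ∀ {s}, 0 < s → ∀ ω, f s ω ≤ 1 := fun {s} hs ω => by
    simp only [f]
    split_ifs
    · rw [Real.exp_le_one_iff]
      have h0 : 0 ≤ ∑' j, S.termBS j ω := tsum_nonneg fun j => S.termBS_nonneg j ω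
      have := mul_nonneg hs.le h0
      linarith
    · exact zero_le_one
  have hfi : ∀ {s}, 0 < s → Integrable (f s) μ := fun {s} hs =>
    Integrable.of_bound (aestronglyMeasurable_of_tendsto_ae atTop
      (fun n => Measurable.aestronglyMeasurable (by fun_prop))
      (Eventually.of_forall fun ω => tendsto_exp_neg_sum (fun j => S.termBS_nonneg j ω) hs)) 1
      (Eventually.of_forall fun ω => by rw [Real.norm_of_nonneg (hf0 hs ω)]; exact hf1 hs ω)
  have hint : ∀ {s}, 0 < s → 1 - Real.pi ^ 2 * lam * Real.sqrt s / 2 ≤ ∫ ω, f s ω ∂μ :=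
    fun {s} hs => by
    refine (h.bs_poisson.le_integral_nearest_pathLoss hl h.bs_ordered hs).trans_eq ?_
    -- Taking `φ = 0` removes the CoMP user.
    have key := h.integral_exp_neg_total hl le_rfl hs
    simp only [zero_mul, zero_div, mul_zero, neg_zero, Real.exp_zero, one_mul, add_zero] at key
    rw [key]
    refine integral_congr_ae ?_
    filter_upwards [h.bs_poisson.ae_ne_zero 0] with ω h0
    have : ‖S.bs 0 ω‖ ^ 4 ≠ 0 := by simpa using h0
    rw [div_self this, one_mul]
  have hb : ∀ {s}, 0 < s → μ.real {ω | ¬Summable fun j => S.termBS j ω} ≤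
      Real.pi ^ 2 * lam * Real.sqrt s / 2 := fun {s} hs => by
    have hm := mul_meas_ge_le_integral_of_nonneg (μ := μ) (f := fun ω => 1 - f s ω)
      (Eventually.of_forall fun ω => sub_nonneg.2 (hf1 hs ω))
      ((integrable_const 1).sub (hfi hs)) 1
    rw [integral_sub (integrable_const 1) (hfi hs), one_mul] at hm
    simp only [integral_const, probReal_univ, smul_eq_mul, one_mul] at hm
    refine (measureReal_mono fun ω hω => ?_).trans (hm.trans (by linarith [hint hs]))
    have hω' : ¬Summable fun j => S.termBS j ω := hω
    simp [f, hω']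
  have hlim : Tendsto (fun s : ℝ => Real.pi ^ 2 * lam * Real.sqrt s / 2) (𝓝[>] 0) (𝓝 0) := by
    have : Continuous fun s : ℝ => Real.pi ^ 2 * lam * Real.sqrt s / 2 := by fun_prop
    simpa using (this.tendsto 0).mono_left nhdsWithin_le_nhds
  have h0 := ge_of_tendsto hlim (eventually_mem_nhdsWithin.mono fun s hs => hb hs)
  rw [ae_iff, ← measureReal_eq_zero_iff]
  exact le_antisymm h0 measureReal_nonneg

/-- All but finitely many stations are at distance at least `2 Rc` from the nearest one. There the
offset at most halves the distance, so a term grows at most by the factor `2 ^ 4 = 16`. -/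
lemma ae_summable_termUser (h : S.IsModel μ lam Rc) (hl : 0 < lam) :
    ∀ᵐ ω ∂μ, Summable fun j => S.termUser j ω := by
  have hfin : ∀ᵐ ω ∂μ, ∀ R : ℕ, {j | S.bs j ω ∈ Metric.ball (0 : Plane) R}.Finite :=
    ae_all_iff.2 fun R => h.bs_poisson.ae_finite measurableSet_ball measure_ball_lt_top
  have hu : ∀ᵐ ω ∂μ, ∀ j k, ‖S.user j k ω‖ ≤ Rc :=
    ae_all_iff.2 fun j => ae_all_iff.2 fun k => h.ae_norm_user_le j k
  filter_upwards [h.ae_summable_termBS hl, hfin, hu, h.bs_poisson.ae_ne_nearest hl h.bs_ordered]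
    with ω hs hf hu hne
  obtain ⟨R, hR⟩ := exists_nat_gt (2 * Rc + ‖S.bs 0 ω‖)
  refine Summable.of_norm_bounded_eventually (hs.mul_left 16) ?_
  refine ((hf R).preimage (Nat.succ_injective.injOn)).subset fun j hj => ?_
  by_contra hnot
  apply hj
  have hnot' : (R : ℝ) ≤ ‖S.bs (j + 1) ω‖ := by simpa using hnot
  change ‖S.termUser j ω‖ ≤ 16 * S.termBS j ω
  rw [Real.norm_of_nonneg (S.termUser_nonneg j ω)]
  have hd : 0 < ‖S.bs (j + 1) ω - S.bs 0 ω‖ := norm_pos_iff.2 (sub_ne_zero.2 (hne j))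
  have h1 : 2 * Rc ≤ ‖S.bs (j + 1) ω - S.bs 0 ω‖ := by
    linarith [norm_sub_norm_le (S.bs (j + 1) ω) (S.bs 0 ω)]
  set u := S.user (j + 1) (S.best (j + 1) ω) ω with hu'
  have h2 : ‖S.bs (j + 1) ω - S.bs 0 ω‖ ≤ 2 * ‖u + S.bs (j + 1) ω - S.bs 0 ω‖ := by
    have h3 : ‖S.bs (j + 1) ω - S.bs 0 ω‖ ≤ ‖u + S.bs (j + 1) ω - S.bs 0 ω‖ + ‖u‖ := by
      have := norm_sub_le (u + S.bs (j + 1) ω - S.bs 0 ω) u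
      rwa [show u + S.bs (j + 1) ω - S.bs 0 ω - u = S.bs (j + 1) ω - S.bs 0 ω by abel] at this
    linarith [hu (j + 1) (S.best (j + 1) ω)]
  have h4 := pow_le_pow_left₀ hd.le h2 4
  rw [mul_pow] at h4
  rw [termUser, termBS, ← hu', ← mul_div_assoc, div_le_div_iff₀ (by
    have : 0 < ‖S.bs (j + 1) ω - S.bs 0 ω‖ ^ 4 := by positivity
    linarith) (by positivity)]
  nlinarith [S.fade_nonneg (j + 1) ω]

/-- The total interference at the nearest base station, with all interfering users at their base
stations. -/
lemma integral_exp_neg_interference (h : S.IsModel μ lam Rc) (hl : 0 < lam) {φ s : ℝ}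
    (hφ : 0 < φ) (hs : 0 < s) :
    ∫ ω, Real.exp (-(s * (S.interCoMP 4 φ 0 ω + S.interCellBS 4 0 ω))) ∂μ =
      Real.exp (-(Real.pi ^ 2 * lam * Real.sqrt s / 2)) *
        ∫ d in Ioi (0 : ℝ), nearestIntegrand lam φ s d := by
  rw [← h.bs_poisson.integral_nearest_pathLoss_eq hl h.bs_ordered hφ hs,
    ← h.integral_exp_neg_total hl hφ.le hs]
  refine integral_congr_ae ?_
  filter_upwards [h.ae_summable_termBS hl, h.ae_selected_eq] with ω hω hsel
  simp only [hω, if_true]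
  rw [S.interCoMP_eq, S.interCellBS_eq hsel, ← Real.exp_add]
  ring_nf

end IsModel

end Network

/-! ### Multinomial expansion of the approximate distribution function. -/

section Expansion

lemma chebCDF_eq_sum (Rc : ℝ) (N : ℕ) (z : ℝ) :
    chebCDF 4 Rc N z =
      ∑ n : Fin (N + 1), signedWeight N n * Real.exp (-(extRate 4 Rc N n * z)) := by
  have e := Finset.sum_Ico_add' (fun n => chebWeight N n * Real.exp (-(chebRate 4 Rc N n * z))) 0 N 1
  rw [zero_add, Nat.Ico_zero_eq_range] at e
  rw [Fin.sum_univ_succ, chebCDF, show Finset.Icc 1 N = Finset.Ico 1 (N + 1) from rfl, ← e,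
    Finset.sum_range]
  simp [signedWeight, extRate, sub_eq_add_neg]

/-- Counting the constant `1` as the term of rate `0`, the approximation is a signed sum of
exponentials. Its power is again one, with rates `μ`, so only Laplace transforms of `I` remain to be
averaged. -/
lemma chebCDF_pow_eq_sum (Rc : ℝ) (N K : ℕ) (ε I c : ℝ) :
    chebCDF 4 Rc N (ε * (I + c)) ^ K =
      ∑ k ∈ Finset.piAntidiag (Finset.univ : Finset (Fin (N + 1))) K,
        (Nat.multinomial Finset.univ k : ℝ) *
        (∏ n : Fin (N + 1), signedWeight N n ^ k n *
          Real.exp (-((k n : ℝ) * extRate 4 Rc N n * ε * c))) *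
        Real.exp (-(ε * totalRate 4 Rc N k * I)) := by
  rw [chebCDF_eq_sum, Finset.sum_pow_eq_sum_piAntidiag]
  refine Finset.sum_congr rfl fun k _ => ?_
  rw [mul_assoc]
  congr 1
  have : Real.exp (-(ε * totalRate 4 Rc N k * I)) =
      ∏ n : Fin (N + 1), Real.exp (-(ε * ((k n : ℝ) * extRate 4 Rc N n) * I)) := by
    rw [← Real.exp_sum, totalRate, Finset.mul_sum, Finset.sum_mul, Finset.sum_neg_distrib]
  rw [this, ← Finset.prod_mul_distrib]
  refine Finset.prod_congr rfl fun n _ => ?_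
  rw [mul_pow, ← Real.exp_nat_mul, mul_assoc, ← Real.exp_add]
  ring_nf

lemma chebRate_pos {Rc : ℝ} (hR : 0 < Rc) {N n : ℕ} (hn : 1 ≤ n) (hnN : n ≤ N) :
    0 < chebRate 4 Rc N n := by
  have hN : (0 : ℝ) < 2 * N := by have : 0 < N := by omega
                                  positivity
  have h1 : (1 : ℝ) ≤ n := by exact_mod_cast hn
  have h2 : (n : ℝ) ≤ N := by exact_mod_cast hnN
  have hx : (2 * (n : ℝ) - 1) / (2 * (N : ℝ)) * Real.pi < Real.pi :=
    mul_lt_of_lt_one_left Real.pi_pos ((div_lt_one hN).2 (by linarith))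
  have hx0 : 0 ≤ (2 * (n : ℝ) - 1) / (2 * (N : ℝ)) * Real.pi :=
    mul_nonneg (div_nonneg (by linarith) hN.le) Real.pi_pos.le
  have hc : -1 < chebNode N n := by
    rw [← Real.cos_pi]
    exact Real.cos_lt_cos_of_nonneg_of_le_pi hx0 le_rfl hx
  exact Real.rpow_pos_of_pos (by nlinarith) 4

lemma extRate_nonneg {Rc : ℝ} (hR : 0 < Rc) {N n : ℕ} (hn : n ≤ N) : 0 ≤ extRate 4 Rc N n := by
  unfold extRate
  split_ifs with h
  · exact le_rfl
  · exact (chebRate_pos hR (Nat.one_le_iff_ne_zero.2 h) hn).le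

lemma totalRate_nonneg {Rc : ℝ} (hR : 0 < Rc) (N : ℕ) (k : Fin (N + 1) → ℕ) :
    0 ≤ totalRate 4 Rc N k :=
  Finset.sum_nonneg fun n _ => mul_nonneg (Nat.cast_nonneg _)
    (extRate_nonneg hR (Nat.le_of_lt_succ n.2))

/-- If not all of `K` sits at index `0`, some index with a positive rate is used. The Laplace
transform requires this strict positivity. -/
lemma totalRate_pos {Rc : ℝ} (hR : 0 < Rc) {N K : ℕ} {k : Fin (N + 1) → ℕ}
    (hk : ∑ n, k n = K) (h0 : k 0 ≠ K) : 0 < totalRate 4 Rc N k := by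
  obtain ⟨n, hn0, hn⟩ : ∃ n, n ≠ 0 ∧ k n ≠ 0 := by
    by_contra! hc
    exact h0 (by rw [← hk, Finset.sum_eq_single 0 (fun n _ hn => hc n hn) (by simp)])
  refine Finset.sum_pos' (fun n _ => mul_nonneg (Nat.cast_nonneg _)
    (extRate_nonneg hR (Nat.le_of_lt_succ n.2))) ⟨n, Finset.mem_univ n, ?_⟩
  have hn1 : (n : ℕ) ≠ 0 := fun h => hn0 (Fin.ext h)
  rw [extRate, if_neg hn1]
  exact mul_pos (Nat.cast_pos.2 (Nat.pos_of_ne_zero hn))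
    (chebRate_pos hR (Nat.one_le_iff_ne_zero.2 hn1) (Nat.le_of_lt_succ n.2))

lemma filter_piAntidiag_eq (N K : ℕ) :
    (Finset.piAntidiag (Finset.univ : Finset (Fin (N + 1))) K).filter (fun k => ¬k 0 ≠ K) =
      {Pi.single 0 K} := by
  ext k
  simp only [Finset.mem_filter, Finset.mem_piAntidiag, Finset.mem_univ, implies_true, and_true,
    ne_eq, not_not, Finset.mem_singleton]
  constructor
  · rintro ⟨hs, h0⟩
    rw [Fin.sum_univ_succ, h0] at hs
    have hz : ∑ i : Fin N, k i.succ = 0 := by omega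
    rw [Finset.sum_eq_zero_iff] at hz
    ext n
    refine Fin.cases ?_ (fun i => ?_) n
    · simpa using h0
    · simpa using hz i (Finset.mem_univ i)
  · rintro rfl
    simp

/-- `B(1/2, 1/2) = Γ(1/2)² / Γ(1)`. This identifies the exponent of the formula with `π² λ √s / 2`.
-/
lemma beta_half : ProbabilityTheory.beta (2 / 4) ((4 - 2) / 4) = Real.pi := by
  rw [ProbabilityTheory.beta, show ((2 : ℝ) / 4) = 1 / 2 by norm_num,
    show (((4 : ℝ) - 2) / 4) = 1 / 2 by norm_num, Real.Gamma_one_half_eq,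
    Real.mul_self_sqrt Real.pi_pos.le]
  norm_num [Real.Gamma_one]

end Expansion

namespace Network.IsModel

variable {Ω : Type*} {K : ℕ} [NeZero K] [mΩ : MeasurableSpace Ω] {μ : Measure Ω}
  [IsProbabilityMeasure μ] {S : Network Ω K} {lam Rc : ℝ}

lemma interference_nonneg {φ : ℝ} (hφ : 0 < φ) (ω : Ω) :
    0 ≤ S.interCoMP 4 φ 0 ω + S.interCellBS 4 0 ω := by
  refine add_nonneg ?_ (tsum_nonneg fun j => ?_)
  · rw [S.interCoMP_eq]
    exact div_nonneg (mul_nonneg hφ.le (S.fade_nonneg 0 ω)) (by positivity)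
  · rw [interTermBS, pathLoss_four]; positivity

lemma aemeasurable_interference (h : S.IsModel μ lam Rc) (φ : ℝ) :
    AEMeasurable (fun ω => S.interCoMP 4 φ 0 ω + S.interCellBS 4 0 ω) μ := by
  have h1 := h.measurable_fade 0
  have h2 := h.bs_poisson.measurable_point 0
  have h3 : Measurable fun ω => ∑' j, S.termBS j ω := Measurable.tsum h.measurable_termBS
  refine ⟨fun ω => φ * S.fade 0 ω / ‖S.bs 0 ω‖ ^ 4 + ∑' j, S.termBS j ω,
    by fun_prop, ?_⟩
  filter_upwards [h.ae_selected_eq] with ω hω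
  rw [S.interCoMP_eq, S.interCellBS_eq hω]

lemma integrable_exp_neg_interference (h : S.IsModel μ lam Rc) {φ s : ℝ} (hφ : 0 < φ)
    (hs : 0 ≤ s) :
    Integrable (fun ω => Real.exp (-(s * (S.interCoMP 4 φ 0 ω + S.interCellBS 4 0 ω)))) μ := by
  refine Integrable.of_bound (((h.aemeasurable_interference φ).const_mul s).neg.exp
    ).aestronglyMeasurable 1 (Eventually.of_forall fun ω => ?_)
  rw [Real.norm_of_nonneg (Real.exp_nonneg _), Real.exp_le_one_iff]
  linarith [mul_nonneg hs (interference_nonneg (S := S) hφ ω)]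

lemma integrable_chebCDF_pow (h : S.IsModel μ lam Rc) (hR : 0 < Rc) {φ ε : ℝ} (hφ : 0 < φ)
    (hε : 0 < ε) (N : ℕ) (c : ℝ) :
    Integrable (fun ω => chebCDF 4 Rc N
      (ε * (S.interCoMP 4 φ 0 ω + S.interCellBS 4 0 ω + c)) ^ K) μ := by
  simp only [chebCDF_pow_eq_sum]
  exact integrable_finsetSum _ fun k _ => (h.integrable_exp_neg_interference hφ
    (mul_nonneg hε.le (totalRate_nonneg hR N k))).const_mul _

/-- The formula is the exact average over the interference when the offsets of the interfering
users are neglected and the distribution of the gains is replaced by its quadrature. -/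
lemma integral_chebCDF_pow (h : S.IsModel μ lam Rc) (hl : 0 < lam) (hR : 0 < Rc) {φ ε : ℝ}
    (hφ : 0 < φ) (hε : 0 < ε) (N : ℕ) (ρ : ℝ) :
    ∫ ω, chebCDF 4 Rc N
      (ε * (S.interCoMP 4 φ 0 ω + S.interCellBS 4 0 ω + 1 / ρ)) ^ K ∂μ =
      nearestOutageApprox K N lam Rc ρ φ ε := by
  simp only [chebCDF_pow_eq_sum]
  rw [integral_finsetSum _ fun k _ => (h.integrable_exp_neg_interference hφ
    (mul_nonneg hε.le (totalRate_nonneg hR N k))).const_mul _]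
  simp only [integral_const_mul]
  -- The only index with `k 0 = K` has rate `0` and coefficient `1`; it is the leading `1` of the
  -- formula.
  rw [← Finset.sum_filter_add_sum_filter_not _ (fun k => k 0 ≠ K), filter_piAntidiag_eq,
    Finset.sum_singleton, add_comm, nearestOutageApprox]
  congr 1
  · have e1 : (Nat.multinomial Finset.univ (Pi.single 0 K : Fin (N + 1) → ℕ) : ℝ) = 1 := by
      rw [Nat.multinomial_single]; simp
    have e2 : ∏ n : Fin (N + 1), (signedWeight N n ^ (Pi.single 0 K : Fin (N + 1) → ℕ) n *
        Real.exp (-(((Pi.single 0 K : Fin (N + 1) → ℕ) n : ℝ) * extRate 4 Rc N n * ε *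
          (1 / ρ)))) = 1 := Finset.prod_eq_one fun n _ => by
      by_cases hn : n = 0
      · subst hn; simp [signedWeight, extRate]
      · simp [hn]
    have e3 : totalRate 4 Rc N (Pi.single 0 K) = 0 := Finset.sum_eq_zero fun n _ => by
      by_cases hn : n = 0
      · subst hn; simp [extRate]
      · simp [hn]
    rw [e1, e2, e3]
    simp
  · refine Finset.sum_congr rfl fun k hk => ?_
    rw [Finset.mem_filter, Finset.mem_piAntidiag] at hk
    have hs : 0 < ε * totalRate 4 Rc N k := mul_pos hε (totalRate_pos hR hk.1.1 hk.2)
    rw [h.integral_exp_neg_interference hl hφ hs, beta_half,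
      show ((2 : ℝ) / 4) = 1 / 2 by norm_num, ← Real.sqrt_eq_rpow, ← mul_assoc]
    congr 3
    ring

end Network.IsModel

/-! ### Error bounds. -/

lemma abs_pow_sub_pow_le_of_le_one {a b : ℝ} (ha : 0 ≤ a) (ha1 : a ≤ 1) (hb : 0 ≤ b) (hb1 : b ≤ 1)
    (n : ℕ) : |a ^ n - b ^ n| ≤ n * |a - b| := by
  refine (abs_pow_sub_pow_le a b n).trans ?_
  rw [abs_of_nonneg ha, abs_of_nonneg hb, mul_comm |a - b|]
  exact mul_le_of_le_one_right (by positivity)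
    (pow_le_one₀ (le_max_of_le_left ha) (max_le ha1 hb1))

lemma abs_gainCDF_sub_le_of_comparable {Rc κ t t' : ℝ}
    (h1 : t ≤ κ * t') (h2 : t' ≤ κ * t) (hκ : 1 ≤ κ) :
    |gainCDF Rc t - gainCDF Rc t'| ≤ κ - 1 := by
  rcases le_total t t' with h | h
  · exact abs_gainCDF_sub_le h h2 hκ
  · rw [abs_sub_comm]
    exact abs_gainCDF_sub_le h h1 hκ

/-- The quadrature need not take values in `[0, 1]`. It is within `π² + π` of `gainCDF`, hence the
base `1 + (π² + π)`. -/
lemma abs_gainCDF_pow_sub_chebCDF_pow_le {Rc t : ℝ} (hR : 0 ≤ Rc) (ht : 0 ≤ t) {N : ℕ}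
    (hN : 0 < N) (K : ℕ) :
    |gainCDF Rc t ^ K - chebCDF 4 Rc N t ^ K| ≤
      K * (1 + (Real.pi ^ 2 + Real.pi)) ^ (K - 1) * ((Real.pi ^ 2 + Real.pi) / N) := by
  have hq := abs_chebCDF_sub_gainCDF_le hR ht hN
  have hpi : 0 ≤ Real.pi ^ 2 + Real.pi := by positivity
  have hN1 : (1 : ℝ) ≤ N := by exact_mod_cast hN
  have hle : (Real.pi ^ 2 + Real.pi) / N ≤ Real.pi ^ 2 + Real.pi := div_le_self hpi hN1
  have h1 : |gainCDF Rc t| ≤ 1 := abs_le.2 ⟨by linarith [gainCDF_nonneg (Rc := Rc) ht],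
    gainCDF_le_one⟩
  have h2 : |chebCDF 4 Rc N t| ≤ 1 + (Real.pi ^ 2 + Real.pi) := by
    have := abs_add_le (chebCDF 4 Rc N t - gainCDF Rc t) (gainCDF Rc t)
    rw [sub_add_cancel] at this
    linarith
  refine (abs_pow_sub_pow_le _ _ K).trans ?_
  rw [abs_sub_comm, mul_comm |_ - _|, mul_right_comm]
  gcongr
  exact max_le (h1.trans (by linarith)) h2

/-- Distances to a user and to its base station are comparable in a small cluster. -/
lemma norm_add_pow_four_comparable {E : Type*} [NormedAddCommGroup E] {u v : E} {β : ℝ}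
    (hβ0 : 0 < β) (hβ1 : β < 1) (hu : ‖u‖ ≤ β * ‖v‖) :
    ‖v‖ ^ 4 ≤ ((1 - β) ^ 4)⁻¹ * ‖u + v‖ ^ 4 ∧ ‖u + v‖ ^ 4 ≤ ((1 - β) ^ 4)⁻¹ * ‖v‖ ^ 4 := by
  have hb : 0 < 1 - β := by linarith
  have hb4 : 0 < (1 - β) ^ 4 := by positivity
  have hv := norm_nonneg v
  constructor
  · rw [inv_mul_eq_div, le_div_iff₀ hb4, ← mul_pow]
    have h1 : ‖v‖ ≤ ‖u + v‖ + ‖u‖ := by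
      have := norm_sub_le (u + v) u
      rwa [add_sub_cancel_left] at this
    exact pow_le_pow_left₀ (by positivity) (by linarith) 4
  · rw [inv_mul_eq_div, le_div_iff₀ hb4, ← mul_pow]
    have h1 := norm_add_le u v
    exact pow_le_pow_left₀ (by positivity) (by nlinarith [mul_nonneg hβ0.le hv]) 4

/-- For `s = r ^ 4` a point within `r` of the nearest one contributes a factor at most `1/2`. The
mean product is thus at most `1 - P / 2`, while it is at least `1 - π² λ r² / 2`. -/
lemma IsHPPP.measureReal_exists_norm_sub_lt {Ω : Type*} [MeasurableSpace Ω] {μ : Measure Ω}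
    [IsProbabilityMeasure μ] {lam : ℝ} {X : ℕ → Ω → Plane} (h : IsHPPP μ lam X) (hl : 0 < lam)
    (ho : ∀ᵐ ω ∂μ, Monotone fun i => ‖X i ω‖) {r : ℝ} (hr : 0 < r) :
    μ.real {ω | ∃ j, ‖X (j + 1) ω - X 0 ω‖ < r} ≤ Real.pi ^ 2 * lam * r ^ 2 := by
  have hX := h.measurable_point
  have hs : 0 < r ^ 4 := by positivity
  have key := h.le_integral_nearest_pathLoss hl ho hs
  have hsq : Real.sqrt (r ^ 4) = r ^ 2 := by
    rw [show r ^ 4 = (r ^ 2) ^ 2 by ring, Real.sqrt_sq (by positivity)]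
  rw [hsq] at key
  set D := {ω | ∃ j, ‖X (j + 1) ω - X 0 ω‖ < r} with hD
  have hDm : MeasurableSet D := by
    rw [hD]
    simp only [ofPred_exists]
    exact MeasurableSet.iUnion fun j => measurableSet_lt (by fun_prop) measurable_const
  have hv0 : ∀ x y : Plane, 0 ≤ ‖y - x‖ ^ 4 / (‖y - x‖ ^ 4 + r ^ 4) := fun x y => by positivity
  have hv1 : ∀ x y : Plane, ‖y - x‖ ^ 4 / (‖y - x‖ ^ 4 + r ^ 4) ≤ 1 := fun x y =>
    (div_le_one (by positivity)).2 (by linarith)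
  have hfm : Measurable (Function.uncurry fun (ω : Ω) (y : Plane) =>
      ‖y - X 0 ω‖ ^ 4 / (‖y - X 0 ω‖ ^ 4 + r ^ 4)) := by
    simp only [Function.uncurry_def]; fun_prop
  have hm := measurable_ptProd hfm (X := fun j => X (j + 1)) fun j => hX (j + 1)
  have hDi : Integrable (D.indicator (fun _ => (1 / 2 : ℝ))) μ :=
    (integrable_const _).indicator hDm
  have hle : ∫ ω, ptProd (fun y => ‖y - X 0 ω‖ ^ 4 / (‖y - X 0 ω‖ ^ 4 + r ^ 4))
      (fun j => X (j + 1) ω) ∂μ ≤ ∫ ω, (1 - D.indicator (fun _ => (1 / 2 : ℝ)) ω) ∂μ := by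
    refine integral_mono (Integrable.of_bound hm.aestronglyMeasurable 1
      (Eventually.of_forall fun ω => ?_)) ((integrable_const 1).sub hDi) fun ω => ?_
    · rw [Real.norm_of_nonneg (ptProd_nonneg (hv0 _))]
      exact ptProd_le_one (hv0 _)
    · by_cases hω : ω ∈ D
      · obtain ⟨j, hj⟩ := id hω
        simp only [indicator_of_mem hω]
        refine (ptProd_le_prod (hv0 _) (j + 1)).trans ?_
        rw [Finset.prod_range_succ]
        refine (mul_le_of_le_one_left (hv0 _ _) (Finset.prod_le_one (fun i _ => hv0 _ _)
          fun i _ => hv1 _ _)).trans ?_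
        rw [div_le_iff₀ (by positivity)]
        have := pow_le_pow_left₀ (norm_nonneg _) hj.le 4
        linarith
      · simp only [indicator_of_notMem hω, sub_zero]
        exact ptProd_le_one (hv0 _)
  rw [integral_sub (integrable_const 1) hDi, integral_indicator_const _ hDm] at hle
  simp only [integral_const, probReal_univ, smul_eq_mul, one_mul] at hle
  linarith

namespace Network

variable {Ω : Type*} {K : ℕ} [NeZero K]

/-- The level below which the gain of the NOMA user of the nearest base station causes an outage. -/
def outageLevel (S : Network Ω K) (φ ε c : ℝ) (ω : Ω) : ℝ :=
  ε * (φ * S.fade 0 ω / ‖S.bs 0 ω‖ ^ 4 + ∑' j, S.termUser j ω + c)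

/-- The sources of randomness other than the gains in the nearest cluster. -/
def interferenceSource : Set (Source K) := {s | ∀ k, s ∉ gainSource 0 k}

lemma measurable_outageLevel (S : Network Ω K) (φ ε c : ℝ) :
    Measurable[S.alg interferenceSource] (S.outageLevel φ ε c) := by
  let _ : MeasurableSpace Ω := S.alg interferenceSource
  have h0 : Measurable (S.fade 0) := S.measurable_fade 0 (by
    rintro s (rfl : s = .comp 0) k; simp [gainSource])
  have hf : ∀ j, Measurable (S.fade (j + 1)) := fun j => S.measurable_fade (j + 1) (by
    rintro s ⟨l, rfl | rfl | rfl⟩ k <;> simp [gainSource])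
  have hbs : Measurable fun ω i => S.bs i ω := S.measurable_bs_alg (by
    intro k; simp [gainSource])
  have hb : ∀ i, Measurable (S.bs i) := fun i => (measurable_pi_apply i).comp hbs
  have hbest : ∀ j, Measurable (S.best (j + 1)) := fun j => S.measurable_best_alg _ (by
    rintro l s (rfl | rfl) k <;> simp [gainSource])
  have hu : ∀ j, Measurable fun ω => S.user (j + 1) (S.best (j + 1) ω) ω := fun j =>
    measurable_apply_fin (fun l => S.measurable_user_alg (by intro k; simp [gainSource]))
      (hbest j)
  have ht : ∀ j, Measurable (S.termUser j) := fun j =>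
    (hf j).div ((((hu j).add (hb (j + 1))).sub (hb 0)).norm.pow_const 4)
  exact ((((h0.const_mul φ).div ((hb 0).norm.pow_const 4)).add (Measurable.tsum ht)).add_const
    c).const_mul ε

lemma outageLevel_nonneg (S : Network Ω K) {φ ε c : ℝ} (hφ : 0 ≤ φ) (hε : 0 ≤ ε) (hc : 0 ≤ c)
    (ω : Ω) : 0 ≤ S.outageLevel φ ε c ω := by
  have h1 : 0 ≤ ∑' j, S.termUser j ω := tsum_nonneg fun j => S.termUser_nonneg j ω
  have h2 : 0 ≤ φ * S.fade 0 ω / ‖S.bs 0 ω‖ ^ 4 :=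
    div_nonneg (mul_nonneg hφ (S.fade_nonneg 0 ω)) (by positivity)
  exact mul_nonneg hε (by linarith)

lemma sinr_lt_iff (S : Network Ω K) {φ ε ρ : ℝ} (hφ : 0 < φ) (hρ : 0 < ρ) {ω : Ω}
    (hω : ∀ i, S.selected 4 i ω = S.best i ω) :
    S.sinr 4 ρ φ 0 ω < ε ↔ ∀ k, S.gain 4 0 ω k < S.outageLevel φ ε (1 / ρ) ω := by
  have h1 : 0 ≤ ∑' j, S.termUser j ω := tsum_nonneg fun j => S.termUser_nonneg j ω
  have h2 : 0 ≤ φ * S.fade 0 ω / ‖S.bs 0 ω‖ ^ 4 :=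
    div_nonneg (mul_nonneg hφ.le (S.fade_nonneg 0 ω)) (by positivity)
  have h3 : 0 < 1 / ρ := by positivity
  rw [sinr, S.interCoMP_eq, S.interCell_eq hω, div_lt_iff₀ (by linarith), hω, outageLevel]
  exact ⟨fun h k => (S.gain_le_best 0 ω k).trans_lt h, fun h => h _⟩

namespace IsModel

variable [mΩ : MeasurableSpace Ω] {μ : Measure Ω} [IsProbabilityMeasure μ] {S : Network Ω K}
  {lam Rc : ℝ}

/-- Outage means that the largest gain, hence every gain, of the nearest cluster is below the level.
The level is built from sources other than those gains, so it is independent of them. -/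
lemma nearestOutage_eq (h : S.IsModel μ lam Rc) (hR : 0 < Rc) {φ ε ρ : ℝ} (hφ : 0 < φ)
    (hε : 0 < ε) (hρ : 0 < ρ) :
    S.nearestOutage μ 4 ρ φ ε = ∫ ω, gainCDF Rc (S.outageLevel φ ε (1 / ρ) ω) ^ K ∂μ := by
  rw [← h.measureReal_forall_gain_lt hR 0 (B := interferenceSource) (fun k => ?_)
    (S.measurable_outageLevel φ ε (1 / ρ))
    (S.outageLevel_nonneg hφ.le hε.le (by positivity)), nearestOutage]
  · refine measureReal_congr ?_
    filter_upwards [h.ae_selected_eq] with ω hω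
    exact propext (S.sinr_lt_iff hφ hρ hω)
  · rw [Set.disjoint_left]
    exact fun s hs hB => hB k hs

/-- Unless some base station is close to the nearest one, neglecting the offsets of the
interfering users changes the interference only by a factor close to `1`. -/
lemma ae_abs_gainCDF_pow_sub_le (h : S.IsModel μ lam Rc) (hl : 0 < lam) {φ ε ρ β : ℝ}
    (hφ : 0 < φ) (hε : 0 < ε) (hρ : 0 < ρ) (hβ0 : 0 < β) (hβ1 : β < 1) :
    ∀ᵐ ω ∂μ, (∀ j, Rc ≤ β * ‖S.bs (j + 1) ω - S.bs 0 ω‖) →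
      |gainCDF Rc (S.outageLevel φ ε (1 / ρ) ω) ^ K - gainCDF Rc
        (ε * (S.interCoMP 4 φ 0 ω + S.interCellBS 4 0 ω + 1 / ρ)) ^ K| ≤
      K * (((1 - β) ^ 4)⁻¹ - 1) := by
  have hu : ∀ᵐ ω ∂μ, ∀ j k, ‖S.user j k ω‖ ≤ Rc :=
    ae_all_iff.2 fun j => ae_all_iff.2 fun k => h.ae_norm_user_le j k
  filter_upwards [h.ae_selected_eq, hu, h.ae_summable_termBS hl, h.ae_summable_termUser hl,
    h.bs_poisson.ae_ne_nearest hl h.bs_ordered] with ω hsel hu hsB hsU hne hfar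
  set κ := ((1 - β) ^ 4)⁻¹ with hκ
  have hb : 0 < 1 - β := by linarith
  have hκ1 : 1 ≤ κ := (one_le_inv₀ (by positivity)).2 (pow_le_one₀ hb.le (by linarith))
  have hκ0 : 0 < κ := by linarith
  have hcmp : ∀ j, S.termUser j ω ≤ κ * S.termBS j ω ∧ S.termBS j ω ≤ κ * S.termUser j ω :=
    fun j => by
    have hd : 0 < ‖S.bs (j + 1) ω - S.bs 0 ω‖ := norm_pos_iff.2 (sub_ne_zero.2 (hne j))
    obtain ⟨h1, h2⟩ := norm_add_pow_four_comparable hβ0 hβ1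
      ((hu (j + 1) (S.best (j + 1) ω)).trans (hfar j))
    rw [← add_sub_assoc, ← hκ] at h1 h2
    have hd4 : 0 < ‖S.bs (j + 1) ω - S.bs 0 ω‖ ^ 4 := by positivity
    -- The comparison itself rules out a user located exactly at the nearest station.
    have hd' : 0 < ‖S.user (j + 1) (S.best (j + 1) ω) ω + S.bs (j + 1) ω - S.bs 0 ω‖ ^ 4 :=
      pos_of_mul_pos_right (hd4.trans_le h1) hκ0.le
    have hf := S.fade_nonneg (j + 1) ω
    rw [termUser, termBS, ← mul_div_assoc, ← mul_div_assoc, div_le_div_iff₀ hd' hd4,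
      div_le_div_iff₀ hd4 hd']
    constructor <;> nlinarith
  have hB0 : 0 ≤ ∑' j, S.termBS j ω := tsum_nonneg fun j => S.termBS_nonneg j ω
  have hU0 : 0 ≤ ∑' j, S.termUser j ω := tsum_nonneg fun j => S.termUser_nonneg j ω
  have hUB : ∑' j, S.termUser j ω ≤ κ * ∑' j, S.termBS j ω := by
    rw [← tsum_mul_left]
    exact hsU.tsum_le_tsum (fun j => (hcmp j).1) (hsB.mul_left κ)
  have hBU : ∑' j, S.termBS j ω ≤ κ * ∑' j, S.termUser j ω := by
    rw [← tsum_mul_left]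
    exact hsB.tsum_le_tsum (fun j => (hcmp j).2) (hsU.mul_left κ)
  have hc : 0 ≤ φ * S.fade 0 ω / ‖S.bs 0 ω‖ ^ 4 :=
    div_nonneg (mul_nonneg hφ.le (S.fade_nonneg 0 ω)) (by positivity)
  have hρ' : 0 < 1 / ρ := by positivity
  rw [S.interCoMP_eq, S.interCellBS_eq hsel, outageLevel]
  set c := φ * S.fade 0 ω / ‖S.bs 0 ω‖ ^ 4
  have hT : 0 ≤ ε * (c + ∑' j, S.termUser j ω + 1 / ρ) := mul_nonneg hε.le (by linarith)
  have hT' : 0 ≤ ε * (c + ∑' j, S.termBS j ω + 1 / ρ) := mul_nonneg hε.le (by linarith)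
  refine (abs_pow_sub_pow_le_of_le_one (gainCDF_nonneg hT) gainCDF_le_one (gainCDF_nonneg hT')
    gainCDF_le_one K).trans (mul_le_mul_of_nonneg_left
    (abs_gainCDF_sub_le_of_comparable ?_ ?_ hκ1) (Nat.cast_nonneg K))
  -- The CoMP term and the noise are nonnegative and `κ ≥ 1`, so adding them preserves comparability
  -- up to the factor `κ`.
  · rw [mul_left_comm]
    exact mul_le_mul_of_nonneg_left (by nlinarith) hε.le
  · rw [mul_left_comm]
    exact mul_le_mul_of_nonneg_left (by nlinarith) hε.le

/-- An explicit bound on the error of the formula. -/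
theorem abs_nearestOutage_sub_le (h : S.IsModel μ lam Rc) (hl : 0 < lam) (hR : 0 < Rc)
    {φ ε ρ β : ℝ} (hφ : 0 < φ) (hε : 0 < ε) (hρ : 0 < ρ) (hβ0 : 0 < β) (hβ1 : β < 1) {N : ℕ}
    (hN : 0 < N) :
    |S.nearestOutage μ 4 ρ φ ε - nearestOutageApprox K N lam Rc ρ φ ε| ≤
      K * (((1 - β) ^ 4)⁻¹ - 1) + Real.pi ^ 2 * lam * (Rc / β) ^ 2 +
      K * (1 + (Real.pi ^ 2 + Real.pi)) ^ (K - 1) * ((Real.pi ^ 2 + Real.pi) / N) := by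
  have hbs := h.bs_poisson.measurable_point
  let T : Ω → ℝ := S.outageLevel φ ε (1 / ρ)
  let T' : Ω → ℝ := fun ω => ε * (S.interCoMP 4 φ 0 ω + S.interCellBS 4 0 ω + 1 / ρ)
  have hT0 : ∀ ω, 0 ≤ T ω := S.outageLevel_nonneg hφ.le hε.le (by positivity)
  have hT0' : ∀ ω, 0 ≤ T' ω := fun ω => mul_nonneg hε.le
    (add_nonneg (interference_nonneg hφ ω) (by positivity))
  have hTm : AEMeasurable T μ :=
    (h.measurable_of_alg (S.measurable_outageLevel φ ε (1 / ρ))).aemeasurable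
  have hTm' : AEMeasurable T' μ :=
    ((h.aemeasurable_interference φ).add_const _).const_mul ε
  have hint : ∀ U : Ω → ℝ, AEMeasurable U μ → (∀ ω, 0 ≤ U ω) →
      Integrable (fun ω => gainCDF Rc (U ω) ^ K) μ := fun U hU hU0 =>
    Integrable.of_bound
      ((((continuous_gainCDF Rc).measurable.comp_aemeasurable hU).pow_const K
        ).aestronglyMeasurable) 1 (Eventually.of_forall fun ω => by
        rw [Real.norm_of_nonneg (pow_nonneg (gainCDF_nonneg (hU0 ω)) K)]
        exact pow_le_one₀ (gainCDF_nonneg (hU0 ω)) gainCDF_le_one)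
  -- On `D` some station is too close for the comparison. There the integrands, both in `[0, 1]`,
  -- differ by at most `1`, so `D` costs its probability.
  set D := {ω | ∃ j, ‖S.bs (j + 1) ω - S.bs 0 ω‖ < Rc / β} with hD
  have hDm : MeasurableSet D := by
    rw [hD]
    simp only [ofPred_exists]
    exact MeasurableSet.iUnion fun j => measurableSet_lt (by fun_prop) measurable_const
  have hκ : 0 ≤ (K : ℝ) * (((1 - β) ^ 4)⁻¹ - 1) := by
    have hb : 0 < 1 - β := by linarith
    have := (one_le_inv₀ (by positivity)).2 (pow_le_one₀ (n := 4) hb.le (by linarith))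
    exact mul_nonneg (Nat.cast_nonneg K) (by linarith)
  have h1 : |∫ ω, gainCDF Rc (T ω) ^ K ∂μ - ∫ ω, gainCDF Rc (T' ω) ^ K ∂μ| ≤
      K * (((1 - β) ^ 4)⁻¹ - 1) + Real.pi ^ 2 * lam * (Rc / β) ^ 2 := by
    have hDi : Integrable (D.indicator (fun _ => (1 : ℝ))) μ :=
      (integrable_const _).indicator hDm
    rw [← integral_sub (hint T hTm hT0) (hint T' hTm' hT0'), ← Real.norm_eq_abs]
    refine (norm_integral_le_of_norm_le ((integrable_const _).add hDi) (f := fun ω =>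
      gainCDF Rc (T ω) ^ K - gainCDF Rc (T' ω) ^ K)
      (g := fun ω => K * (((1 - β) ^ 4)⁻¹ - 1) + D.indicator (fun _ => (1 : ℝ)) ω) ?_).trans ?_
    · filter_upwards [h.ae_abs_gainCDF_pow_sub_le hl hφ hε hρ hβ0 hβ1] with ω hω
      rw [Real.norm_eq_abs]
      by_cases hωD : ω ∈ D
      · rw [indicator_of_mem hωD]
        have a1 := pow_nonneg (gainCDF_nonneg (Rc := Rc) (hT0 ω)) K
        have a2 := pow_nonneg (gainCDF_nonneg (Rc := Rc) (hT0' ω)) K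
        have a3 : gainCDF Rc (T ω) ^ K ≤ 1 := pow_le_one₀ (gainCDF_nonneg (hT0 ω)) gainCDF_le_one
        have a4 : gainCDF Rc (T' ω) ^ K ≤ 1 :=
          pow_le_one₀ (gainCDF_nonneg (hT0' ω)) gainCDF_le_one
        exact abs_le.2 ⟨by linarith, by linarith⟩
      · rw [indicator_of_notMem hωD, add_zero]
        refine hω fun j => ?_
        have : Rc / β ≤ ‖S.bs (j + 1) ω - S.bs 0 ω‖ := by
          by_contra hc
          exact hωD ⟨j, not_le.1 hc⟩
        rwa [div_le_iff₀' hβ0] at this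
    · rw [integral_add (integrable_const _) hDi, integral_indicator_const _ hDm]
      simp only [integral_const, probReal_univ, smul_eq_mul, one_mul, mul_one]
      exact add_le_add_right (h.bs_poisson.measureReal_exists_norm_sub_lt hl h.bs_ordered
        (div_pos hR hβ0)) _
  have h2 : |∫ ω, gainCDF Rc (T' ω) ^ K ∂μ - ∫ ω, chebCDF 4 Rc N (T' ω) ^ K ∂μ| ≤
      K * (1 + (Real.pi ^ 2 + Real.pi)) ^ (K - 1) * ((Real.pi ^ 2 + Real.pi) / N) := by
    rw [← integral_sub (hint T' hTm' hT0') (h.integrable_chebCDF_pow hR hφ hε N (1 / ρ)),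
      ← Real.norm_eq_abs]
    refine (norm_integral_le_of_norm_le_const (Eventually.of_forall fun ω =>
      abs_gainCDF_pow_sub_chebCDF_pow_le hR.le (hT0' ω) hN K)).trans ?_
    simp
  rw [h.nearestOutage_eq hR hφ hε hρ, ← h.integral_chebCDF_pow hl hR hφ hε N ρ]
  exact (abs_sub_le _ (∫ ω, gainCDF Rc (T' ω) ^ K ∂μ) _).trans (add_le_add h1 h2)

end IsModel

end Network

lemma exists_offset_ratio (K : ℕ) {η : ℝ} (hη : 0 < η) :
    ∃ β : ℝ, 0 < β ∧ β < 1 ∧ K * (((1 - β) ^ 4)⁻¹ - 1) < η := by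
  have hc : ContinuousAt (fun β : ℝ => (K : ℝ) * (((1 - β) ^ 4)⁻¹ - 1)) 0 := by
    refine continuousAt_const.mul (ContinuousAt.sub (ContinuousAt.inv₀ (by fun_prop) (by norm_num))
      continuousAt_const)
  have h0 : ∀ᶠ β in 𝓝[>] (0 : ℝ), (K : ℝ) * (((1 - β) ^ 4)⁻¹ - 1) < η :=
    (hc.tendsto.mono_left nhdsWithin_le_nhds).eventually_lt_const (by simpa using hη)
  obtain ⟨β, h1, h2⟩ := (h0.and (Ioo_mem_nhdsGT one_pos)).exists
  exact ⟨β, h2.1, h2.2, h1⟩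
end

theorem proposition1 (K : ℕ) [NeZero K] :
    -- the integrals over `d` in the formula converge
    (∀ (lam φ s : ℝ), 0 < lam → 0 < φ → 0 < s →
      IntegrableOn (nearestIntegrand lam φ s) (Ioi (0 : ℝ))) ∧
    -- the interference is almost surely finite, and the formula is the exact average over all
    -- interference once the offsets of the interfering users are neglected and the distribution
    -- function of the channel gain is replaced by its Gauss–Chebyshev approximation
    (∀ (Ω : Type*) [MeasurableSpace Ω] (μ : Measure Ω) [IsProbabilityMeasure μ]
      (S : Network Ω K) (lam Rc ρ φ R : ℝ) (N : ℕ),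
      0 < lam → 0 < Rc → 0 < ρ → 0 < φ → 0 < R → 1 ≤ N → S.IsModel μ lam Rc →
      (∀ᵐ ω ∂μ, Summable (fun j : {j : ℕ // j ≠ 0} => S.interTerm 4 0 j ω)) ∧
      (∀ᵐ ω ∂μ, Summable (fun j : {j : ℕ // j ≠ 0} => S.interTermBS 4 0 j ω)) ∧
      Integrable (fun ω => chebCDF 4 Rc N ((2 ^ R - 1) *
        (S.interCoMP 4 φ 0 ω + S.interCellBS 4 0 ω + 1 / ρ)) ^ K) μ ∧
      ∫ ω, chebCDF 4 Rc N ((2 ^ R - 1) *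
          (S.interCoMP 4 φ 0 ω + S.interCellBS 4 0 ω + 1 / ρ)) ^ K ∂μ =
        nearestOutageApprox K N lam Rc ρ φ (2 ^ R - 1)) ∧
    -- the formula approximates the true outage probability, uniformly in all other parameters,
    -- when the quadrature is fine and clusters are small compared to base station distances
    (∀ η : ℝ, 0 < η → ∃ δ : ℝ, 0 < δ ∧ ∃ N₀ : ℕ,
      ∀ (Ω : Type*) [MeasurableSpace Ω] (μ : Measure Ω) [IsProbabilityMeasure μ]
        (S : Network Ω K) (lam Rc ρ φ R : ℝ) (N : ℕ),
        0 < lam → 0 < Rc → 0 < ρ → 0 < φ → 0 < R → N₀ ≤ N → Rc * Real.sqrt lam < δ →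
        S.IsModel μ lam Rc →
        |S.nearestOutage μ 4 ρ φ (2 ^ R - 1) -
          nearestOutageApprox K N lam Rc ρ φ (2 ^ R - 1)| < η) := by
  have hε : ∀ R : ℝ, 0 < R → (0 : ℝ) < 2 ^ R - 1 := fun R hR =>
    sub_pos.2 (Real.one_lt_rpow one_lt_two hR)
  refine ⟨fun lam φ s hl hφ hs => integrableOn_nearestIntegrand hl hφ hs,
    fun Ω _ μ _ S lam Rc ρ φ R N hl hRc hρ hφ hR hN h => ⟨?_, ?_,
      h.integrable_chebCDF_pow hRc hφ (hε R hR) N (1 / ρ),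
      h.integral_chebCDF_pow hl hRc hφ (hε R hR) N ρ⟩, fun η hη => ?_⟩
  · filter_upwards [h.ae_selected_eq, h.ae_summable_termUser hl] with ω hω hs
    rw [summable_ne_zero_iff (f := fun j => S.interTerm 4 0 j ω)]
    simpa only [S.interTerm_eq hω] using hs
  · filter_upwards [h.ae_selected_eq, h.ae_summable_termBS hl] with ω hω hs
    rw [summable_ne_zero_iff (f := fun j => S.interTermBS 4 0 j ω)]
    simpa only [S.interTermBS_eq hω] using hs
  -- Each of the three errors gets `η / 3`: first `β` for the offsets, then `N₀` for the quadrature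
  -- and `δ`, depending on `β`, for close stations.
  · have hη3 : 0 < η / 3 := by positivity
    obtain ⟨β, hβ0, hβ1, hβ⟩ := exists_offset_ratio K hη3
    have hpi := Real.pi_pos
    have hsq : 0 < Real.sqrt (η / 3) := Real.sqrt_pos.2 hη3
    have hlim : Filter.Tendsto (fun N : ℕ => (K : ℝ) * (1 + (Real.pi ^ 2 + Real.pi)) ^ (K - 1) *
        ((Real.pi ^ 2 + Real.pi) / N)) Filter.atTop (nhds 0) := by
      simpa using (tendsto_const_div_atTop_nhds_zero_nat (Real.pi ^ 2 + Real.pi)).const_mul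
        ((K : ℝ) * (1 + (Real.pi ^ 2 + Real.pi)) ^ (K - 1))
    obtain ⟨N₀, hN₀⟩ := Filter.eventually_atTop.1
      ((hlim.eventually_lt_const hη3).and (Filter.eventually_gt_atTop 0))
    -- This `δ` is the solution of `(π δ / β)² = η / 3`, since `π² λ (Rc / β)² = (π Rc √λ / β)²`.
    refine ⟨β * Real.sqrt (η / 3) / Real.pi, by positivity, N₀, ?_⟩
    intro Ω _ μ _ S lam Rc ρ φ R N hl hRc hρ hφ hR hN hδ h
    have hδ' : Real.pi ^ 2 * lam * (Rc / β) ^ 2 < η / 3 := by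
      rw [lt_div_iff₀ hpi] at hδ
      have h1 : Rc * Real.sqrt lam * Real.pi / β < Real.sqrt (η / 3) := by
        rwa [div_lt_iff₀' hβ0]
      have h2 := pow_lt_pow_left₀ h1 (by positivity) two_ne_zero
      rw [Real.sq_sqrt hη3.le, div_pow, mul_pow, mul_pow, Real.sq_sqrt hl.le] at h2
      calc _ = Rc ^ 2 * lam * Real.pi ^ 2 / β ^ 2 := by ring
        _ < _ := h2
    have := h.abs_nearestOutage_sub_le hl hRc hφ (hε R hR) hρ hβ0 hβ1 (hN₀ N hN).2
    linarith [(hN₀ N hN).1]
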